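/- **Setting.** Let $\mathbb{R}^n$ carry the inner product $\langle x,y\rangle=x^TBy$ ($B$ positive definite) with norm $\|\cdot\|_2$, let $\mathbb{R}^m$ carry the dot product, and let $A:\mathbb{R}^n\to\mathbb{R}^m$ be linear with adjoint $A^*$. Let $\|\cdot\|$ be a norm on $\mathbb{R}^n$ with dual norm $\|y\|_*=\sup\{\langle y,x\rangle:\|x\|\le 1\}$ such that (i) every extreme point $a$ of $\{\|x\|\le1\}$ satisfies $\|a\|_2=1$, and (ii) for each $x$ there are a subspace $T_x$ and $e_x\in T_x$ with $\partial\|x\|=\{e_x+v: v\in T_x^\perp,\ \|v\|_*\le1\}$. Put $K(x)=\|e_x\|_2^2$. For $k>0$ let $\rho_+(A,k)$ (resp. $\rho_-(A,k)$) be the smallest (resp. largest) constant $\rho\ge0$ with $\|Ax\|_2^2\le\rho\|x\|_2^2$ (resp. $\ge$) for all $x$ with $\|x\|^2\le k\|x\|_2^2$. Let $b=Ax_0+z$ with $x_0\ne0$, $k_0=K(x_0)$, $c=\max_{x\in T_{x_0}\setminus\{0\}}\frac{\|x\|^2}{k_0\|x\|_2^2}$, $f(x)=\frac12\|Ax-b\|_2^2$,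 $\phi_\lambda(x)=f(x)+\lambda\|x\|$, $$m_{\lambda,L}(y,x)=f(y)+\langle\nabla f(y),x-y\rangle+\tfrac L2\|x-y\|_2^2+\lambda\|x\|,\qquad \mathrm{Prox}_{\lambda,L}(y)=\arg\min_x m_{\lambda,L}(y,x).$$ **Algorithm.** Parameters: $\eta,\delta'\in(0,1)$, $L_{\min}>0$, $\gamma_{\rm dec}\ge1$, $\gamma_{\rm inc}>1$; inputs: $\lambda_{\rm tgt},\epsilon>0$. *ProxGrad* with parameter $\lambda$, started at $x^{(0)}$ and $L_0$, with tolerance $\epsilon'$: in iteration $t+1$ $(t=0,1,\dots)$ let $M_{t+1}$ be the first $L$ among $L_t,\gamma_{\rm inc}L_t,\gamma_{\rm inc}^2L_t,\dots$ with $\phi_\lambda(\mathrm{Prox}_{\lambda,L}(x^{(t)}))\le m_{\lambda,L}(x^{(t)},\mathrm{Prox}_{\lambda,L}(x^{(t)}))$, and set $x^{(t+1)}=\mathrm{Prox}_{\lambda,M_{t+1}}(x^{(t)})$, $L_{t+1}=\max\{L_{\min},M_{t+1}/\gamma_{\rm dec}\}$; stop after the first iteration with $$\|M_{t+1}(x^{(t)}-x^{(t+1)})+\nabla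 f(x^{(t+1)})-\nabla f(x^{(t)})\|_*\le\epsilon'$$ and return $x^{(t+1)},M_{t+1}$. *Homotopy*: $y^{(0)}=0$, $M=L_{\min}$, $\lambda_0=\|A^*b\|_*$, $\lambda_t=\lambda_0\eta^t$, $N=\lfloor\log(\lambda_{\rm tgt}/\lambda_0)/\log\eta\rfloor$. For $t=0,\dots,N-1$, ProxGrad with parameter $\lambda_{t+1}$, started at $y^{(t)}$ and the current $M$, with tolerance $\delta'\lambda_{t+1}$, returns $y^{(t+1)}$ and the new $M$. Finally ProxGrad with parameter $\lambda_{\rm tgt}$, started at $y^{(N)}$ and $M$, with tolerance $\epsilon$, returns the output $y$. **Theorem.** Suppose $\lambda_{\rm tgt}\ge4\|A^*z\|_*$ and that there are $r>1$ and $\delta\in(0,\frac14]$ such that, with $$\gamma=\frac{\lambda_{\rm tgt}(1+\delta)+\|A^*z\|_*}{\lambda_{\rm tgt}(1-\delta)-\|A^*z\|_*},\qquad \tilde k=36\,r\,c\,k_0(1+\gamma)\gamma_{\rm inc},$$ one has $$\frac{\rho_-(A,ck_0(1+\gamma)^2)}{\rho_+(A,2\tilde k)}>\frac cr,\qquad \rho_-(A,2\tilde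 k)>0.$$ Suppose also $L_{\min}\le\gamma_{\rm inc}\rho_+(A,2\tilde k)$, $\lambda_0\ge\lambda_{\rm tgt}$ and $\frac{1+\delta'}{1+\delta}\le\eta$. Let $\kappa=\rho_+(A,2\tilde k)/\rho_-(A,2\tilde k)$, $\Theta=\log\big(1-\frac1{4\gamma_{\rm inc}\kappa}\big)^{-1}$ and $$C=\frac{6\gamma_{\rm inc}\kappa\,\delta\,c\,k_0(1+\gamma)\Big(\sqrt{\rho_-(A,2\tilde k)}+\sqrt{\rho_+(A,1)\,\kappa}\Big)^2}{\rho_-(A,ck_0(1+\gamma)^2)}.$$ Then the algorithm terminates, and: 1. for each $t=0,\dots,N-1$, the number of proximal-gradient iterations for computing $y^{(t+1)}$ from $y^{(t)}$ is at most $\log(C/\delta'^2)/\Theta$; 2. the number of proximal-gradient iterations for computing $y$ from $y^{(N)}$ is at most $\max\{1,\ \log(C\lambda_{\rm tgt}^2/\epsilon^2)/\Theta\}$; 3. for every minimizer $y^*$ of $\phi_{\lambda_{\rm tgt}}$, $$\phi_{\lambda_{\rm tgt}}(y)-\phi_{\lambda_{\rm tgt}}(y^*)\le\frac{9\,c\,k_0\,\lambda_{\rm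 tgt}(1+\gamma)\,\epsilon}{\rho_-(A,ck_0(1+\gamma)^2)};$$ 4. the total number of proximal-gradient iterations is at most $$\max\Big\{1,\frac{\log(C\lambda_{\rm tgt}^2/\epsilon^2)}{\Theta}\Big\}+\frac{\log(\lambda_{\rm tgt}/\lambda_0)}{\log\eta}\cdot\frac{\log(C/\delta'^2)}{\Theta}.$$ -/

import Mathlib

open scoped BigOperators

noncomputable section

namespace ProxHomotopy

/-! ### The regularizing norm: dual norm, subdifferential, decomposability

`E` is a finite-dimensional real inner product space, that is, `ℝⁿ` with the inner product
`xᵀ B y` of a positive definite matrix `B`; `‖·‖` is its inner-product norm. -/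

section Norms

variable {E : Type*} [NormedAddCommGroup E] [InnerProductSpace ℝ E]

/-- The dual of the norm `p`. -/
def dualNorm (p : Seminorm ℝ E) (y : E) : ℝ :=
  sSup {s : ℝ | ∃ x : E, p x ≤ 1 ∧ s = inner ℝ y x}

/-- The subdifferential of the norm `p` at `x`. -/
def subdiff (p : Seminorm ℝ E) (x : E) : Set E :=
  {ξ : E | ∀ y : E, p x + inner ℝ ξ (y - x) ≤ p y}

/-- All extreme points of the unit ball of `p` have inner-product norm one. -/
def UnitExtremePoints (p : Seminorm ℝ E) : Prop :=
  ∀ a ∈ Set.extremePoints ℝ {x : E | p x ≤ 1}, ‖a‖ = 1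

/-- Decomposability: at each `x` there are a subspace `T` and a vector `e ∈ T` such that the
subdifferential at `x` consists of all `e + v` with `v ∈ Tᗮ` in the dual unit ball. -/
def Decomposable (p : Seminorm ℝ E) : Prop :=
  ∀ x : E, ∃ T : Submodule ℝ E, ∃ e : E, e ∈ T ∧
    subdiff p x = {w : E | ∃ v ∈ Tᗮ, dualNorm p v ≤ 1 ∧ w = e + v}

/-- The subspace `T_x` of a decomposable norm. (It is determined by `x`: its orthogonal
complement is the direction of the affine hull of the subdifferential.) -/
def tangent {p : Seminorm ℝ E} (h : Decomposable p) (x : E) : Submodule ℝ E :=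
  (h x).choose

/-- The vector `e_x` of a decomposable norm. (It is determined by `x`: it is the element of
smallest norm in the subdifferential.) -/
def signVec {p : Seminorm ℝ E} (h : Decomposable p) (x : E) : E :=
  (h x).choose_spec.choose

/-- The generalized cardinality `K(x) = ‖e_x‖²`. -/
def card {p : Seminorm ℝ E} (h : Decomposable p) (x : E) : ℝ :=
  ‖signVec h x‖ ^ 2

/-- The constant `c`: the maximum of `p(x)² / (K(x₀) ‖x‖²)` over nonzero `x ∈ T_{x₀}`. -/
def constC {p : Seminorm ℝ E} (h : Decomposable p) (x₀ : E) : ℝ :=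
  sSup {s : ℝ | ∃ x ∈ tangent h x₀, x ≠ 0 ∧ s = p x ^ 2 / (card h x₀ * ‖x‖ ^ 2)}

variable {F : Type*} [NormedAddCommGroup F] [InnerProductSpace ℝ F]

/-- The upper restricted isometry constant `ρ₊(A, k)`. -/
def rhoPlus (p : Seminorm ℝ E) (A : E →ₗ[ℝ] F) (k : ℝ) : ℝ :=
  sInf {ρ : ℝ | 0 ≤ ρ ∧ ∀ x : E, p x ^ 2 ≤ k * ‖x‖ ^ 2 → ‖A x‖ ^ 2 ≤ ρ * ‖x‖ ^ 2}

/-- The lower restricted isometry constant `ρ₋(A, k)`. -/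
def rhoMinus (p : Seminorm ℝ E) (A : E →ₗ[ℝ] F) (k : ℝ) : ℝ :=
  sSup {ρ : ℝ | 0 ≤ ρ ∧ ∀ x : E, p x ^ 2 ≤ k * ‖x‖ ^ 2 → ρ * ‖x‖ ^ 2 ≤ ‖A x‖ ^ 2}

end Norms

/-! ### The regularized least squares problem -/

/-- Data of the problem: the measurement map `A`, the measurements `b`, and the regularizing
norm `reg` (a seminorm that vanishes only at `0`). -/
structure Problem (E : Type*) [NormedAddCommGroup E] [InnerProductSpace ℝ E] (m : ℕ) where
  A : E →ₗ[ℝ] EuclideanSpace ℝ (Fin m)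
  b : EuclideanSpace ℝ (Fin m)
  reg : Seminorm ℝ E
  reg_definite : ∀ x : E, reg x = 0 → x = 0

/-- Parameters of the homotopy algorithm and its subroutines. -/
structure Params where
  eta : ℝ
  deltaP : ℝ
  Lmin : ℝ
  gammaDec : ℝ
  gammaInc : ℝ
  eta_pos : 0 < eta
  eta_lt_one : eta < 1
  deltaP_pos : 0 < deltaP
  deltaP_lt_one : deltaP < 1
  Lmin_pos : 0 < Lmin
  one_le_gammaDec : 1 ≤ gammaDec
  one_lt_gammaInc : 1 < gammaInc

section Algorithm

variable {E : Type*} [NormedAddCommGroup E] [InnerProductSpace ℝ E] [FiniteDimensional ℝ E]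
  {m : ℕ}

/-- The adjoint `A*`. -/
def Problem.adj (P : Problem E m) : EuclideanSpace ℝ (Fin m) →ₗ[ℝ] E :=
  LinearMap.adjoint P.A

/-- `f(x) = ½ ‖A x - b‖²`. -/
def Problem.f (P : Problem E m) (x : E) : ℝ :=
  (1 / 2) * ‖P.A x - P.b‖ ^ 2

/-- `∇f(x) = A* (A x - b)`; see `Problem.hasGradientAt_f`. -/
def Problem.grad (P : Problem E m) (x : E) : E :=
  P.adj (P.A x - P.b)

/-- `φ_λ(x) = f(x) + λ p(x)`. -/
def Problem.phi (P : Problem E m) (lam : ℝ) (x : E) : ℝ :=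
  P.f x + lam * P.reg x

/-- `m_{λ,L}(y, x)`. -/
def Problem.model (P : Problem E m) (lam L : ℝ) (y x : E) : ℝ :=
  P.f y + inner ℝ (P.grad y) (x - y) + L / 2 * ‖x - y‖ ^ 2 + lam * P.reg x

/-- `Prox_{λ,L}(y)`, the minimizer of `m_{λ,L}(y, ·)`; it exists for `λ ≥ 0` and `L > 0`, see
`Problem.prox_spec`. -/
def Problem.prox (P : Problem E m) (lam L : ℝ) (y : E) : E :=
  Classical.epsilon fun x : E => ∀ w : E, P.model lam L y x ≤ P.model lam L y w

/-- The line search test: the loop of `Backtrack` is left at the first `L` for which it holds. -/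
def Problem.LineSearchOK (P : Problem E m) (lam L : ℝ) (x : E) : Prop :=
  P.phi lam (P.prox lam L x) ≤ P.model lam L x (P.prox lam L x)

/-- The value `M` returned by `Backtrack_{φ_λ}(x, L)`: the first of `L, γ_inc L, γ_inc² L, …` that
passes the line search test; there is one, see `Problem.exists_lineSearchOK`. -/
def backtrackM (P : Problem E m) (S : Params) (lam : ℝ) (x : E) (L : ℝ) : ℝ :=
  S.gammaInc ^ sInf {i : ℕ | P.LineSearchOK lam (S.gammaInc ^ i * L) x} * L

/-- The iterates `(x⁽ᵗ⁾, M_t, L_t)` of `ProxGrad_{φ_λ}(x⁽⁰⁾, L₀, …)` with the stopping test ignored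
(`M₀` is never used). -/
def proxGradSeq (P : Problem E m) (S : Params) (lam : ℝ) (x₀ : E) (L₀ : ℝ) : ℕ → E × ℝ × ℝ
  | 0 => (x₀, L₀, L₀)
  | t + 1 =>
    let s := proxGradSeq P S lam x₀ L₀ t
    let M := backtrackM P S lam s.1 s.2.2
    (P.prox lam M s.1, M, max S.Lmin (M / S.gammaDec))

/-- The stopping test of `ProxGrad` with tolerance `tol` after iteration `t + 1`. -/
def StopsAfter (P : Problem E m) (S : Params) (lam : ℝ) (x₀ : E) (L₀ tol : ℝ) (t : ℕ) : Prop :=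
  let s := proxGradSeq P S lam x₀ L₀ t
  let s' := proxGradSeq P S lam x₀ L₀ (t + 1)
  dualNorm P.reg (s'.2.1 • (s.1 - s'.1) + P.grad s'.1 - P.grad s.1) ≤ tol

/-- `ProxGrad_{φ_λ}(x⁽⁰⁾, L₀, L_min, tol)` terminates. -/
def ProxGradTerminates (P : Problem E m) (S : Params) (lam : ℝ) (x₀ : E) (L₀ tol : ℝ) : Prop :=
  ∃ t : ℕ, StopsAfter P S lam x₀ L₀ tol t

/-- The number of iterations (at least one) of `ProxGrad_{φ_λ}(x⁽⁰⁾, L₀, L_min, tol)`, when it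
terminates. -/
def proxGradIters (P : Problem E m) (S : Params) (lam : ℝ) (x₀ : E) (L₀ tol : ℝ) : ℕ :=
  sInf {t : ℕ | StopsAfter P S lam x₀ L₀ tol t} + 1

/-- The output `[x, M]` of `ProxGrad_{φ_λ}(x⁽⁰⁾, L₀, L_min, tol)`, when it terminates. -/
def proxGrad (P : Problem E m) (S : Params) (lam : ℝ) (x₀ : E) (L₀ tol : ℝ) : E × ℝ :=
  let s := proxGradSeq P S lam x₀ L₀ (proxGradIters P S lam x₀ L₀ tol)
  (s.1, s.2.1)

/-- `λ₀ = p*(A* b)`. -/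
def lam0 (P : Problem E m) : ℝ := dualNorm P.reg (P.adj P.b)

/-- `λ_t = λ₀ ηᵗ`. -/
def lamSeq (P : Problem E m) (S : Params) (t : ℕ) : ℝ := lam0 P * S.eta ^ t

/-- The number `N` of stages before the final one. -/
def numStages (P : Problem E m) (S : Params) (lamTgt : ℝ) : ℕ :=
  ⌊Real.log (lamTgt / lam0 P) / Real.log S.eta⌋₊

/-- `(y⁽ᵗ⁾, M)` after `t` stages of the homotopy algorithm: the stage with regularization
parameter `λ_{t+1}` is solved to tolerance `δ' λ_{t+1}`, warm started at the previous output. -/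
def homotopySeq (P : Problem E m) (S : Params) : ℕ → E × ℝ
  | 0 => (0, S.Lmin)
  | t + 1 =>
    proxGrad P S (lamSeq P S (t + 1)) (homotopySeq P S t).1 (homotopySeq P S t).2
      (S.deltaP * lamSeq P S (t + 1))

/-- The computation of `y⁽ᵗ⁺¹⁾` from `y⁽ᵗ⁾` terminates. -/
def StageTerminates (P : Problem E m) (S : Params) (t : ℕ) : Prop :=
  ProxGradTerminates P S (lamSeq P S (t + 1)) (homotopySeq P S t).1 (homotopySeq P S t).2
    (S.deltaP * lamSeq P S (t + 1))

/-- The number of proximal-gradient iterations for computing `y⁽ᵗ⁺¹⁾` from `y⁽ᵗ⁾`. -/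
def stageIters (P : Problem E m) (S : Params) (t : ℕ) : ℕ :=
  proxGradIters P S (lamSeq P S (t + 1)) (homotopySeq P S t).1 (homotopySeq P S t).2
    (S.deltaP * lamSeq P S (t + 1))

/-- The final stage, started at `y⁽ᴺ⁾` with parameter `λ_tgt` and tolerance `ε`, terminates. -/
def FinalTerminates (P : Problem E m) (S : Params) (lamTgt eps : ℝ) : Prop :=
  ProxGradTerminates P S lamTgt (homotopySeq P S (numStages P S lamTgt)).1
    (homotopySeq P S (numStages P S lamTgt)).2 eps

/-- The number of proximal-gradient iterations of the final stage. -/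
def finalIters (P : Problem E m) (S : Params) (lamTgt eps : ℝ) : ℕ :=
  proxGradIters P S lamTgt (homotopySeq P S (numStages P S lamTgt)).1
    (homotopySeq P S (numStages P S lamTgt)).2 eps

/-- The output `y` of the homotopy algorithm. -/
def homotopyOutput (P : Problem E m) (S : Params) (lamTgt eps : ℝ) : E :=
  (proxGrad P S lamTgt (homotopySeq P S (numStages P S lamTgt)).1
    (homotopySeq P S (numStages P S lamTgt)).2 eps).1

/-- The total number of proximal-gradient iterations of the homotopy algorithm. -/
def totalIters (P : Problem E m) (S : Params) (lamTgt eps : ℝ) : ℕ :=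
  (∑ t ∈ Finset.range (numStages P S lamTgt), stageIters P S t) + finalIters P S lamTgt eps

/-! ### The constants of the convergence result -/

/-- `γ = (λ_tgt (1 + δ) + p*(A* z)) / (λ_tgt (1 - δ) - p*(A* z))`. -/
def gammaConst (P : Problem E m) (z : EuclideanSpace ℝ (Fin m)) (lamTgt delta : ℝ) : ℝ :=
  (lamTgt * (1 + delta) + dualNorm P.reg (P.adj z)) /
    (lamTgt * (1 - delta) - dualNorm P.reg (P.adj z))

/-- `k̃ = 36 r c k₀ (1 + γ) γ_inc`. -/
def kTilde (c k₀ r gam gammaInc : ℝ) : ℝ := 36 * r * c * k₀ * (1 + gam) * gammaInc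

/-- `κ = ρ₊(A, 2k̃) / ρ₋(A, 2k̃)`. -/
def kappa (P : Problem E m) (kt : ℝ) : ℝ :=
  rhoPlus P.reg P.A (2 * kt) / rhoMinus P.reg P.A (2 * kt)

/-- The constant `C` of the iteration bounds. -/
def bigC (P : Problem E m) (gammaInc c k₀ gam delta kt : ℝ) : ℝ :=
  6 * gammaInc * kappa P kt * delta * c * k₀ * (1 + gam) *
      (Real.sqrt (rhoMinus P.reg P.A (2 * kt)) +
        Real.sqrt (rhoPlus P.reg P.A 1 * kappa P kt)) ^ 2 /
    rhoMinus P.reg P.A (c * (1 + gam) ^ 2 * k₀)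

/-- `log ((1 - 1 / (4 γ_inc κ))⁻¹)`, the logarithm of the inverse contraction factor. -/
def logRate (P : Problem E m) (gammaInc kt : ℝ) : ℝ :=
  Real.log ((1 - 1 / (4 * gammaInc * kappa P kt))⁻¹)

/-! ### The algorithm is well defined -/

lemma Problem.f_expand (P : Problem E m) (y x : E) :
    P.f x = P.f y + inner ℝ (P.grad y) (x - y) + 1 / 2 * ‖P.A (x - y)‖ ^ 2 := by
  have h1 : P.A x - P.b = (P.A y - P.b) + P.A (x - y) := by rw [map_sub]; abel
  have h2 : inner ℝ (P.grad y) (x - y) = inner ℝ (P.A y - P.b) (P.A (x - y)) := by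
    simp only [Problem.grad, Problem.adj]
    rw [LinearMap.adjoint_inner_left]
  rw [Problem.f, Problem.f, h1, norm_add_sq_real, h2]
  ring

/-- `Problem.grad` is the gradient of `f`. -/
lemma Problem.hasGradientAt_f [CompleteSpace E] (P : Problem E m) (x : E) :
    HasGradientAt P.f (P.grad x) x := by
  rw [hasGradientAt_iff_hasFDerivAt]
  have hA : HasFDerivAt (fun y => P.A y - P.b) (LinearMap.toContinuousLinearMap P.A) x :=
    ((LinearMap.toContinuousLinearMap P.A).hasFDerivAt).sub_const _
  have h := (hA.norm_sq).const_mul (1 / 2 : ℝ)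
  refine h.congr_fderiv ?_
  ext v
  simp [Problem.grad, Problem.adj, LinearMap.adjoint_inner_left]

lemma Problem.continuous_reg (P : Problem E m) : Continuous P.reg := by
  have h : ConvexOn ℝ Set.univ P.reg := P.reg.convexOn
  exact continuousOn_univ.1 (h.continuousOn isOpen_univ)

/-- The proximal point exists. -/
lemma Problem.prox_spec (P : Problem E m) {lam L : ℝ} (hlam : 0 ≤ lam) (hL : 0 < L) (y : E) :
    ∀ w : E, P.model lam L y (P.prox lam L y) ≤ P.model lam L y w := by
  have hcont : Continuous (P.model lam L y) := by
    have := P.continuous_reg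
    unfold Problem.model
    fun_prop
  have hlow : ∀ x : E, ‖P.grad y‖ + 1 ≤ L / 2 * ‖x - y‖ → P.f y + ‖x - y‖ ≤ P.model lam L y x := by
    intro x hx
    have h1 : -(‖P.grad y‖ * ‖x - y‖) ≤ inner ℝ (P.grad y) (x - y) :=
      neg_le_of_abs_le (abs_real_inner_le_norm _ _)
    have h2 : 0 ≤ lam * P.reg x := mul_nonneg hlam (apply_nonneg _ _)
    have h3 := mul_le_mul_of_nonneg_right hx (norm_nonneg (x - y))
    unfold Problem.model
    nlinarith
  have hd : Filter.Tendsto (fun x : E => ‖x - y‖) (Filter.cocompact E) Filter.atTop :=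
    tendsto_dist_right_cocompact_atTop y |>.congr fun x => dist_eq_norm x y
  have hlim : Filter.Tendsto (P.model lam L y) (Filter.cocompact E) Filter.atTop := by
    refine Filter.tendsto_atTop_mono' _ ?_ (Filter.tendsto_atTop_add_const_left _ (P.f y) hd)
    filter_upwards [(hd.const_mul_atTop (half_pos hL)).eventually_ge_atTop (‖P.grad y‖ + 1)]
      with x hx using hlow x hx
  exact Classical.epsilon_spec (hcont.exists_forall_le hlim)

/-- The line search terminates. -/
lemma Problem.exists_lineSearchOK (P : Problem E m) (S : Params) (lam : ℝ) {L : ℝ} (hL : 0 < L)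
    (x : E) : ∃ i : ℕ, P.LineSearchOK lam (S.gammaInc ^ i * L) x := by
  obtain ⟨i, hi⟩ := pow_unbounded_of_one_lt
    (‖LinearMap.toContinuousLinearMap P.A‖ ^ 2 / L) S.one_lt_gammaInc
  refine ⟨i, ?_⟩
  unfold Problem.LineSearchOK Problem.phi Problem.model
  generalize P.prox lam (S.gammaInc ^ i * L) x = w
  rw [P.f_expand x w]
  have h1 : ‖P.A (w - x)‖ ≤ ‖LinearMap.toContinuousLinearMap P.A‖ * ‖w - x‖ :=
    (LinearMap.toContinuousLinearMap P.A).le_opNorm (w - x)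
  have h2 : ‖P.A (w - x)‖ ^ 2 ≤ ‖LinearMap.toContinuousLinearMap P.A‖ ^ 2 * ‖w - x‖ ^ 2 := by
    rw [← mul_pow]
    exact pow_le_pow_left₀ (norm_nonneg _) h1 2
  have h3 : ‖LinearMap.toContinuousLinearMap P.A‖ ^ 2 ≤ S.gammaInc ^ i * L :=
    ((div_lt_iff₀ hL).1 hi).le
  have h4 := mul_le_mul_of_nonneg_right h3 (sq_nonneg ‖w - x‖)
  linarith

end Algorithm

end ProxHomotopy

end

/-!
# Linear convergence of the proximal-gradient homotopy method for decomposable norms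

**Geometry of the norm.** Let `p` be the norm, `p*` its dual norm. Since the extreme points of the
unit ball of `p` lie on the Euclidean unit sphere, Krein-Milman gives `p* ≤ ‖·‖ ≤ p`, and every
vector attains its dual norm at an *atom*, a point with `p a = ‖a‖ = 1`
(`IsAtomicDecomposable.norm_le`, `IsAtomicDecomposable.exists_isAtom_inner_eq`). Decomposability
forces every such top atom of a vector of `T_xᗮ` to lie in `T_xᗮ`, so the projection onto `T_xᗮ`
contracts `p*` (`proj_mem_dualBall`). Splitting off top atoms one after the other writes each vector
as a positive combination of a *frame*, a set of pairwise strongly orthogonal atoms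
(`exists_frame`), the analogue of a singular value decomposition; the number of atoms is the rank.

The quantitative heart is a curvature bound: for an atom `a` and a point `u` of the dual ball, the
component of `u` in `T_a` is within `√5` of `a` (`norm_atom_add_proj_sub_sq_le`). Along a frame these
estimates add up orthogonally, and they yield `p(x - y) ≤ (√5 / 2) (√j + √k) ‖x - y‖` for `x`, `y` of
ranks `j`, `k` (`two_mul_apply_sub_le`). So differences of vectors of low rank satisfy the
restricted eigenvalue bounds of `A`. For vectors that are not of low rank, an averaging argument over
the atoms (Maurey's lemma, `norm_map_sq_le_of_restricted`) bounds `‖A x‖²` by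
`ρ₊ (‖x‖² + p(x)² / (k - 1))`.

**Analysis of the method.** All estimates for the iteration are made in a `RecoverySetting`, which
collects the constants. A point whose objective gap is at most `δ λ B`, with `B` the error scale
`errBound`, has an error `x - x₀` of norm at most `B`, and it fits the noiseless data
(`spread_le_of_nearOptimal`, `norm_map_sub_le`). Pairing the optimality condition of the proximal
step with the sum of the atoms of the new point bounds its rank (`exists_hasRank`). Hence, starting
from a nearly optimal point of low rank:

* the line search accepts every `L ∈ [ρ₊, γ_inc ρ₊]` (`lineSearchOK`). Otherwise the curvature ratio
  `τ = ‖A d‖² / (L ‖d‖²)` of the step `d` exceeds one; the descent at step length `1 / τ`, limited by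
  the objective gap, bounds the step, thus the rank of the new point, and then the restricted bound
  gives `τ ≤ 1`;
* the new point is again nearly optimal and of low rank (`nearOptimal_prox`, `lowRank_prox`);
* the objective gap contracts by `1 - 1 / (4 γ_inc κ)` (`phi_prox_sub_le`), and the residual squared
  is at most a constant times the gap (`residual_sq_le`).

This gives the logarithmic iteration bound for one call (`proxGrad_terminates`). The approximate
solution for one parameter is nearly optimal for the next (`nearOptimal_of_residual_prev`), so the
invariants pass from stage to stage, beginning with the exact solution `0` at `λ₀ = p*(A* b)`.
-/

noncomputable section

namespace ProxHomotopy

/-! ### The dual ball and atoms -/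

section Geometry

variable {E : Type*} [NormedAddCommGroup E] [InnerProductSpace ℝ E]

/-- The standing assumptions on the regularizer, bundled. -/
structure IsAtomicDecomposable (p : Seminorm ℝ E) : Prop where
  definite : ∀ x : E, p x = 0 → x = 0
  unit : UnitExtremePoints p
  dec : Decomposable p

/-- The dual unit ball, described without a supremum; see `mem_dualBall_iff`. -/
def dualBall (p : Seminorm ℝ E) : Set E :=
  {u : E | ∀ x : E, inner ℝ u x ≤ p x}

/-- Atoms are the vectors at which `p` and the inner-product norm are both one. They include the
extreme points of the unit ball and form a closed set. -/
def IsAtom (p : Seminorm ℝ E) (a : E) : Prop :=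
  p a = 1 ∧ ‖a‖ = 1

variable {p : Seminorm ℝ E}

lemma zero_mem_dualBall : (0 : E) ∈ dualBall p := fun x => by simp

lemma neg_mem_dualBall {u : E} (hu : u ∈ dualBall p) : -u ∈ dualBall p := fun x => by
  have := hu (-x)
  rwa [inner_neg_right, ← inner_neg_left, map_neg_eq_map] at this

lemma abs_inner_le_of_mem_dualBall {u : E} (hu : u ∈ dualBall p) (x : E) :
    |inner ℝ u x| ≤ p x := by
  have h := neg_mem_dualBall hu x
  rw [inner_neg_left] at h
  exact abs_le.2 ⟨by linarith, hu x⟩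

lemma isClosed_dualBall : IsClosed (dualBall p) := by
  have : dualBall p = ⋂ x : E, {u : E | inner ℝ u x ≤ p x} := by
    ext u; simp [dualBall]
  rw [this]
  exact isClosed_iInter fun x => isClosed_le (by fun_prop) continuous_const

/-- Subgradients are the elements of the dual ball that norm `x`. -/
lemma mem_subdiff_iff {x ξ : E} : ξ ∈ subdiff p x ↔ ξ ∈ dualBall p ∧ inner ℝ ξ x = p x := by
  constructor
  · intro h
    have h0 := h 0
    have h2 := h ((2 : ℝ) • x)
    have e2 : (2 : ℝ) • x - x = x := by rw [two_smul]; abel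
    rw [zero_sub, inner_neg_right, map_zero] at h0
    rw [e2, map_smul_eq_mul, Real.norm_eq_abs, abs_of_pos (by norm_num : (0 : ℝ) < 2)] at h2
    have hx : inner ℝ ξ x = p x := by linarith
    refine ⟨fun y => ?_, hx⟩
    have := h y
    rw [inner_sub_right, hx] at this
    linarith
  · rintro ⟨h, hx⟩ y
    rw [inner_sub_right, hx]
    linarith [h y]

variable [FiniteDimensional ℝ E]

lemma continuous_seminorm (p : Seminorm ℝ E) : Continuous p :=
  continuousOn_univ.1 (p.convexOn.continuousOn isOpen_univ)

namespace IsAtomicDecomposable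

variable (H : IsAtomicDecomposable p)
include H

lemma exists_norm_le : ∃ C : ℝ, 0 < C ∧ ∀ x : E, ‖x‖ ≤ C * p x := by
  rcases subsingleton_or_nontrivial E with hE | hE
  · exact ⟨1, one_pos, fun x => by simp [Subsingleton.elim x 0]⟩
  obtain ⟨y, hy, hmin⟩ := (isCompact_sphere (0 : E) 1).exists_isMinOn
    (NormedSpace.sphere_nonempty.2 zero_le_one) (continuous_seminorm p).continuousOn
  have hy1 : ‖y‖ = 1 := by simpa using hy
  have hpos : 0 < p y := (apply_nonneg p y).lt_of_ne fun h => by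
    rw [H.definite y h.symm] at hy1; simp at hy1
  refine ⟨(p y)⁻¹, inv_pos.2 hpos, fun x => ?_⟩
  rcases eq_or_ne x 0 with rfl | hx
  · simp
  have hx' : 0 < ‖x‖ := norm_pos_iff.2 hx
  have h := hmin (show ‖x‖⁻¹ • x ∈ Metric.sphere (0 : E) 1 by
    simp [norm_smul, hx'.ne'])
  simp only [Set.mem_ofPred_eq, map_smul_eq_mul, norm_inv, norm_norm] at h
  rw [inv_mul_eq_div, le_div_iff₀ hx'] at h
  rw [inv_mul_eq_div, le_div_iff₀ hpos]
  linarith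

lemma isCompact_ball : IsCompact {x : E | p x ≤ 1} := by
  obtain ⟨C, hC, h⟩ := H.exists_norm_le
  refine Metric.isCompact_of_isClosed_isBounded
    (isClosed_le (continuous_seminorm p) continuous_const) ?_
  refine (Metric.isBounded_closedBall (x := (0 : E)) (r := C)).subset fun x hx => ?_
  rw [mem_closedBall_zero_iff]
  exact (h x).trans (by nlinarith [hx.out])

omit [FiniteDimensional ℝ E] H in
lemma convex_ball : Convex ℝ {x : E | p x ≤ 1} := by
  have := p.convexOn.convex_le 1
  simpa using this

/-- By Krein-Milman the unit ball of `p` lies in the Euclidean unit ball. -/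
lemma norm_le (x : E) : ‖x‖ ≤ p x := by
  have hsub : {x : E | p x ≤ 1} ⊆ Metric.closedBall (0 : E) 1 := by
    rw [← closure_convexHull_extremePoints H.isCompact_ball convex_ball]
    refine closure_minimal (convexHull_min (fun a ha => ?_) (convex_closedBall _ _))
      Metric.isClosed_closedBall
    simp [H.unit a ha]
  rcases eq_or_ne x 0 with rfl | hx
  · simp
  have hp : 0 < p x := (apply_nonneg p x).lt_of_ne fun h => hx (H.definite x h.symm)
  have h := hsub (show (p x)⁻¹ • x ∈ {x : E | p x ≤ 1} by
    simp [map_smul_eq_mul, abs_of_pos hp, hp.ne'])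
  rw [mem_closedBall_zero_iff, norm_smul, norm_inv, Real.norm_eq_abs, abs_of_pos hp,
    inv_mul_eq_div, div_le_one hp] at h
  exact h

lemma bddAbove_dual (y : E) : BddAbove {s : ℝ | ∃ x : E, p x ≤ 1 ∧ s = inner ℝ y x} := by
  refine ⟨‖y‖, ?_⟩
  rintro s ⟨x, hx, rfl⟩
  calc inner ℝ y x ≤ ‖y‖ * ‖x‖ := real_inner_le_norm _ _
    _ ≤ ‖y‖ * 1 := mul_le_mul_of_nonneg_left ((H.norm_le x).trans hx) (norm_nonneg _)
    _ = ‖y‖ := mul_one _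

lemma inner_le_dualNorm_of_le_one (y : E) {x : E} (hx : p x ≤ 1) : inner ℝ y x ≤ dualNorm p y :=
  le_csSup (H.bddAbove_dual y) ⟨x, hx, rfl⟩

omit [FiniteDimensional ℝ E] H in
lemma dualNorm_le {y : E} {C : ℝ} (h : ∀ x : E, p x ≤ 1 → inner ℝ y x ≤ C) : dualNorm p y ≤ C := by
  refine csSup_le ⟨_, 0, by simp, rfl⟩ ?_
  rintro s ⟨x, hx, rfl⟩
  exact h x hx

lemma inner_le_dualNorm_mul (y x : E) : inner ℝ y x ≤ dualNorm p y * p x := by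
  rcases eq_or_ne x 0 with rfl | hx
  · simp
  have hp : 0 < p x := (apply_nonneg p x).lt_of_ne fun h => hx (H.definite x h.symm)
  have h := H.inner_le_dualNorm_of_le_one y (x := (p x)⁻¹ • x)
    (by simp [map_smul_eq_mul, abs_of_pos hp, hp.ne'])
  rw [real_inner_smul_right, inv_mul_eq_div, div_le_iff₀ hp] at h
  exact h

lemma dualNorm_nonneg (y : E) : 0 ≤ dualNorm p y := by
  have := H.inner_le_dualNorm_of_le_one y (x := 0) (by simp)
  simpa using this

lemma dualNorm_le_norm (y : E) : dualNorm p y ≤ ‖y‖ :=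
  dualNorm_le fun x hx => (real_inner_le_norm _ _).trans
    (mul_le_of_le_one_right (norm_nonneg _) ((H.norm_le x).trans hx))

lemma mem_dualBall_iff {u : E} : u ∈ dualBall p ↔ dualNorm p u ≤ 1 := by
  constructor
  · exact fun h => dualNorm_le fun x hx => (h x).trans hx
  · intro h x
    exact (H.inner_le_dualNorm_mul u x).trans (mul_le_of_le_one_left (apply_nonneg _ _) h)

lemma dualNorm_add_le (x y : E) : dualNorm p (x + y) ≤ dualNorm p x + dualNorm p y :=
  dualNorm_le fun w hw => by
    rw [inner_add_left]
    exact add_le_add (H.inner_le_dualNorm_of_le_one x hw) (H.inner_le_dualNorm_of_le_one y hw)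

lemma dualNorm_smul_le (t : ℝ) (x : E) : dualNorm p (t • x) ≤ |t| * dualNorm p x := by
  refine dualNorm_le fun w hw => ?_
  have h2 := H.inner_le_dualNorm_of_le_one x hw
  have h3 := H.inner_le_dualNorm_of_le_one x (x := -w) (by rwa [map_neg_eq_map])
  rw [inner_neg_right] at h3
  rw [real_inner_smul_left]
  calc t * inner ℝ x w ≤ |t| * |inner ℝ x w| := by rw [← abs_mul]; exact le_abs_self _
    _ ≤ |t| * dualNorm p x :=
      mul_le_mul_of_nonneg_left (abs_le.2 ⟨by linarith, h2⟩) (abs_nonneg _)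

lemma abs_inner_le_dualNorm_mul (y x : E) : |inner ℝ y x| ≤ dualNorm p y * p x := by
  have h := H.inner_le_dualNorm_mul y (-x)
  rw [inner_neg_right, map_neg_eq_map] at h
  exact abs_le.2 ⟨by linarith, H.inner_le_dualNorm_mul y x⟩

lemma inv_dualNorm_smul_mem {y : E} (hy : 0 < dualNorm p y) :
    (dualNorm p y)⁻¹ • y ∈ dualBall p := by
  rw [H.mem_dualBall_iff]
  refine (H.dualNorm_smul_le _ _).trans ?_
  rw [abs_of_pos (inv_pos.2 hy), inv_mul_cancel₀ hy.ne']

lemma dualNorm_pos {y : E} (hy : y ≠ 0) : 0 < dualNorm p y := by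
  have h := H.inner_le_dualNorm_mul y y
  have h1 : 0 < inner ℝ y y := real_inner_self_pos.2 hy
  by_contra hcon
  nlinarith [apply_nonneg p y]

omit H in
lemma isCompact_dualBall : IsCompact (dualBall p) := by
  obtain ⟨C, hC⟩ : ∃ C : ℝ, ∀ u ∈ dualBall p, ‖u‖ ≤ C := by
    obtain ⟨z, -, hmax⟩ := (isCompact_closedBall (0 : E) 1).exists_isMaxOn
      ⟨0, by simp⟩ (continuous_seminorm p).continuousOn
    refine ⟨p z, fun u hu => ?_⟩
    rcases eq_or_ne u 0 with rfl | h0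
    · simp
    have hn : 0 < ‖u‖ := norm_pos_iff.2 h0
    have h1 : p (‖u‖⁻¹ • u) ≤ p z := hmax (by simp [norm_smul, hn.ne'])
    have h2 := hu (‖u‖⁻¹ • u)
    rw [real_inner_smul_right, real_inner_self_eq_norm_sq, pow_two, inv_mul_cancel_left₀ hn.ne'] at h2
    exact h2.trans h1
  exact Metric.isCompact_of_isClosed_isBounded isClosed_dualBall
    ((Metric.isBounded_closedBall (x := (0 : E)) (r := C)).subset fun u hu => by
      simpa using hC u hu)

lemma mem_dualBall_of_isAtom {a : E} (ha : IsAtom p a) : a ∈ dualBall p := by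
  rw [H.mem_dualBall_iff, ← ha.2]
  exact H.dualNorm_le_norm a

/-- The dual norm is attained at an atom. -/
lemma exists_isAtom_inner_eq [Nontrivial E] (y : E) :
    ∃ a : E, IsAtom p a ∧ inner ℝ y a = dualNorm p y := by
  set B : Set E := {x : E | p x ≤ 1}
  have hB : IsCompact B := H.isCompact_ball
  have hexp : IsExposed ℝ B ((innerSL ℝ y).toExposed B) :=
    ContinuousLinearMap.toExposed.isExposed
  have hne : ((innerSL ℝ y).toExposed B).Nonempty := by
    obtain ⟨x, hx, hmax⟩ := hB.exists_isMaxOn ⟨0, by simp [B]⟩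
      (innerSL ℝ y).continuous.continuousOn
    exact ⟨x, hx, fun z hz => hmax hz⟩
  obtain ⟨a, ha⟩ := (hexp.isCompact hB).extremePoints_nonempty hne
  have haB : a ∈ Set.extremePoints ℝ B := hexp.isExtreme.extremePoints_subset_extremePoints ha
  have hn : ‖a‖ = 1 := H.unit a haB
  have hp : p a = 1 := le_antisymm haB.1 (hn ▸ H.norm_le a)
  refine ⟨a, ⟨hp, hn⟩, le_antisymm (H.inner_le_dualNorm_of_le_one y hp.le) ?_⟩
  exact dualNorm_le fun x hx => ha.1.2 x hx

end IsAtomicDecomposable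

end Geometry

/-! ### Decomposability: complementary subspaces and top atoms -/

namespace IsAtomicDecomposable

variable {E : Type*} [NormedAddCommGroup E] [InnerProductSpace ℝ E] {p : Seminorm ℝ E}

/-- The space `T_xᗮ` of directions of the subdifferential at `x`. -/
def perp (H : IsAtomicDecomposable p) (x : E) : Submodule ℝ E := (tangent H.dec x)ᗮ

/-- The vector `e_x`. -/
def sgn (H : IsAtomicDecomposable p) (x : E) : E := signVec H.dec x

variable (H : IsAtomicDecomposable p)
include H

lemma sgn_mem_tangent (x : E) : H.sgn x ∈ tangent H.dec x :=
  (H.dec x).choose_spec.choose_spec.1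

lemma subdiff_eq (x : E) :
    subdiff p x = {w : E | ∃ v ∈ H.perp x, dualNorm p v ≤ 1 ∧ w = H.sgn x + v} :=
  (H.dec x).choose_spec.choose_spec.2

lemma inner_sgn_of_mem_perp {x v : E} (hv : v ∈ H.perp x) : inner ℝ (H.sgn x) v = 0 :=
  Submodule.inner_right_of_mem_orthogonal (H.sgn_mem_tangent x) hv

variable [FiniteDimensional ℝ E]

lemma sgn_add_mem_subdiff {x v : E} (hv : v ∈ H.perp x) (hv1 : v ∈ dualBall p) :
    H.sgn x + v ∈ subdiff p x := by
  rw [H.subdiff_eq]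
  exact ⟨v, hv, H.mem_dualBall_iff.1 hv1, rfl⟩

lemma exists_eq_sgn_add {x ξ : E} (h : ξ ∈ subdiff p x) :
    ∃ v ∈ H.perp x, v ∈ dualBall p ∧ ξ = H.sgn x + v := by
  rw [H.subdiff_eq] at h
  obtain ⟨v, hv, hv1, rfl⟩ := h
  exact ⟨v, hv, H.mem_dualBall_iff.2 hv1, rfl⟩

lemma sgn_mem_subdiff (x : E) : H.sgn x ∈ subdiff p x := by
  simpa using H.sgn_add_mem_subdiff (H.perp x).zero_mem zero_mem_dualBall

lemma sgn_mem_dualBall (x : E) : H.sgn x ∈ dualBall p :=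
  (mem_subdiff_iff.1 (H.sgn_mem_subdiff x)).1

lemma inner_sgn_self (x : E) : inner ℝ (H.sgn x) x = p x :=
  (mem_subdiff_iff.1 (H.sgn_mem_subdiff x)).2

/-- The subspace `T_xᗮ` is detected by the dual ball: it consists of the directions in which the
dual ball extends symmetrically around `e_x`. -/
lemma mem_perp_of_mem_dualBall {x v : E} (h1 : H.sgn x + v ∈ dualBall p)
    (h2 : H.sgn x - v ∈ dualBall p) : v ∈ H.perp x ∧ v ∈ dualBall p := by
  have hx := H.inner_sgn_self x
  have a1 := h1 x
  have a2 := h2 x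
  rw [inner_add_left, hx] at a1
  rw [inner_sub_left, hx] at a2
  have hv : inner ℝ v x = 0 := le_antisymm (by linarith) (by linarith)
  obtain ⟨w, hw, hw1, he⟩ := H.exists_eq_sgn_add
    (mem_subdiff_iff.2 ⟨h1, by rw [inner_add_left, hv, hx, add_zero]⟩)
  obtain rfl : v = w := add_left_cancel he
  exact ⟨hw, hw1⟩

lemma sgn_add_mem_dualBall {x v : E} (hv : v ∈ H.perp x) (hv1 : v ∈ dualBall p) :
    H.sgn x + v ∈ dualBall p :=
  (mem_subdiff_iff.1 (H.sgn_add_mem_subdiff hv hv1)).1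

lemma sgn_sub_mem_dualBall {x v : E} (hv : v ∈ H.perp x) (hv1 : v ∈ dualBall p) :
    H.sgn x - v ∈ dualBall p := by
  rw [sub_eq_add_neg]
  exact H.sgn_add_mem_dualBall ((H.perp x).neg_mem hv) (neg_mem_dualBall hv1)

/-- At an atom `a` the vector `e_a` is `a` itself. -/
lemma sgn_eq_self {a : E} (ha : IsAtom p a) : H.sgn a = a := by
  have hsub : a ∈ subdiff p a := mem_subdiff_iff.2
    ⟨H.mem_dualBall_of_isAtom ha, by rw [real_inner_self_eq_norm_sq, ha.1, ha.2, one_pow]⟩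
  obtain ⟨v, hv, -, he⟩ := H.exists_eq_sgn_add hsub
  have h1 : 1 ≤ ‖H.sgn a‖ := by
    have := real_inner_le_norm (H.sgn a) a
    rwa [H.inner_sgn_self, ha.1, ha.2, mul_one] at this
  have h2 : ‖a‖ ^ 2 = ‖H.sgn a‖ ^ 2 + ‖v‖ ^ 2 := by
    conv_lhs => rw [he]
    rw [norm_add_sq_real, H.inner_sgn_of_mem_perp hv]
    ring
  rw [ha.2] at h2
  have h3 : ‖v‖ ^ 2 ≤ 0 := by nlinarith
  have h4 : v = 0 := by
    rw [← norm_eq_zero]; exact pow_eq_zero_iff two_ne_zero |>.1 (le_antisymm h3 (sq_nonneg _))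
  rw [h4, add_zero] at he
  exact he.symm

/-- An atom at which an element of `T_xᗮ` attains its dual norm lies in `T_xᗮ` itself. -/
lemma top_mem_perp {x y b : E} (hy : y ∈ H.perp x) (hy0 : y ≠ 0) (hb : IsAtom p b)
    (htop : inner ℝ y b = dualNorm p y) : b ∈ H.perp x := by
  have hg := H.dualNorm_pos hy0
  set v : E := (dualNorm p y)⁻¹ • y with hv
  have hvZ : v ∈ H.perp x := (H.perp x).smul_mem _ hy
  have hvB : v ∈ dualBall p := H.inv_dualNorm_smul_mem hg
  have hvb : inner ℝ v b = 1 := by rw [hv, real_inner_smul_left, htop, inv_mul_cancel₀ hg.ne']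
  have h1 := H.sgn_add_mem_dualBall hvZ hvB
  have h2 := neg_mem_dualBall (H.sgn_sub_mem_dualBall hvZ hvB)
  have i1 := h1 b
  have i2 := h2 b
  rw [hb.1, inner_add_left, hvb] at i1
  rw [hb.1, inner_neg_left, inner_sub_left, hvb] at i2
  have h0 : inner ℝ (H.sgn x) b = 0 := le_antisymm (by linarith) (by linarith)
  obtain ⟨v1, hv1, -, e1⟩ := H.exists_eq_sgn_add (x := b)
    (mem_subdiff_iff.2 ⟨h1, by rw [inner_add_left, h0, hvb, hb.1, zero_add]⟩)
  obtain ⟨v2, hv2, -, e2⟩ := H.exists_eq_sgn_add (x := b)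
    (mem_subdiff_iff.2 ⟨hvB, by rw [hvb, hb.1]⟩)
  have he : H.sgn x = v1 - v2 := by
    have : H.sgn x = (H.sgn x + v) - v := by abel
    rw [this, e1, e2]; abel
  have heZ : H.sgn x ∈ H.perp b := he ▸ (H.perp b).sub_mem hv1 hv2
  have j1 := H.sgn_add_mem_dualBall heZ (H.sgn_mem_dualBall x)
  have j2 := neg_mem_dualBall (H.sgn_sub_mem_dualBall heZ (H.sgn_mem_dualBall x))
  rw [H.sgn_eq_self hb] at j1 j2
  rw [add_comm] at j1
  rw [neg_sub] at j2
  exact (H.mem_perp_of_mem_dualBall j1 j2).1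

/-- The orthogonal projection onto `T_xᗮ`. -/
def proj (x : E) : E →L[ℝ] E := (H.perp x).starProjection

lemma proj_mem (x u : E) : H.proj x u ∈ H.perp x := Submodule.starProjection_apply_mem _ _

lemma inner_proj_eq {x v : E} (hv : v ∈ H.perp x) (u : E) :
    inner ℝ v (H.proj x u) = inner ℝ v u := by
  rw [proj, ← Submodule.inner_starProjection_left_eq_right,
    Submodule.starProjection_eq_self_iff.2 hv]

lemma inner_proj_left (x u w : E) : inner ℝ (H.proj x u) w = inner ℝ u (H.proj x w) :=
  Submodule.inner_starProjection_left_eq_right _ _ _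

/-- The projection onto `T_xᗮ` does not increase the dual norm. -/
lemma proj_mem_dualBall [Nontrivial E] (x : E) {u : E} (hu : u ∈ dualBall p) :
    H.proj x u ∈ dualBall p := by
  rcases eq_or_ne (H.proj x u) 0 with h0 | h0
  · rw [h0]; exact zero_mem_dualBall
  obtain ⟨b, hb, htop⟩ := H.exists_isAtom_inner_eq (H.proj x u)
  have hbZ := H.top_mem_perp (H.proj_mem x u) h0 hb htop
  rw [H.mem_dualBall_iff, ← htop, real_inner_comm, H.inner_proj_eq hbZ, real_inner_comm]
  exact (hu b).trans hb.1.le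

/-- Decomposability in primal form. -/
lemma proj_add_abs_le [Nontrivial E] (x y : E) :
    p (H.proj x y) + |inner ℝ (H.sgn x) y| ≤ p y := by
  set ζ := H.proj x (H.sgn (H.proj x y)) with hζ
  have hζB : ζ ∈ dualBall p := H.proj_mem_dualBall x (H.sgn_mem_dualBall _)
  have hζy : inner ℝ ζ y = p (H.proj x y) := by
    rw [hζ, H.inner_proj_left, H.inner_sgn_self]
  have h1 := H.sgn_add_mem_dualBall (H.proj_mem x _) hζB y
  have h2 := neg_mem_dualBall (H.sgn_sub_mem_dualBall (H.proj_mem x _) hζB) y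
  rw [inner_add_left, ← hζ, hζy] at h1
  rw [inner_neg_left, inner_sub_left, ← hζ, hζy] at h2
  rcases abs_cases (inner ℝ (H.sgn x) y) with h | h <;> linarith

/-! ### Orthogonality of atoms -/

omit H in
/-- Strong orthogonality of two vectors: their sum and difference are in the dual ball. -/
def _root_.ProxHomotopy.Ortho (p : Seminorm ℝ E) (a b : E) : Prop :=
  a + b ∈ dualBall p ∧ a - b ∈ dualBall p

omit H in
omit [FiniteDimensional ℝ E] in
lemma _root_.ProxHomotopy.Ortho.symm {a b : E} (h : Ortho p a b) : Ortho p b a :=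
  ⟨by rw [add_comm]; exact h.1, by rw [← neg_sub]; exact neg_mem_dualBall h.2⟩

lemma ortho_iff {a v : E} (ha : IsAtom p a) :
    Ortho p a v ↔ v ∈ H.perp a ∧ v ∈ dualBall p := by
  constructor
  · rintro ⟨h1, h2⟩
    exact H.mem_perp_of_mem_dualBall (by rwa [H.sgn_eq_self ha]) (by rwa [H.sgn_eq_self ha])
  · rintro ⟨h1, h2⟩
    have j1 := H.sgn_add_mem_dualBall h1 h2
    have j2 := H.sgn_sub_mem_dualBall h1 h2
    rw [H.sgn_eq_self ha] at j1 j2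
    exact ⟨j1, j2⟩

lemma mem_perp_of_ortho {a b : E} (ha : IsAtom p a) (h : Ortho p a b) : b ∈ H.perp a :=
  ((H.ortho_iff ha).1 h).1

lemma inner_eq_zero_of_mem_perp {a v : E} (ha : IsAtom p a) (hv : v ∈ H.perp a) :
    inner ℝ a v = 0 := by
  have := H.inner_sgn_of_mem_perp hv
  rwa [H.sgn_eq_self ha] at this

/-- A vector splits off each of its top atoms. -/
lemma sub_smul_mem_perp {y b : E} (hb : IsAtom p b) (htop : inner ℝ y b = dualNorm p y) :
    y - dualNorm p y • b ∈ H.perp b ∧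
      dualNorm p (y - dualNorm p y • b) ≤ dualNorm p y := by
  rcases eq_or_ne y 0 with rfl | hy0
  · have : dualNorm p (0 : E) = 0 := by rw [← htop, inner_zero_left]
    simp [this]
  have hg := H.dualNorm_pos hy0
  obtain ⟨v, hv, hv1, he⟩ := H.exists_eq_sgn_add (x := b) (mem_subdiff_iff.2
    ⟨H.inv_dualNorm_smul_mem hg,
      by rw [real_inner_smul_left, htop, inv_mul_cancel₀ hg.ne', hb.1]⟩)
  rw [H.sgn_eq_self hb] at he
  have hy : y - dualNorm p y • b = dualNorm p y • v := by
    have : y = dualNorm p y • ((dualNorm p y)⁻¹ • y) := by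
      rw [smul_smul, mul_inv_cancel₀ hg.ne', one_smul]
    rw [he, smul_add] at this
    nth_rewrite 1 [this]
    abel
  rw [hy]
  refine ⟨(H.perp b).smul_mem _ hv, (H.dualNorm_smul_le _ _).trans ?_⟩
  rw [abs_of_pos hg]
  exact mul_le_of_le_one_right hg.le (H.mem_dualBall_iff.1 hv1)

/-- For orthogonal atoms `a`, `b` the projection onto `T_aᗮ` preserves `T_bᗮ`. -/
lemma proj_mem_perp [Nontrivial E] {a b u : E} (ha : IsAtom p a) (hb : IsAtom p b)
    (hab : Ortho p a b) (hu : u ∈ H.perp b) : H.proj a u ∈ H.perp b := by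
  rcases eq_or_ne u 0 with rfl | hu0
  · rw [map_zero]; exact (H.perp b).zero_mem
  have hg := H.dualNorm_pos hu0
  set v : E := (dualNorm p u)⁻¹ • u with hv
  have hvo : Ortho p b v := (H.ortho_iff hb).2
    ⟨(H.perp b).smul_mem _ hu, H.inv_dualNorm_smul_mem hg⟩
  have hba : H.proj a b = b :=
    Submodule.starProjection_eq_self_iff.2 (H.mem_perp_of_ortho ha hab)
  have hpo : Ortho p b (H.proj a v) := by
    constructor
    · have := H.proj_mem_dualBall a hvo.1
      rwa [map_add, hba] at this
    · have := H.proj_mem_dualBall a hvo.2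
      rwa [map_sub, hba] at this
  have h := (H.perp b).smul_mem (dualNorm p u) (H.mem_perp_of_ortho hb hpo)
  rwa [hv, map_smul, smul_smul, mul_inv_cancel₀ hg.ne', one_smul] at h

/-- The component of an atom `b` in `T_aᗮ` is of second order in `a - b`. -/
lemma proj_atom_le [Nontrivial E] {a b : E} (ha : IsAtom p a) (hb : IsAtom p b) :
    p (H.proj a b) ≤ 1 - |inner ℝ a b| := by
  have := H.proj_add_abs_le a b
  rw [H.sgn_eq_self ha, hb.1] at this
  linarith

end IsAtomicDecomposable

/-! ### The curvature of the set of atoms -/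

/-- The numerical core of `dualNorm_smul_atom_add_le`: `al` is the correlation `⟨a, b⟩` of two
atoms, `f = ⟨u, b⟩` and `be = ⟨u, a⟩`; the hypotheses force `al = 1`. -/
lemma eq_of_correlation_bounds {κ μ ε al f be R : ℝ} (hκ : 0 < κ) (hε : 0 < ε)
    (hμ : μ * κ = κ - (2 + ε)) (hμ1 : μ ≤ 1) (hμ0 : 0 < μ)
    (hal : al ≤ 1) (hf : f ≤ 1) (hbe : be ≤ 1) (hR : 2 * R ^ 2 < κ * ε)
    (h0 : κ + be ≤ κ * al + f)
    (hlip : (f - be) ^ 2 ≤ 2 * R ^ 2 * (1 - al))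
    (h1 : κ - μ * f ≤ (κ * al - μ * be) * al + κ * (1 - al) ^ 2 + μ * (1 - al))
    (h2 : (κ * al + f) * al - (1 - al) ≤ κ + be) : al = 1 ∧ f = be := by
  obtain ⟨e, rfl⟩ : ∃ e, al = 1 - e := ⟨1 - al, by ring⟩
  obtain ⟨q, rfl⟩ : ∃ q, f = be + q := ⟨f - be, by ring⟩
  have he : 0 ≤ e := by linarith
  have hq : κ * e ≤ q := by linarith
  have hq2 : q ≤ 2 * κ * e + 2 * e := by
    nlinarith [mul_nonneg hκ.le (sq_nonneg e), mul_nonneg he (sub_nonneg.2 hf)]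
  have hq1 : 2 * κ * e * (1 - e) ≤ μ * (q + 2 * e) := by
    nlinarith [mul_nonneg (mul_nonneg hμ0.le he) (sub_nonneg.2 hbe)]
  rcases he.eq_or_lt with rfl | hpos
  · constructor <;> nlinarith
  exfalso
  have h3 : 2 * κ * e * (1 - e) ≤ μ * (2 * κ * e + 4 * e) :=
    hq1.trans (mul_le_mul_of_nonneg_left (by linarith) hμ0.le)
  have h4 : κ * (1 - e) ≤ μ * κ + μ * 2 := by
    have : (2 * e) * (κ * (1 - e)) ≤ (2 * e) * (μ * κ + μ * 2) := by linarith
    exact le_of_mul_le_mul_left this (by linarith)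
  have h5 : ε ≤ κ * e := by nlinarith
  have h6 : (κ * e) ^ 2 ≤ 2 * R ^ 2 * e := by
    have : (κ * e) ^ 2 ≤ q ^ 2 := pow_le_pow_left₀ (by positivity) hq 2
    nlinarith
  have h7 : κ ^ 2 * e ≤ 2 * R ^ 2 := by
    have : e * (κ ^ 2 * e) ≤ e * (2 * R ^ 2) := by nlinarith
    exact le_of_mul_le_mul_left this hpos
  nlinarith

/-- The concluding arithmetic of `norm_normalPart_sq_le_aux`. -/
lemma le_of_second_order_bounds {g s β N ε W V f : ℝ} (hg : 1 ≤ g) (hg2 : g - 1 ≤ s ^ 2 * N / 2)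
    (hs : 0 < s) (hβ : β ≤ 1) (hW : 0 ≤ W) (hV : 0 ≤ V)
    (hlow : β + s * N - ε * s ≤ g * f) (hup : f ≤ β + s * W + s * V) :
    N - ε ≤ s * N / 2 + (1 + s ^ 2 * N / 2) * W + (1 + s ^ 2 * N / 2) * V := by
  have h1 : g * f ≤ g * (β + s * W + s * V) := mul_le_mul_of_nonneg_left hup (by linarith)
  have h2 : (g - 1) * β ≤ s ^ 2 * N / 2 := by nlinarith
  have h3 : g * (s * W) ≤ (1 + s ^ 2 * N / 2) * (s * W) :=
    mul_le_mul_of_nonneg_right (by linarith) (mul_nonneg hs.le hW)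
  have h4 : g * (s * V) ≤ (1 + s ^ 2 * N / 2) * (s * V) :=
    mul_le_mul_of_nonneg_right (by linarith) (mul_nonneg hs.le hV)
  refine le_of_mul_le_mul_left ?_ hs
  calc s * (N - ε) ≤ g * (β + s * W + s * V) - β := by linarith
    _ = (g - 1) * β + g * (s * W) + g * (s * V) := by ring
    _ ≤ s ^ 2 * N / 2 + (1 + s ^ 2 * N / 2) * (s * W) + (1 + s ^ 2 * N / 2) * (s * V) := by
      linarith
    _ = _ := by ring

namespace IsAtomicDecomposable

open Filter Topology

variable {E : Type*} [NormedAddCommGroup E] [InnerProductSpace ℝ E] {p : Seminorm ℝ E}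
  [FiniteDimensional ℝ E] (H : IsAtomicDecomposable p)
include H

lemma continuous_dualNorm : Continuous (dualNorm p) := by
  refine (LipschitzWith.of_le_add (f := dualNorm p) fun x y => ?_).continuous
  have h := H.dualNorm_add_le y (x - y)
  rw [add_sub_cancel] at h
  refine h.trans ?_
  rw [dist_eq_norm]
  gcongr
  exact H.dualNorm_le_norm _

lemma isCompact_atoms : IsCompact {a : E | IsAtom p a} := by
  refine H.isCompact_ball.of_isClosed_subset ?_ fun a ha => ha.1.le
  exact (isClosed_eq (continuous_seminorm p) continuous_const).inter
    (isClosed_eq continuous_norm continuous_const)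

lemma inner_proj_self (x y : E) : inner ℝ y (H.proj x y) = ‖H.proj x y‖ ^ 2 := by
  rw [← real_inner_self_eq_norm_sq, H.inner_proj_eq (H.proj_mem x y), real_inner_comm]

/-- A second-order bound on the dual norm near an atom, uniform in the atom. For a maximizer `a`
of `a ↦ ‖κ a + u‖_* - μ ⟨u, a⟩` over the atoms and a top atom `b` of `κ a + u`, maximality says that
`a` is in turn a top atom of `κ b - μ u`; splitting `b` off the first vector and `a` off the second
yields two scalar inequalities for `⟨a, b⟩` that leave only `a = b`. -/
lemma dualNorm_smul_atom_add_le [Nontrivial E] {u : E} (hu : u ∈ dualBall p) {ε : ℝ} (hε : 0 < ε) :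
    ∃ κ₀ : ℝ, 0 < κ₀ ∧ ∀ κ : ℝ, κ₀ ≤ κ → ∀ a : E, IsAtom p a →
      dualNorm p (κ • a + u) ≤ κ + inner ℝ u a + (2 + ε) / κ * (1 - inner ℝ u a) := by
  refine ⟨3 + ε + (2 * ‖u‖ ^ 2 + 1) / ε, by positivity, fun κ hκ₀ => ?_⟩
  have hκ3 : 3 + ε ≤ κ := le_trans (le_add_of_nonneg_right (by positivity)) hκ₀
  have hκR : 2 * ‖u‖ ^ 2 < κ * ε := by
    have : (2 * ‖u‖ ^ 2 + 1) / ε ≤ κ := by linarith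
    rw [div_le_iff₀ hε] at this
    linarith
  have hκ : 0 < κ := by linarith
  set μ : ℝ := 1 - (2 + ε) / κ with hμ
  have hμκ : μ * κ = κ - (2 + ε) := by rw [hμ]; field_simp
  have hμ1 : μ ≤ 1 := by rw [hμ]; linarith [show 0 ≤ (2 + ε) / κ by positivity]
  have hμ0 : 0 < μ := by
    by_contra hcon
    nlinarith
  have hcont : Continuous fun a : E => dualNorm p (κ • a + u) - μ * inner ℝ u a := by
    have := H.continuous_dualNorm
    fun_prop
  obtain ⟨c, hc, -⟩ := H.exists_isAtom_inner_eq (0 : E)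
  obtain ⟨a, ha, hmax⟩ := H.isCompact_atoms.exists_isMaxOn ⟨c, hc⟩ hcont.continuousOn
  replace ha : IsAtom p a := ha
  obtain ⟨b, hb, hbtop⟩ := H.exists_isAtom_inner_eq (κ • a + u)
  have hAA : inner ℝ a a = (1 : ℝ) := by rw [real_inner_self_eq_norm_sq, ha.2, one_pow]
  have hBB : inner ℝ b b = (1 : ℝ) := by rw [real_inner_self_eq_norm_sq, hb.2, one_pow]
  have hG : dualNorm p (κ • a + u) = κ * inner ℝ a b + inner ℝ u b := by
    rw [← hbtop, inner_add_left, real_inner_smul_left]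
  have hatop : inner ℝ (κ • b - μ • u) a = dualNorm p (κ • b - μ • u) := by
    refine le_antisymm (H.inner_le_dualNorm_of_le_one _ ha.1.le) ?_
    obtain ⟨d, hd, hdtop⟩ := H.exists_isAtom_inner_eq (κ • b - μ • u)
    have h1 : dualNorm p (κ • d + u) - μ * inner ℝ u d ≤
      dualNorm p (κ • a + u) - μ * inner ℝ u a := hmax hd
    have h2 := H.inner_le_dualNorm_of_le_one (κ • d + u) hb.1.le
    rw [inner_add_left, real_inner_smul_left, real_inner_comm b d] at h2
    rw [← hdtop]
    simp only [inner_sub_left, real_inner_smul_left]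
    rw [hG, ← real_inner_comm a b] at h1
    linarith
  have hal : inner ℝ a b ≤ (1 : ℝ) := by
    have := real_inner_le_norm a b; rwa [ha.2, hb.2, one_mul] at this
  have hf : inner ℝ u b ≤ (1 : ℝ) := (hu b).trans hb.1.le
  have hbe : inner ℝ u a ≤ (1 : ℝ) := (hu a).trans ha.1.le
  have hbe' : -1 ≤ (inner ℝ u a : ℝ) := by
    have := abs_le.1 (abs_inner_le_of_mem_dualBall hu a); rw [ha.1] at this; exact this.1
  have h0 : κ + inner ℝ u a ≤ κ * inner ℝ a b + inner ℝ u b := by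
    rw [← hG]
    have := H.inner_le_dualNorm_of_le_one (κ • a + u) ha.1.le
    rwa [inner_add_left, real_inner_smul_left, hAA, mul_one] at this
  have hal0 : 0 ≤ (inner ℝ a b : ℝ) := by
    by_contra hcon
    nlinarith
  have hlip : (inner ℝ u b - inner ℝ u a) ^ 2 ≤ 2 * ‖u‖ ^ 2 * (1 - inner ℝ a b) := by
    have h1 : |inner ℝ u (b - a)| ≤ ‖u‖ * ‖b - a‖ := abs_real_inner_le_norm _ _
    have h2 : ‖b - a‖ ^ 2 = 2 * (1 - inner ℝ a b) := by
      rw [norm_sub_sq_real, ha.2, hb.2, real_inner_comm]; ring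
    rw [← inner_sub_right, ← sq_abs]
    calc |inner ℝ u (b - a)| ^ 2 ≤ (‖u‖ * ‖b - a‖) ^ 2 := pow_le_pow_left₀ (abs_nonneg _) h1 2
      _ = 2 * ‖u‖ ^ 2 * (1 - inner ℝ a b) := by rw [mul_pow, h2]; ring
  have hpa : p (H.proj a b) ≤ 1 - inner ℝ a b :=
    (H.proj_atom_le ha hb).trans (by linarith [le_abs_self (inner ℝ a b)])
  have hpb : p (H.proj b a) ≤ 1 - inner ℝ a b := by
    refine (H.proj_atom_le hb ha).trans ?_
    rw [real_inner_comm]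
    linarith [le_abs_self (inner ℝ a b)]
  have h1 : κ - μ * inner ℝ u b ≤ (κ * inner ℝ a b - μ * inner ℝ u a) * inner ℝ a b +
      κ * (1 - inner ℝ a b) ^ 2 + μ * (1 - inner ℝ a b) := by
    obtain ⟨hz, -⟩ := H.sub_smul_mem_perp ha hatop
    have hg : dualNorm p (κ • b - μ • u) = κ * inner ℝ a b - μ * inner ℝ u a := by
      rw [← hatop, inner_sub_left, real_inner_smul_left, real_inner_smul_left, real_inner_comm]
    rw [hg] at hz
    have e1 := H.inner_proj_eq hz b
    have e2 := H.inner_eq_zero_of_mem_perp ha (H.proj_mem a b)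
    simp only [inner_sub_left, real_inner_smul_left, hBB, e2, H.inner_proj_self] at e1
    have e3 : ‖H.proj a b‖ ^ 2 ≤ (1 - inner ℝ a b) ^ 2 :=
      pow_le_pow_left₀ (norm_nonneg _) ((H.norm_le _).trans hpa) 2
    have e4 : -(1 - inner ℝ a b) ≤ inner ℝ u (H.proj a b) := by
      have := (abs_le.1 (abs_inner_le_of_mem_dualBall hu (H.proj a b))).1
      linarith
    nlinarith [mul_le_mul_of_nonneg_left e3 hκ.le, mul_le_mul_of_nonneg_left e4 hμ0.le]
  have h2 : (κ * inner ℝ a b + inner ℝ u b) * inner ℝ a b - (1 - inner ℝ a b) ≤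
      κ + inner ℝ u a := by
    obtain ⟨hz, -⟩ := H.sub_smul_mem_perp hb hbtop
    rw [hG] at hz
    have e1 := H.inner_proj_eq hz a
    have e2 := H.inner_eq_zero_of_mem_perp hb (H.proj_mem b a)
    simp only [inner_sub_left, inner_add_left, real_inner_smul_left, hAA, e2,
      H.inner_proj_self] at e1
    rw [real_inner_comm a b] at e1
    have e4 : -(1 - inner ℝ a b) ≤ inner ℝ u (H.proj b a) := by
      have := (abs_le.1 (abs_inner_le_of_mem_dualBall hu (H.proj b a))).1
      linarith
    nlinarith [mul_nonneg hκ.le (sq_nonneg ‖H.proj b a‖)]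
  obtain ⟨ha1, hfb⟩ := eq_of_correlation_bounds hκ hε hμκ hμ1 hμ0 hal hf hbe hκR h0 hlip h1 h2
  intro d hd
  have h3 : dualNorm p (κ • d + u) - μ * inner ℝ u d ≤
    dualNorm p (κ • a + u) - μ * inner ℝ u a := hmax hd
  rw [hG, ha1, hfb] at h3
  have h4 : (2 + ε) / κ = 1 - μ := by rw [hμ]; ring
  rw [h4]
  nlinarith

/-- The norm is differentiable at an atom along the directions normal to `a` and `T_aᗮ`, with
derivative zero. -/
lemma apply_atom_add_smul_le {a n : E} (ha : IsAtom p a) (han : inner ℝ a n = 0)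
    (hn : ∀ v ∈ H.perp a, inner ℝ v n = 0) {ε : ℝ} (hε : 0 < ε) :
    ∃ s₀ : ℝ, 0 < s₀ ∧ ∀ s : ℝ, 0 < s → s ≤ s₀ → p (a + s • n) ≤ 1 + ε * s := by
  set K : Set E := dualBall p ∩ {ξ : E | ε ≤ inner ℝ ξ n} with hK
  have hKc : IsCompact K := by
    refine isCompact_dualBall.inter_right (isClosed_le continuous_const (by fun_prop))
  have key : ∀ s : ℝ, p (a + s • n) =
      inner ℝ (H.sgn (a + s • n)) a + s * inner ℝ (H.sgn (a + s • n)) n := fun s => by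
    rw [← real_inner_smul_right, ← inner_add_right, H.inner_sgn_self]
  have hle : ∀ ξ ∈ dualBall p, inner ℝ ξ a ≤ 1 := fun ξ hξ => (hξ a).trans ha.1.le
  rcases K.eq_empty_or_nonempty with hE | hne
  · refine ⟨1, one_pos, fun s hs _ => ?_⟩
    have h1 : inner ℝ (H.sgn (a + s • n)) n ≤ ε := by
      by_contra hcon
      have : H.sgn (a + s • n) ∈ K := ⟨H.sgn_mem_dualBall _, (not_le.1 hcon).le⟩
      rw [hE] at this; exact this
    rw [key]
    nlinarith [hle _ (H.sgn_mem_dualBall (a + s • n))]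
  · obtain ⟨ξ, hξ, hmax⟩ := hKc.exists_isMaxOn hne
      (f := fun ξ : E => (inner ℝ ξ a : ℝ)) (by fun_prop)
    have hm : inner ℝ ξ a < (1 : ℝ) := by
      refine (hle ξ hξ.1).lt_of_ne fun h => ?_
      obtain ⟨v, hv, -, he⟩ := H.exists_eq_sgn_add (x := a)
        (mem_subdiff_iff.2 ⟨hξ.1, by rw [h, ha.1]⟩)
      have h2 : ε ≤ inner ℝ ξ n := hξ.2
      rw [he, H.sgn_eq_self ha, inner_add_left, han, hn v hv] at h2
      linarith
    have hpn : 0 ≤ p n := apply_nonneg _ _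
    refine ⟨(1 - inner ℝ ξ a) / (p n + 1), div_pos (by linarith) (by linarith), fun s hs hs0 => ?_⟩
    rw [le_div_iff₀ (by linarith)] at hs0
    rw [key]
    have hB := H.sgn_mem_dualBall (a + s • n)
    by_cases h1 : ε ≤ inner ℝ (H.sgn (a + s • n)) n
    · have h2 : inner ℝ (H.sgn (a + s • n)) a ≤ (inner ℝ ξ a : ℝ) := hmax ⟨hB, h1⟩
      have h3 := mul_le_mul_of_nonneg_left (hB n) hs.le
      nlinarith [mul_pos hε hs]
    · have h2 := hle _ hB
      nlinarith [not_le.1 h1]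

/-- The component of `u` normal to `a` and `T_aᗮ`. -/
def normalPart (a u : E) : E := u - H.proj a u - (inner ℝ u a : ℝ) • a

lemma inner_normalPart_atom {a : E} (ha : IsAtom p a) (u : E) :
    inner ℝ a (H.normalPart a u) = 0 := by
  have := H.inner_eq_zero_of_mem_perp ha (H.proj_mem a u)
  rw [normalPart, inner_sub_right, inner_sub_right, this, real_inner_smul_right,
    real_inner_self_eq_norm_sq, ha.2, real_inner_comm]
  ring

lemma inner_perp_normalPart {a v : E} (ha : IsAtom p a) (hv : v ∈ H.perp a) (u : E) :
    inner ℝ v (H.normalPart a u) = 0 := by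
  have := H.inner_eq_zero_of_mem_perp ha hv
  rw [normalPart, inner_sub_right, inner_sub_right, H.inner_proj_eq hv, real_inner_smul_right,
    real_inner_comm a v, this, real_inner_comm u v]
  ring

lemma inner_normalPart_self {a : E} (ha : IsAtom p a) (u : E) :
    inner ℝ u (H.normalPart a u) = ‖H.normalPart a u‖ ^ 2 := by
  have h1 := H.inner_normalPart_atom ha u
  have h2 := H.inner_perp_normalPart ha (H.proj_mem a u) u
  have : u = H.normalPart a u + H.proj a u + (inner ℝ u a : ℝ) • a := by
    rw [normalPart]; abel
  nth_rewrite 1 [this]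
  rw [inner_add_left, inner_add_left, h2, real_inner_smul_left, h1, real_inner_self_eq_norm_sq]
  ring

/-- For small `s` the top atom `c` of `a + s n`, with `n` the normal part of `u`, is an atom at
distance about `s ‖n‖` from `a` in the direction `n`; inserting it in the uniform bound
`dualNorm_smul_atom_add_le` with `κ = 1 / s` bounds `‖n‖`. -/
lemma norm_normalPart_sq_le_aux [Nontrivial E] {a u : E} (ha : IsAtom p a) (hu : u ∈ dualBall p)
    {ε : ℝ} (hε : 0 < ε) :
    ‖H.normalPart a u‖ ^ 2 - ε ≤
      ‖H.normalPart a u‖ ^ 2 / 2 + (2 + ε) * (1 - inner ℝ u a) := by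
  obtain ⟨κ₀, hκ₀, hS1⟩ := H.dualNorm_smul_atom_add_le hu hε
  obtain ⟨s₀, hs₀, hS2⟩ := H.apply_atom_add_smul_le ha (H.inner_normalPart_atom ha u)
    (fun v hv => H.inner_perp_normalPart ha hv u) hε
  set n := H.normalPart a u with hn
  set N : ℝ := ‖n‖ ^ 2 with hN
  set β : ℝ := inner ℝ u a with hβ
  have hN0 : 0 ≤ N := sq_nonneg _
  have hAA : inner ℝ a a = (1 : ℝ) := by rw [real_inner_self_eq_norm_sq, ha.2, one_pow]
  have hβ1 : |β| ≤ 1 := (abs_inner_le_of_mem_dualBall hu a).trans ha.1.le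
  set F : ℝ → ℝ := fun s => s * N / 2 + (1 + s ^ 2 * N / 2) * (N / 2 / (1 - ε * s)) +
    (1 + s ^ 2 * N / 2) * ((2 + ε) * (1 - β)) with hF
  have hlim : Tendsto F (𝓝[>] 0) (𝓝 (N / 2 + (2 + ε) * (1 - β))) := by
    have hc : ContinuousAt F 0 := by
      have : (1 : ℝ) - ε * 0 ≠ 0 := by norm_num
      fun_prop (disch := assumption)
    have h0 : F 0 = N / 2 + (2 + ε) * (1 - β) := by simp [hF]
    rw [← h0]
    exact hc.tendsto.mono_left nhdsWithin_le_nhds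
  refine ge_of_tendsto hlim ?_
  have hsm : ∀ᶠ s : ℝ in 𝓝[>] 0, s < min s₀ (min κ₀⁻¹ (ε⁻¹ / 2)) :=
    (eventually_lt_nhds (lt_min hs₀ (lt_min (inv_pos.2 hκ₀) (by positivity)))).filter_mono
      nhdsWithin_le_nhds
  filter_upwards [hsm, self_mem_nhdsWithin] with s hs hspos
  replace hspos : 0 < s := hspos
  obtain ⟨hs1, hs2, hs3⟩ : s < s₀ ∧ s < κ₀⁻¹ ∧ s < ε⁻¹ / 2 := by simpa using hs
  have hεs : ε * s < 1 / 2 := by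
    have := mul_lt_mul_of_pos_left hs3 hε
    rwa [← mul_div_assoc, mul_inv_cancel₀ hε.ne'] at this
  obtain ⟨c, hc, hctop⟩ := H.exists_isAtom_inner_eq (a + s • n)
  obtain ⟨hz, -⟩ := H.sub_smul_mem_perp hc hctop
  set g := dualNorm p (a + s • n) with hg
  set z := a + s • n - g • c with hzdef
  have hy : a + s • n = g • c + z := by rw [hzdef]; abel
  have hcz : inner ℝ c z = 0 := H.inner_eq_zero_of_mem_perp hc hz
  have hn0 : inner ℝ a n = 0 := H.inner_normalPart_atom ha u
  have hg1 : 1 ≤ g := by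
    have := H.inner_le_dualNorm_of_le_one (a + s • n) ha.1.le
    rwa [inner_add_left, hAA, real_inner_smul_left, real_inner_comm, hn0, mul_zero, add_zero] at this
  have hsq : g ^ 2 + ‖z‖ ^ 2 = 1 + s ^ 2 * N := by
    have e1 : ‖a + s • n‖ ^ 2 = 1 + s ^ 2 * N := by
      rw [norm_add_sq_real, real_inner_smul_right, hn0, ha.2, norm_smul, mul_pow,
        Real.norm_eq_abs, sq_abs]
      ring
    rw [← e1, hy, norm_add_sq_real, real_inner_smul_left, hcz, norm_smul, hc.2,
      Real.norm_eq_abs, mul_one, sq_abs]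
    ring
  have hg2 : g - 1 ≤ s ^ 2 * N / 2 := by nlinarith [sq_nonneg ‖z‖, sq_nonneg (g - 1)]
  have hpz : p z ≤ ε * s := by
    have e1 := H.proj_add_abs_le c (a + s • n)
    have e2 : H.proj c (a + s • n) = z := by
      rw [hy, map_add, map_smul]
      have e3 : H.proj c c = 0 := by
        have := H.inner_proj_self c c
        rw [H.inner_eq_zero_of_mem_perp hc (H.proj_mem c c)] at this
        exact norm_eq_zero.1 (pow_eq_zero_iff two_ne_zero |>.1 this.symm)
      rw [e3, smul_zero, zero_add]
      exact Submodule.starProjection_eq_self_iff.2 hz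
    rw [e2, H.sgn_eq_self hc, real_inner_comm, hctop, abs_of_pos (by linarith)] at e1
    linarith [hS2 s hspos hs1.le]
  have hη : (1 - inner ℝ a c) * (1 - ε * s) ≤ s ^ 2 * N / 2 := by
    have e1 : 1 = g * inner ℝ a c + inner ℝ a z := by
      have : inner ℝ a (a + s • n) = (1 : ℝ) := by
        rw [inner_add_right, hAA, real_inner_smul_right, hn0, mul_zero, add_zero]
      rw [← this, hy, inner_add_right, real_inner_smul_right]
    have e0 : 0 ≤ 1 - (inner ℝ a c : ℝ) := by
      have := real_inner_le_norm a c
      rw [ha.2, hc.2] at this; linarith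
    have e2 : inner ℝ a z ≤ (1 - inner ℝ a c) * (ε * s) := by
      calc inner ℝ a z = inner ℝ z (H.proj c a) := by
            rw [H.inner_proj_eq hz, real_inner_comm]
        _ ≤ ‖z‖ * ‖H.proj c a‖ := real_inner_le_norm _ _
        _ ≤ p z * p (H.proj c a) :=
            mul_le_mul (H.norm_le _) (H.norm_le _) (norm_nonneg _) (apply_nonneg _ _)
        _ ≤ (ε * s) * (1 - inner ℝ a c) := by
            refine mul_le_mul hpz ?_ (apply_nonneg _ _) (by positivity)
            refine (H.proj_atom_le hc ha).trans ?_
            rw [real_inner_comm]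
            linarith [le_abs_self (inner ℝ a c)]
        _ = _ := mul_comm _ _
    nlinarith
  have huc : β + s * N - ε * s ≤ g * inner ℝ u c := by
    have e1 : inner ℝ u (a + s • n) = β + s * N := by
      rw [inner_add_right, real_inner_smul_right, H.inner_normalPart_self ha]
    have e2 : inner ℝ u (a + s • n) = g * inner ℝ u c + inner ℝ u z := by
      rw [hy, inner_add_right, real_inner_smul_right]
    linarith [(hu z).trans hpz]
  have hup : s⁻¹ * inner ℝ a c + inner ℝ u c ≤ s⁻¹ + β + (2 + ε) * s * (1 - β) := by
    have e1 := hS1 s⁻¹ ((le_inv_comm₀ hκ₀ hspos).2 hs2.le) a ha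
    have e2 := H.inner_le_dualNorm_of_le_one (s⁻¹ • a + u) hc.1.le
    rw [inner_add_left, real_inner_smul_left] at e2
    rw [div_inv_eq_mul] at e1
    exact e2.trans e1
  set η : ℝ := 1 - inner ℝ a c with hηdef
  have hη' : s⁻¹ * η ≤ s * (N / 2 / (1 - ε * s)) := by
    rw [inv_mul_le_iff₀ hspos, ← mul_assoc, mul_div_assoc', le_div_iff₀ (by linarith)]
    linarith
  have hup' : inner ℝ u c ≤ β + s * (N / 2 / (1 - ε * s)) + (2 + ε) * s * (1 - β) := by
    have : s⁻¹ * inner ℝ a c = s⁻¹ - s⁻¹ * η := by rw [hηdef]; ring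
    linarith
  have hβ2 := abs_le.1 hβ1
  have hW : 0 ≤ N / 2 / (1 - ε * s) := div_nonneg (by linarith) (by linarith)
  have hV : 0 ≤ (2 + ε) * (1 - β) := mul_nonneg (by linarith) (by linarith)
  have hup'' : inner ℝ u c ≤ β + s * (N / 2 / (1 - ε * s)) + s * ((2 + ε) * (1 - β)) := by
    linarith
  exact le_of_second_order_bounds hg1 hg2 hspos hβ2.2 hW hV huc hup''

lemma norm_normalPart_sq_le [Nontrivial E] {a u : E} (ha : IsAtom p a) (hu : u ∈ dualBall p) :
    ‖H.normalPart a u‖ ^ 2 ≤ 4 * (1 - inner ℝ u a) := by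
  by_contra hcon
  rw [not_le] at hcon
  set N : ℝ := ‖H.normalPart a u‖ ^ 2
  set β : ℝ := inner ℝ u a
  have hβ := abs_le.1 ((abs_inner_le_of_mem_dualBall hu a).trans ha.1.le)
  have h := H.norm_normalPart_sq_le_aux ha hu (ε := (N / 2 - 2 * (1 - β)) / 4) (by linarith)
  have : (N / 2 - 2 * (1 - β)) / 4 * (1 - β) ≤ (N / 2 - 2 * (1 - β)) / 4 * 2 :=
    mul_le_mul_of_nonneg_left (by linarith [hβ.1]) (by linarith)
  nlinarith

/-- A point of the dual ball is moved by a vector of norm at most `√5` when its components along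
`a` and normal to `T_aᗮ` are replaced by those of a subgradient at `a`. -/
lemma norm_atom_add_proj_sub_sq_le [Nontrivial E] {a u : E} (ha : IsAtom p a)
    (hu : u ∈ dualBall p) : ‖a + H.proj a u - u‖ ^ 2 ≤ 5 := by
  have h1 := H.norm_normalPart_sq_le ha hu
  have h2 := H.norm_normalPart_sq_le ha (neg_mem_dualBall hu)
  have e1 : H.normalPart a (-u) = -H.normalPart a u := by
    simp only [normalPart, map_neg, inner_neg_left, neg_smul]; abel
  rw [e1, norm_neg, inner_neg_left] at h2
  have hβ := abs_le.1 ((abs_inner_le_of_mem_dualBall hu a).trans ha.1.le)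
  have e2 : a + H.proj a u - u = (1 - inner ℝ u a : ℝ) • a - H.normalPart a u := by
    rw [normalPart, sub_smul, one_smul]; abel
  rw [e2, norm_sub_sq_real, real_inner_smul_left, H.inner_normalPart_atom ha, norm_smul, ha.2,
    Real.norm_eq_abs, mul_one, sq_abs]
  rcases le_total 0 (inner ℝ u a : ℝ) with h | h
  · nlinarith [hβ.2]
  · nlinarith [hβ.1]

end IsAtomicDecomposable

/-! ### Frames and spectral decompositions -/

section Frames

variable {E : Type*} [NormedAddCommGroup E] [InnerProductSpace ℝ E]

/-- A frame is a finite set of pairwise strongly orthogonal atoms. -/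
structure IsFrame (p : Seminorm ℝ E) (s : Finset E) : Prop where
  atom : ∀ a ∈ s, IsAtom p a
  ortho : ∀ a ∈ s, ∀ b ∈ s, a ≠ b → Ortho p a b

variable {p : Seminorm ℝ E} {s : Finset E}

lemma IsFrame.subset {t : Finset E} (hs : IsFrame p s) (h : t ⊆ s) : IsFrame p t :=
  ⟨fun a ha => hs.atom a (h ha), fun a ha b hb => hs.ortho a (h ha) b (h hb)⟩

lemma isFrame_empty : IsFrame p ∅ := ⟨by simp, by simp⟩

open Classical in
lemma isFrame_insert {b : E} (hs : IsFrame p s) (hb : IsAtom p b)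
    (h : ∀ a ∈ s, Ortho p b a) : IsFrame p (insert b s) := by
  refine ⟨fun a ha => ?_, fun a ha c hc hac => ?_⟩
  · rcases Finset.mem_insert.1 ha with rfl | ha
    exacts [hb, hs.atom a ha]
  · rcases Finset.mem_insert.1 ha with rfl | ha' <;> rcases Finset.mem_insert.1 hc with rfl | hc'
    · exact absurd rfl hac
    · exact h c hc'
    · exact (h a ha').symm
    · exact hs.ortho a ha' c hc' hac

/-- The norm of a nonnegative combination is at most the sum of the coefficients. -/
lemma IsFrame.apply_sum_le (hs : IsFrame p s) {σ : E → ℝ} (hσ : ∀ a ∈ s, 0 ≤ σ a) :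
    p (∑ a ∈ s, σ a • a) ≤ ∑ a ∈ s, σ a := by
  have h : p (∑ a ∈ s, σ a • a) ≤ ∑ a ∈ s, p (σ a • a) :=
    Finset.le_sum_of_subadditive p (map_zero p).le (map_add_le_add p) s _
  refine h.trans (Finset.sum_le_sum fun a ha => ?_)
  rw [map_smul_eq_mul, (hs.atom a ha).1, mul_one, Real.norm_eq_abs, abs_of_nonneg (hσ a ha)]

variable [FiniteDimensional ℝ E] (H : IsAtomicDecomposable p)

namespace IsAtomicDecomposable

include H

lemma inner_frame (hs : IsFrame p s) {a b : E} (ha : a ∈ s) (hb : b ∈ s) (hab : a ≠ b) :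
    inner ℝ a b = 0 :=
  H.inner_eq_zero_of_mem_perp (hs.atom a ha)
    (H.mem_perp_of_ortho (hs.atom a ha) (hs.ortho a ha b hb hab))

lemma inner_frame_sum (hs : IsFrame p s) (c : E → ℝ) {b : E} (hb : b ∈ s) :
    inner ℝ (∑ a ∈ s, c a • a) b = c b := by
  rw [sum_inner, Finset.sum_eq_single b]
  · rw [real_inner_smul_left, real_inner_self_eq_norm_sq, (hs.atom b hb).2]; ring
  · intro a ha hab
    rw [real_inner_smul_left, H.inner_frame hs ha hb hab, mul_zero]
  · exact fun h => absurd hb h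

lemma norm_frame_sum_sq (hs : IsFrame p s) (c : E → ℝ) :
    ‖∑ a ∈ s, c a • a‖ ^ 2 = ∑ a ∈ s, c a ^ 2 := by
  rw [← real_inner_self_eq_norm_sq]
  nth_rewrite 2 [← Finset.sum_congr rfl fun a _ => rfl]
  rw [inner_sum]
  refine Finset.sum_congr rfl fun b hb => ?_
  rw [real_inner_smul_right, H.inner_frame_sum hs c hb]; ring

lemma sum_mem_perp {b : E} (hb : IsAtom p b) (h : ∀ a ∈ s, Ortho p b a) (c : E → ℝ) :
    ∑ a ∈ s, c a • a ∈ H.perp b :=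
  (H.perp b).sum_mem fun a ha => (H.perp b).smul_mem _ (H.mem_perp_of_ortho hb (h a ha))

lemma sum_add_mem_dualBall (hs : IsFrame p s) {v : E} (hv : v ∈ dualBall p)
    (hvs : ∀ a ∈ s, v ∈ H.perp a) : ∑ a ∈ s, a + v ∈ dualBall p := by
  classical
  induction s using Finset.induction_on with
  | empty => simpa using hv
  | insert b s hbs ih =>
    have hb := hs.atom b (Finset.mem_insert_self _ _)
    have ih' := ih (hs.subset (Finset.subset_insert _ _))
      fun a ha => hvs a (Finset.mem_insert_of_mem ha)
    rw [Finset.sum_insert hbs, add_assoc]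
    refine ((H.ortho_iff hb).2 ⟨(H.perp b).add_mem ?_ (hvs b (Finset.mem_insert_self _ _)), ih'⟩).1
    have := H.sum_mem_perp hb (s := s) (fun a ha => hs.ortho b (Finset.mem_insert_self _ _) a
      (Finset.mem_insert_of_mem ha) fun h => hbs (h ▸ ha)) (fun _ => 1)
    simpa using this

lemma sum_mem_dualBall (hs : IsFrame p s) : ∑ a ∈ s, a ∈ dualBall p := by
  have := H.sum_add_mem_dualBall hs zero_mem_dualBall fun a _ => (H.perp a).zero_mem
  simpa using this

lemma inner_sum_frame_sum (hs : IsFrame p s) (c : E → ℝ) :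
    inner ℝ (∑ a ∈ s, a) (∑ a ∈ s, c a • a) = ∑ a ∈ s, c a := by
  rw [sum_inner]
  exact Finset.sum_congr rfl fun a ha => by rw [real_inner_comm, H.inner_frame_sum hs c ha]

lemma apply_frame_sum (hs : IsFrame p s) {σ : E → ℝ} (hσ : ∀ a ∈ s, 0 ≤ σ a) :
    p (∑ a ∈ s, σ a • a) = ∑ a ∈ s, σ a := by
  refine le_antisymm (hs.apply_sum_le hσ) ?_
  rw [← H.inner_sum_frame_sum hs]
  exact H.sum_mem_dualBall hs _

lemma norm_sum_frame_sq (hs : IsFrame p s) : ‖∑ a ∈ s, a‖ ^ 2 = s.card := by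
  have := H.norm_frame_sum_sq hs fun _ => 1
  simpa using this

/-- Subgradients of a positive combination of a frame have inner product one with its atoms. -/
lemma inner_subdiff_frame (hs : IsFrame p s) {σ : E → ℝ} (hσ : ∀ a ∈ s, 0 < σ a) {ξ : E}
    (hξ : ξ ∈ subdiff p (∑ a ∈ s, σ a • a)) {a : E} (ha : a ∈ s) : inner ℝ ξ a = 1 := by
  obtain ⟨hB, hξ'⟩ := mem_subdiff_iff.1 hξ
  rw [H.apply_frame_sum hs fun a ha => (hσ a ha).le, inner_sum] at hξ'
  have hle : ∀ b ∈ s, inner ℝ ξ (σ b • b) ≤ σ b := fun b hb => by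
    rw [real_inner_smul_right]
    have := hB b
    rw [(hs.atom b hb).1] at this
    exact mul_le_of_le_one_right (hσ b hb).le this
  have h := (Finset.sum_eq_sum_iff_of_le hle).1 hξ' a ha
  rw [real_inner_smul_right] at h
  exact mul_left_cancel₀ (hσ a ha).ne' (h.trans (mul_one _).symm)

open Classical in
/-- Spectral decomposition inside a subspace that contains the top atoms of its elements. -/
lemma exists_frame_aux [Nontrivial E] (d : ℕ) : ∀ V : Submodule ℝ E, Module.finrank ℝ V = d →
    (∀ y ∈ V, y ≠ 0 → ∀ b, IsAtom p b → inner ℝ y b = dualNorm p y → b ∈ V) → ∀ y ∈ V,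
    ∃ s : Finset E, IsFrame p s ∧ (∀ a ∈ s, a ∈ V) ∧
      ∃ σ : E → ℝ, (∀ a ∈ s, 0 < σ a) ∧ y = ∑ a ∈ s, σ a • a := by
  induction d using Nat.strong_induction_on with
  | _ d ih =>
  intro V hd hV y hy
  rcases eq_or_ne y 0 with rfl | hy0
  · exact ⟨∅, isFrame_empty, by simp, fun _ => 0, by simp, by simp⟩
  obtain ⟨b, hb, htop⟩ := H.exists_isAtom_inner_eq y
  have hbV := hV y hy hy0 b hb htop
  obtain ⟨hz, -⟩ := H.sub_smul_mem_perp hb htop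
  have hbb : b ∉ H.perp b := fun h => by
    have := H.inner_eq_zero_of_mem_perp hb h
    rw [real_inner_self_eq_norm_sq, hb.2] at this
    norm_num at this
  have hlt : V ⊓ H.perp b < V :=
    inf_le_left.lt_of_ne fun h => hbb (h.ge hbV).2
  obtain ⟨s, hs, hsV, σ, hσ, hσy⟩ := ih _ (hd ▸ Submodule.finrank_lt_finrank_of_lt hlt)
    (V ⊓ H.perp b) rfl
    (fun w hw hw0 c hc hct => ⟨hV w hw.1 hw0 c hc hct, H.top_mem_perp hw.2 hw0 hc hct⟩)
    (y - dualNorm p y • b) ⟨V.sub_mem hy (V.smul_mem _ hbV), hz⟩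
  have hbs : b ∉ s := fun h => hbb (hsV b h).2
  refine ⟨insert b s, isFrame_insert hs hb fun a ha => (H.ortho_iff hb).2
    ⟨(hsV a ha).2, H.mem_dualBall_of_isAtom (hs.atom a ha)⟩, ?_,
    fun a => if a = b then dualNorm p y else σ a, ?_, ?_⟩
  · intro a ha
    rcases Finset.mem_insert.1 ha with rfl | ha
    exacts [hbV, (hsV a ha).1]
  · intro a ha
    rcases Finset.mem_insert.1 ha with rfl | ha
    · simpa using H.dualNorm_pos hy0
    · have : a ≠ b := fun h => hbs (h ▸ ha)
      simpa [this] using hσ a ha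
  · dsimp only
    rw [Finset.sum_insert hbs, if_pos rfl, Finset.sum_congr rfl (g := fun a => σ a • a), ← hσy]
    · abel
    · intro a ha
      have : a ≠ b := fun h => hbs (h ▸ ha)
      simp [this]

/-- Every vector is a positive combination of a frame. -/
lemma exists_frame [Nontrivial E] (y : E) : ∃ s : Finset E, IsFrame p s ∧
    ∃ σ : E → ℝ, (∀ a ∈ s, 0 < σ a) ∧ y = ∑ a ∈ s, σ a • a := by
  obtain ⟨s, hs, -, h⟩ := H.exists_frame_aux _ ⊤ rfl (fun _ _ _ _ _ _ => trivial) y trivial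
  exact ⟨s, hs, h⟩

/-- Projecting successively onto the spaces `T_aᗮ`, for `a` in a frame, moves each point of the
dual ball towards a subgradient at the frame, with mutually orthogonal displacements. -/
lemma exists_mem_perp_near [Nontrivial E] (hs : IsFrame p s) : ∀ u ∈ dualBall p,
    ∃ v ∈ dualBall p, (∀ a ∈ s, v ∈ H.perp a) ∧
      (∀ b, IsAtom p b → (∀ a ∈ s, Ortho p a b) → u ∈ H.perp b → v ∈ H.perp b) ∧
      ‖∑ a ∈ s, a + v - u‖ ^ 2 ≤ 5 * s.card := by
  classical
  induction s using Finset.induction_on with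
  | empty => exact fun u hu => ⟨u, hu, by simp, fun _ _ _ h => h, by simp⟩
  | insert c s hcs ih =>
    intro u hu
    have hc := hs.atom c (Finset.mem_insert_self _ _)
    have hco : ∀ a ∈ s, Ortho p c a := fun a ha => hs.ortho c (Finset.mem_insert_self _ _) a
      (Finset.mem_insert_of_mem ha) fun h => hcs (h ▸ ha)
    obtain ⟨v, hv, hvs, hvb, hvn⟩ := ih (hs.subset (Finset.subset_insert _ _)) _
      (H.proj_mem_dualBall c hu)
    have hvc : v ∈ H.perp c := hvb c hc (fun a ha => (hco a ha).symm) (H.proj_mem c u)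
    refine ⟨v, hv, ?_, ?_, ?_⟩
    · intro a ha
      rcases Finset.mem_insert.1 ha with rfl | ha
      exacts [hvc, hvs a ha]
    · intro b hb hab hub
      exact hvb b hb (fun a ha => hab a (Finset.mem_insert_of_mem ha))
        (H.proj_mem_perp hc hb (hab c (Finset.mem_insert_self _ _)) hub)
    · have e1 : ∑ a ∈ insert c s, a + v - u =
          (c + H.proj c u - u) + (∑ a ∈ s, a + v - H.proj c u) := by
        rw [Finset.sum_insert hcs]; abel
      have hw : ∑ a ∈ s, a + v - H.proj c u ∈ H.perp c := by
        refine (H.perp c).sub_mem ((H.perp c).add_mem ?_ hvc) (H.proj_mem c u)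
        simpa using H.sum_mem_perp hc hco (fun _ => 1)
      have e2 : inner ℝ (c + H.proj c u - u) (∑ a ∈ s, a + v - H.proj c u) = 0 := by
        have h1 := H.inner_eq_zero_of_mem_perp hc hw
        have h2 := H.inner_proj_left c u (∑ a ∈ s, a + v - H.proj c u)
        have h3 : H.proj c (∑ a ∈ s, a + v - H.proj c u) = ∑ a ∈ s, a + v - H.proj c u :=
          Submodule.starProjection_eq_self_iff.2 hw
        rw [h3] at h2
        rw [inner_sub_left, inner_add_left, h1, h2]; ring
      have h5 := H.norm_atom_add_proj_sub_sq_le hc hu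
      rw [e1, norm_add_sq_real, e2, Finset.card_insert_of_notMem hcs]
      push_cast
      linarith

/-- The dual ball lies within distance `√(5 k)` of the subdifferential at a combination of a frame
of `k` atoms. -/
lemma exists_subdiff_near [Nontrivial E] (hs : IsFrame p s) {σ : E → ℝ} (hσ : ∀ a ∈ s, 0 ≤ σ a)
    {u : E} (hu : u ∈ dualBall p) :
    ∃ ξ ∈ subdiff p (∑ a ∈ s, σ a • a), ‖ξ - u‖ ≤ √(5 * s.card) := by
  obtain ⟨v, hv, hvs, -, hn⟩ := H.exists_mem_perp_near hs u hu
  refine ⟨_, mem_subdiff_iff.2 ⟨H.sum_add_mem_dualBall hs hv hvs, ?_⟩, Real.le_sqrt_of_sq_le hn⟩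
  have h0 : inner ℝ v (∑ a ∈ s, σ a • a) = 0 := by
    rw [inner_sum]
    refine Finset.sum_eq_zero fun a ha => ?_
    rw [real_inner_smul_right, real_inner_comm,
      H.inner_eq_zero_of_mem_perp (hs.atom a ha) (hvs a ha), mul_zero]
  rw [inner_add_left, H.inner_sum_frame_sum hs, H.apply_frame_sum hs hσ, h0, add_zero]

end IsAtomicDecomposable

/-- `x` is a nonnegative combination of a frame of `k` atoms. -/
def HasRank (p : Seminorm ℝ E) (x : E) (k : ℕ) : Prop :=
  ∃ s : Finset E, IsFrame p s ∧ s.card = k ∧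
    ∃ σ : E → ℝ, (∀ a ∈ s, 0 ≤ σ a) ∧ x = ∑ a ∈ s, σ a • a

omit [FiniteDimensional ℝ E] in
lemma hasRank_zero : HasRank p (0 : E) 0 :=
  ⟨∅, isFrame_empty, rfl, fun _ => 0, by simp, by simp⟩

namespace IsAtomicDecomposable

include H

/-- Differences of vectors of low rank have a small ratio of `p` to the inner-product norm: compare
the subgradient of `p` at `x - y` with nearby subgradients at `x` and `y`, and use monotonicity of
the subdifferential. -/
lemma two_mul_apply_sub_le [Nontrivial E] {x y : E} {j k : ℕ} (hx : HasRank p x j)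
    (hy : HasRank p y k) : 2 * p (x - y) ≤ (√(5 * j) + √(5 * k)) * ‖x - y‖ := by
  obtain ⟨s, hs, rfl, σ, hσ, hxs⟩ := hx
  obtain ⟨t, ht, rfl, τ, hτ, hyt⟩ := hy
  set u := H.sgn (x - y) with hu
  have hu1 : u ∈ dualBall p := H.sgn_mem_dualBall _
  have hu2 : inner ℝ u (x - y) = p (x - y) := H.inner_sgn_self _
  obtain ⟨ξ, hξ, hξn⟩ := H.exists_subdiff_near hs hσ (neg_mem_dualBall hu1)
  obtain ⟨ζ, hζ, hζn⟩ := H.exists_subdiff_near ht hτ hu1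
  rw [← hxs] at hξ
  rw [← hyt] at hζ
  have h1 := hξ y
  have h2 := hζ x
  have h3 := abs_le.1 ((abs_real_inner_le_norm (ξ - -u) (x - y)).trans
    (mul_le_mul_of_nonneg_right hξn (norm_nonneg _)))
  have h4 := abs_le.1 ((abs_real_inner_le_norm (ζ - u) (x - y)).trans
    (mul_le_mul_of_nonneg_right hζn (norm_nonneg _)))
  have h5 : inner ℝ ξ (y - x) = -inner ℝ ξ (x - y) := by rw [← neg_sub x y, inner_neg_right]
  rw [sub_neg_eq_add, inner_add_left, hu2] at h3
  rw [inner_sub_left, hu2] at h4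
  rw [h5] at h1
  linarith [h3.1, h3.2, h4.1, h4.2]

variable {F : Type*} [NormedAddCommGroup F] [InnerProductSpace ℝ F]

omit [FiniteDimensional ℝ E] H in
/-- Derandomized sampling of `j` atoms: for a quadratic form `q` and weights with mean `m`, some
sum of `j` atoms does no worse than the average. -/
lemma exists_sum_le (A : E →ₗ[ℝ] F) (ρ : ℝ) {w : E → ℝ} (hw : ∀ a ∈ s, 0 ≤ w a)
    (hw1 : ∑ a ∈ s, w a = 1) (j : ℕ) : ∀ y : E, ∃ n : E → ℕ, ∑ a ∈ s, n a = j ∧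
      ρ * ‖y + ∑ a ∈ s, (n a : ℝ) • a‖ ^ 2 - ‖A (y + ∑ a ∈ s, (n a : ℝ) • a)‖ ^ 2 ≤
        (ρ * ‖y + (j : ℝ) • ∑ a ∈ s, w a • a‖ ^ 2 - ‖A (y + (j : ℝ) • ∑ a ∈ s, w a • a)‖ ^ 2) +
          j * (∑ a ∈ s, w a * (ρ * ‖a‖ ^ 2 - ‖A a‖ ^ 2) -
            (ρ * ‖∑ a ∈ s, w a • a‖ ^ 2 - ‖A (∑ a ∈ s, w a • a)‖ ^ 2)) := by
  classical
  set m := ∑ a ∈ s, w a • a with hm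
  set q : E → ℝ := fun x => ρ * ‖x‖ ^ 2 - ‖A x‖ ^ 2 with hq
  set B : E → E → ℝ := fun x y => 2 * (ρ * inner ℝ x y - inner ℝ (A x) (A y)) with hB
  have hqB : ∀ x y, q (x + y) = q x + q y + B x y := fun x y => by
    simp only [hq, hB, map_add, norm_add_sq_real]; ring
  have hBm : ∀ x, B x m = ∑ a ∈ s, w a * B x a := fun x => by
    simp only [hB, hm, map_sum, map_smul, inner_sum, real_inner_smul_right, Finset.mul_sum,
      ← Finset.sum_sub_distrib]
    exact Finset.sum_congr rfl fun a _ => by ring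
  change ∀ y : E, ∃ n : E → ℕ, ∑ a ∈ s, n a = j ∧ q (y + ∑ a ∈ s, (n a : ℝ) • a) ≤
    q (y + (j : ℝ) • m) + j * (∑ a ∈ s, w a * q a - q m)
  induction j with
  | zero => exact fun y => ⟨fun _ => 0, by simp, by simp⟩
  | succ j ih =>
    intro y
    obtain ⟨b, hb, hbq⟩ : ∃ b ∈ s, q (y + (j : ℝ) • m + b) ≤
        q (y + (j : ℝ) • m + m) + (∑ a ∈ s, w a * q a - q m) := by
      by_contra! hcon
      set Y := y + (j : ℝ) • m
      have h1 : ∑ a ∈ s, w a * q (Y + a) = q (Y + m) + (∑ a ∈ s, w a * q a - q m) := by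
        simp only [hqB, mul_add, Finset.sum_add_distrib, hBm, ← Finset.sum_mul, hw1]
        ring
      obtain ⟨c, hc, hwc⟩ : ∃ c ∈ s, 0 < w c := by
        by_contra! hneg
        have : ∑ a ∈ s, w a ≤ 0 := Finset.sum_nonpos hneg
        linarith
      have h2 : ∑ a ∈ s, w a * (q (Y + m) + (∑ a ∈ s, w a * q a - q m)) <
          ∑ a ∈ s, w a * q (Y + a) :=
        Finset.sum_lt_sum (fun a ha => mul_le_mul_of_nonneg_left (hcon a ha).le (hw a ha))
          ⟨c, hc, mul_lt_mul_of_pos_left (hcon c hc) hwc⟩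
      rw [← Finset.sum_mul, hw1, one_mul, h1] at h2
      exact lt_irrefl _ h2
    obtain ⟨n, hn, hle⟩ := ih (y + b)
    refine ⟨fun a => n a + if a = b then 1 else 0, ?_, ?_⟩
    · rw [Finset.sum_add_distrib, hn, Finset.sum_ite_eq' s b, if_pos hb]
    · have e1 : ∑ a ∈ s, ((n a + if a = b then 1 else 0 : ℕ) : ℝ) • a =
          ∑ a ∈ s, (n a : ℝ) • a + b := by
        simp only [Nat.cast_add, add_smul, Finset.sum_add_distrib, Nat.cast_ite, Nat.cast_one,
          Nat.cast_zero, ite_smul, one_smul, zero_smul]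
        rw [Finset.sum_ite_eq' s b, if_pos hb]
      have e2 : y + (∑ a ∈ s, (n a : ℝ) • a + b) = y + b + ∑ a ∈ s, (n a : ℝ) • a := by abel
      have e3 : y + b + (j : ℝ) • m = y + (j : ℝ) • m + b := by abel
      have e4 : y + ((j + 1 : ℕ) : ℝ) • m = y + (j : ℝ) • m + m := by
        push_cast; rw [add_smul, one_smul]; abel
      rw [e1, e2, e4]
      rw [e3] at hle
      push_cast
      linarith

/-- An upper bound `ρ` on the vectors with `p² ≤ K ‖·‖²` extends to all vectors at the cost of an
additional term `p² / (k - 1)`: a vector is an average of sums of `k ≤ K` atoms. -/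
lemma norm_map_sq_le_of_restricted (hs : IsFrame p s) (A : E →ₗ[ℝ] F) {ρ K : ℝ}
    (hA : ∀ x : E, p x ^ 2 ≤ K * ‖x‖ ^ 2 → ‖A x‖ ^ 2 ≤ ρ * ‖x‖ ^ 2) {k : ℕ} (hk : 2 ≤ k)
    (hkK : (k : ℝ) ≤ K) {σ : E → ℝ} (hσ : ∀ a ∈ s, 0 ≤ σ a) :
    ‖A (∑ a ∈ s, σ a • a)‖ ^ 2 ≤
      ρ * (‖∑ a ∈ s, σ a • a‖ ^ 2 + (∑ a ∈ s, σ a) ^ 2 / (k - 1)) := by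
  have hk1 : (0 : ℝ) < k - 1 := by
    have : (2 : ℝ) ≤ k := by exact_mod_cast hk
    linarith
  set P := ∑ a ∈ s, σ a with hP
  have hP0 : 0 ≤ P := Finset.sum_nonneg hσ
  rcases hP0.eq_or_lt with hP0 | hP0
  · have h0 : ∀ a ∈ s, σ a = 0 := (Finset.sum_eq_zero_iff_of_nonneg hσ).1 hP0.symm
    have : ∑ a ∈ s, σ a • a = 0 := Finset.sum_eq_zero fun a ha => by rw [h0 a ha, zero_smul]
    rw [this, map_zero, ← hP0]
    simp
  set w : E → ℝ := fun a => P⁻¹ * σ a with hw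
  have hv : ∑ a ∈ s, σ a • a = P • ∑ a ∈ s, w a • a := by
    rw [Finset.smul_sum]
    refine Finset.sum_congr rfl fun a _ => ?_
    rw [smul_smul, hw, mul_inv_cancel_left₀ hP0.ne']
  obtain ⟨n, hn, hle⟩ := exists_sum_le (s := s) A ρ (w := w)
    (fun a ha => mul_nonneg (inv_nonneg.2 hP0.le) (hσ a ha))
    (by rw [← Finset.mul_sum, ← hP, inv_mul_cancel₀ hP0.ne']) k 0
  set m := ∑ a ∈ s, w a • a with hm
  have hw1 : ∑ a ∈ s, w a = 1 := by rw [← Finset.mul_sum, ← hP, inv_mul_cancel₀ hP0.ne']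
  have hn' : ∑ a ∈ s, (n a : ℝ) = k := by exact_mod_cast hn
  have hsamp : ‖A (∑ a ∈ s, (n a : ℝ) • a)‖ ^ 2 ≤ ρ * ‖∑ a ∈ s, (n a : ℝ) • a‖ ^ 2 := by
    refine hA _ ?_
    have h1 : p (∑ a ∈ s, (n a : ℝ) • a) ≤ k := by
      rw [← hn']; exact hs.apply_sum_le fun a _ => Nat.cast_nonneg _
    have h2 : (k : ℝ) ≤ ‖∑ a ∈ s, (n a : ℝ) • a‖ ^ 2 := by
      rw [H.norm_frame_sum_sq hs, ← hn']
      refine Finset.sum_le_sum fun a _ => ?_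
      exact_mod_cast Nat.le_self_pow two_ne_zero (n a)
    have h3 := apply_nonneg p (∑ a ∈ s, (n a : ℝ) • a)
    have hk0 : (0 : ℝ) ≤ k := Nat.cast_nonneg _
    calc p (∑ a ∈ s, (n a : ℝ) • a) ^ 2 ≤ (k : ℝ) ^ 2 := pow_le_pow_left₀ h3 h1 2
      _ = k * k := by ring
      _ ≤ K * ‖∑ a ∈ s, (n a : ℝ) • a‖ ^ 2 := mul_le_mul hkK h2 hk0 (hk0.trans hkK)
  have hc : ∑ a ∈ s, w a * (ρ * ‖a‖ ^ 2 - ‖A a‖ ^ 2) ≤ ρ := by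
    calc ∑ a ∈ s, w a * (ρ * ‖a‖ ^ 2 - ‖A a‖ ^ 2) ≤ ∑ a ∈ s, w a * ρ := by
          refine Finset.sum_le_sum fun a ha => mul_le_mul_of_nonneg_left ?_
            (mul_nonneg (inv_nonneg.2 hP0.le) (hσ a ha))
          rw [(hs.atom a ha).2]
          nlinarith [sq_nonneg ‖A a‖]
      _ = ρ := by rw [← Finset.sum_mul, hw1, one_mul]
  simp only [zero_add, map_smul, norm_smul, mul_pow, Real.norm_eq_abs, sq_abs] at hle
  have hk0 : (0 : ℝ) < k := by linarith
  have h1 : 0 ≤ (k : ℝ) * ((k - 1) * (ρ * ‖m‖ ^ 2 - ‖A m‖ ^ 2) + ρ) := by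
    have := mul_le_mul_of_nonneg_left hc hk0.le
    nlinarith
  have h2 : 0 ≤ (k - 1) * (ρ * ‖m‖ ^ 2 - ‖A m‖ ^ 2) + ρ := by
    by_contra hcon
    nlinarith [mul_neg_of_pos_of_neg hk0 (not_le.1 hcon)]
  have h3 : ‖A m‖ ^ 2 ≤ ρ * ‖m‖ ^ 2 + ρ / (k - 1) := by
    have : 0 ≤ ((k - 1) * (ρ * ‖m‖ ^ 2 - ‖A m‖ ^ 2) + ρ) / (k - 1) := div_nonneg h2 hk1.le
    rw [add_div, mul_div_cancel_left₀ _ hk1.ne'] at this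
    linarith
  rw [hv, map_smul, norm_smul, norm_smul, mul_pow, mul_pow, Real.norm_eq_abs, sq_abs]
  calc P ^ 2 * ‖A m‖ ^ 2 ≤ P ^ 2 * (ρ * ‖m‖ ^ 2 + ρ / (k - 1)) :=
        mul_le_mul_of_nonneg_left h3 (sq_nonneg _)
    _ = _ := by ring

end IsAtomicDecomposable

end Frames

/-! ### Optimality conditions and the proximal step -/

section Optimality

variable {E : Type*} [NormedAddCommGroup E] [InnerProductSpace ℝ E] [FiniteDimensional ℝ E]
  {m : ℕ} (P : Problem E m)

/-- A first-order condition from a one-sided second-order expansion. -/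
lemma nonneg_of_forall_quadratic {a b : ℝ} (h : ∀ t : ℝ, 0 < t → t ≤ 1 → 0 ≤ t * a + t ^ 2 * b) :
    0 ≤ a := by
  by_contra! ha
  have hb : 0 < b := by have := h 1 one_pos le_rfl; linarith
  have ht : 0 < min 1 (-a / (2 * b)) := lt_min one_pos (div_pos (by linarith) (by linarith))
  have h1 := h _ ht (min_le_left _ _)
  have h2 : min 1 (-a / (2 * b)) * (2 * b) ≤ -a := by
    rw [← le_div_iff₀ (by linarith)]; exact min_le_right _ _
  set t := min 1 (-a / (2 * b))
  have h3 : 0 ≤ t * (a + t * b) := by linarith [h1, (by ring : t * (a + t * b) = t * a + t ^ 2 * b)]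
  have h4 := nonneg_of_mul_nonneg_right h3 ht
  linarith

omit [FiniteDimensional ℝ E] in
lemma Problem.reg_segment_le (x d : E) {t : ℝ} (ht : 0 ≤ t) (ht1 : t ≤ 1) :
    P.reg (x + t • d) ≤ P.reg x + t * (P.reg (x + d) - P.reg x) := by
  have e : x + t • d = (1 - t) • x + t • (x + d) := by
    rw [sub_smul, smul_add, one_smul]; abel
  rw [e]
  refine (map_add_le_add _ _ _).trans ?_
  rw [map_smul_eq_mul, map_smul_eq_mul, Real.norm_eq_abs, Real.norm_eq_abs, abs_of_nonneg ht,
    abs_of_nonneg (by linarith)]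
  linarith

/-- The optimality condition of the proximal step. -/
lemma Problem.prox_subgradient {lam L : ℝ} (hlam : 0 < lam) (hL : 0 < L) (y : E) :
    ∃ ξ ∈ subdiff P.reg (P.prox lam L y),
      lam • ξ = -P.grad y - L • (P.prox lam L y - y) := by
  set x := P.prox lam L y with hx
  have hmin := P.prox_spec hlam.le hL y
  rw [← hx] at hmin
  refine ⟨lam⁻¹ • (-P.grad y - L • (x - y)), fun w => ?_, by
    rw [smul_smul, mul_inv_cancel₀ hlam.ne', one_smul]⟩
  have key : 0 ≤ inner ℝ (P.grad y + L • (x - y)) (w - x) + lam * (P.reg w - P.reg x) := by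
    refine nonneg_of_forall_quadratic (b := L / 2 * ‖w - x‖ ^ 2) fun t ht ht1 => ?_
    have h1 := hmin (x + t • (w - x))
    have h2 := mul_le_mul_of_nonneg_left (P.reg_segment_le x (w - x) ht.le ht1) hlam.le
    rw [add_sub_cancel] at h2
    have e1 : x + t • (w - x) - y = (x - y) + t • (w - x) := by abel
    simp only [Problem.model, e1, inner_add_right, norm_add_sq_real, real_inner_smul_right,
      norm_smul, mul_pow, Real.norm_eq_abs, sq_abs] at h1
    rw [inner_add_left, real_inner_smul_left]
    nlinarith
  rw [real_inner_smul_left, ← sub_nonneg]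
  have e : P.reg w - (P.reg x + lam⁻¹ * inner ℝ (-P.grad y - L • (x - y)) (w - x)) =
      lam⁻¹ * (inner ℝ (P.grad y + L • (x - y)) (w - x) + lam * (P.reg w - P.reg x)) := by
    have : -P.grad y - L • (x - y) = -(P.grad y + L • (x - y)) := by abel
    rw [this, inner_neg_left]
    field_simp
    ring
  rw [e]
  exact mul_nonneg (inv_nonneg.2 hlam.le) key

/-- The optimality condition of the regularized problem. -/
lemma Problem.phi_subgradient {lam : ℝ} (hlam : 0 < lam) {x : E}
    (hmin : ∀ w, P.phi lam x ≤ P.phi lam w) :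
    ∃ ξ ∈ subdiff P.reg x, lam • ξ = -P.grad x := by
  refine ⟨lam⁻¹ • (-P.grad x), fun w => ?_, by
    rw [smul_smul, mul_inv_cancel₀ hlam.ne', one_smul]⟩
  have key : 0 ≤ inner ℝ (P.grad x) (w - x) + lam * (P.reg w - P.reg x) := by
    refine nonneg_of_forall_quadratic (b := 1 / 2 * ‖P.A (w - x)‖ ^ 2) fun t ht ht1 => ?_
    have h1 := hmin (x + t • (w - x))
    have h2 := mul_le_mul_of_nonneg_left (P.reg_segment_le x (w - x) ht.le ht1) hlam.le
    rw [add_sub_cancel] at h2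
    simp only [Problem.phi] at h1
    rw [P.f_expand x (x + t • (w - x)), add_sub_cancel_left] at h1
    simp only [map_smul, real_inner_smul_right, norm_smul, mul_pow, Real.norm_eq_abs,
      sq_abs] at h1
    nlinarith
  rw [real_inner_smul_left, ← sub_nonneg]
  have e : P.reg w - (P.reg x + lam⁻¹ * inner ℝ (-P.grad x) (w - x)) =
      lam⁻¹ * (inner ℝ (P.grad x) (w - x) + lam * (P.reg w - P.reg x)) := by
    rw [inner_neg_left]
    field_simp
    ring
  rw [e]
  exact mul_nonneg (inv_nonneg.2 hlam.le) key

lemma Problem.exists_minimizer (H : IsAtomicDecomposable P.reg) {lam : ℝ} (hlam : 0 < lam) :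
    ∃ x, ∀ w, P.phi lam x ≤ P.phi lam w := by
  have hcont : Continuous (P.phi lam) := by
    have := P.continuous_reg
    have hA : Continuous P.A := P.A.continuous_of_finiteDimensional
    unfold Problem.phi Problem.f
    fun_prop
  refine hcont.exists_forall_le ?_
  refine Filter.tendsto_atTop_mono (f := fun x : E => lam * ‖x‖) (fun x => ?_) ?_
  · have h1 := mul_le_mul_of_nonneg_left (H.norm_le x) hlam.le
    have h2 : 0 ≤ P.f x := by unfold Problem.f; positivity
    unfold Problem.phi
    linarith
  · exact (tendsto_norm_cocompact_atTop (E := E)).const_mul_atTop hlam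

/-- The directional decrease of the linearized objective along a proximal step. -/
lemma Problem.prox_linear_decrease {lam L : ℝ} {x y ξ : E} (hlam : 0 ≤ lam)
    (hξ : ξ ∈ subdiff P.reg y) (h : lam • ξ = -P.grad x - L • (y - x)) :
    inner ℝ (P.grad x) (y - x) + lam * (P.reg y - P.reg x) ≤ -(L * ‖y - x‖ ^ 2) := by
  have h1 := mul_le_mul_of_nonneg_left (hξ x) hlam
  have h2 : inner ℝ (lam • ξ) (y - x) = -inner ℝ (P.grad x) (y - x) - L * ‖y - x‖ ^ 2 := by
    rw [h, inner_sub_left, inner_neg_left, real_inner_smul_left, real_inner_self_eq_norm_sq]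
  rw [real_inner_smul_left] at h2
  have h3 : inner ℝ ξ (x - y) = -inner ℝ ξ (y - x) := by rw [← neg_sub y x, inner_neg_right]
  rw [h3] at h1
  linarith

/-- The objective gap is controlled by the residual of the optimality condition. -/
lemma Problem.phi_sub_le {lam : ℝ} (hlam : 0 ≤ lam) {x ξ : E} (hξ : ξ ∈ subdiff P.reg x) (w : E) :
    P.phi lam x - P.phi lam w ≤ inner ℝ (P.grad x + lam • ξ) (x - w) := by
  have h1 := mul_le_mul_of_nonneg_left (hξ w) hlam
  have h2 := P.f_expand x w
  have h3 : inner ℝ ξ (w - x) = -inner ℝ ξ (x - w) := by rw [← neg_sub x w, inner_neg_right]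
  have h4 : inner ℝ (P.grad x) (w - x) = -inner ℝ (P.grad x) (x - w) := by
    rw [← neg_sub x w, inner_neg_right]
  rw [inner_add_left, real_inner_smul_left, Problem.phi, Problem.phi, h2]
  rw [h3] at h1
  rw [h4]
  linarith [sq_nonneg ‖P.A (w - x)‖]

lemma Problem.phi_prox_le {lam L : ℝ} (hlam : 0 < lam) (hL : 0 < L) {x : E}
    (hOK : P.LineSearchOK lam L x) :
    P.phi lam (P.prox lam L x) ≤ P.phi lam x - L / 2 * ‖P.prox lam L x - x‖ ^ 2 := by
  obtain ⟨ξ, hξ, h⟩ := P.prox_subgradient hlam hL x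
  have h1 := P.prox_linear_decrease hlam.le hξ h
  refine hOK.trans ?_
  unfold Problem.model Problem.phi
  linarith

lemma Problem.lineSearchOK_iff {lam L : ℝ} {x : E} : P.LineSearchOK lam L x ↔
    ‖P.A (P.prox lam L x - x)‖ ^ 2 ≤ L * ‖P.prox lam L x - x‖ ^ 2 := by
  unfold Problem.LineSearchOK Problem.phi Problem.model
  rw [P.f_expand x (P.prox lam L x)]
  constructor <;> intro h <;> linarith

end Optimality

/-! ### Recovery from restricted eigenvalues -/

namespace IsAtomicDecomposable

section Tangent

variable {E : Type*} [NormedAddCommGroup E] [InnerProductSpace ℝ E] [FiniteDimensional ℝ E]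
  {p : Seminorm ℝ E} (H : IsAtomicDecomposable p)

/-- The component of `h` in the tangent space `T_x`. -/
def tproj (x h : E) : E := h - H.proj x h

lemma tproj_mem (x h : E) : H.tproj x h ∈ tangent H.dec x := by
  rw [← Submodule.orthogonal_orthogonal (tangent H.dec x)]
  exact Submodule.sub_starProjection_mem_orthogonal h

lemma norm_tproj_le (x h : E) : ‖H.tproj x h‖ ≤ ‖h‖ := by
  have h0 : inner ℝ (H.tproj x h) (H.proj x h) = 0 :=
    Submodule.inner_right_of_mem_orthogonal (H.tproj_mem x h) (H.proj_mem x h)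
  have h1 : ‖h‖ ^ 2 = ‖H.tproj x h‖ ^ 2 + ‖H.proj x h‖ ^ 2 := by
    have : h = H.tproj x h + H.proj x h := by rw [tproj]; abel
    conv_lhs => rw [this]
    rw [norm_add_sq_real, h0]; ring
  nlinarith [norm_nonneg h, norm_nonneg (H.tproj x h), sq_nonneg ‖H.proj x h‖]

/-- The norm `p` of the tangential part plus that of the normal part of `h`. -/
def spread (x h : E) : ℝ := p (H.tproj x h) + p (H.proj x h)

lemma apply_le_spread (x h : E) : p h ≤ H.spread x h := by
  have : h = H.tproj x h + H.proj x h := by rw [tproj]; abel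
  conv_lhs => rw [this]
  exact map_add_le_add _ _ _

lemma tproj_le_spread (x h : E) : p (H.tproj x h) ≤ H.spread x h :=
  le_add_of_nonneg_right (apply_nonneg _ _)

/-- Decomposability makes the norm grow along the normal part of a displacement. -/
lemma spread_le_apply_add [Nontrivial E] (x h : E) :
    H.spread x h - 2 * p (H.tproj x h) ≤ p (x + h) - p x := by
  set v := H.proj x (H.sgn (H.proj x h)) with hv
  have hvB : v ∈ dualBall p := H.proj_mem_dualBall x (H.sgn_mem_dualBall _)
  have h1 := H.sgn_add_mem_subdiff (H.proj_mem x (H.sgn (H.proj x h))) hvB (x + h)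
  have h2 : inner ℝ v h = p (H.proj x h) := by
    rw [hv, H.inner_proj_left, H.inner_sgn_self]
  have h3 : inner ℝ (H.sgn x) h = inner ℝ (H.sgn x) (H.tproj x h) := by
    rw [tproj, inner_sub_right, H.inner_sgn_of_mem_perp (H.proj_mem x h), sub_zero]
  have h4 := (abs_le.1 (abs_inner_le_of_mem_dualBall (H.sgn_mem_dualBall x) (H.tproj x h))).1
  rw [add_sub_cancel_left, ← hv, inner_add_left, h2, h3] at h1
  rw [spread]
  linarith

end Tangent

end IsAtomicDecomposable

variable {E : Type*} [NormedAddCommGroup E] [InnerProductSpace ℝ E] [FiniteDimensional ℝ E]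
  {m : ℕ}

/-- The balance between noise level `ν` and warm start accuracy `δ`. -/
lemma noise_tradeoff {ν δ : ℝ} (hν : 0 ≤ ν) (hν1 : ν ≤ 1 / 4) (hδ : 0 ≤ δ) (hδ1 : δ ≤ 1 / 4) :
    (1 + ν) ^ 2 * (1 - δ - ν) ≤ 2 * (4 / 5 - 5 / 8 * δ) ^ 2 := by
  have h1 : (1 + ν) ^ 2 * (1 - ν) ≤ 1 + ν := by nlinarith [mul_nonneg hν (sq_nonneg ν)]
  have h2 : (1 + ν) ^ 2 * (1 - ν) ≤ 75 / 64 + 5 / 16 * (ν - 1 / 4) := by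
    nlinarith [mul_nonneg hν (sq_nonneg (ν - 1 / 4)), sq_nonneg (ν - 1 / 4)]
  have h3 : δ * (1 + 2 * ν) ≤ δ * (1 + ν) ^ 2 :=
    mul_le_mul_of_nonneg_left (by nlinarith) hδ
  have h4 : (1 + ν) ^ 2 * (1 - δ - ν) = (1 + ν) ^ 2 * (1 - ν) - δ * (1 + ν) ^ 2 := by ring
  rcases le_total ν (3 / 20) with h | h
  · nlinarith [mul_nonneg (sub_nonneg.2 hδ1) (sub_nonneg.2 h), mul_nonneg hδ (sub_nonneg.2 hδ1)]
  · nlinarith [mul_nonneg (sub_nonneg.2 hδ1) (sub_nonneg.2 h), mul_nonneg hδ (sub_nonneg.2 hδ1)]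

/-- A noisy measurement `b = A x₀ + z` with restricted eigenvalue bounds. The parameter `ck` stands
for `c K(x₀)`, `G` for `1 + γ`, and `72 Q` for the dimension `2 k̃` at which the spectrum of `A` is
confined to `[ρm, ρp]`; `ρs` and `ρ1` are the lower bound on the cone of recovery and the upper
bound on atoms. The field `gain` expresses that `1 + γ = 2 λ / ((1 - δ) λ - p*(A* z))` at `λ_tgt`, so
that the left side is the smaller one for larger `λ`; `ratio` is the condition on the restricted
eigenvalues. -/
structure RecoverySetting (P : Problem E m) (H : IsAtomicDecomposable P.reg) where
  x₀ : E
  z : EuclideanSpace ℝ (Fin m)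
  (ck G Q δ lamT ρs ρp ρm ρ1 ginc : ℝ)
  b_eq : P.b = P.A x₀ + z
  one_le_ck : 1 ≤ ck
  two_le_G : 2 ≤ G
  two_le_Q : 2 ≤ Q
  δ_pos : 0 < δ
  δ_le : δ ≤ 1 / 4
  lamT_pos : 0 < lamT
  noise : dualNorm P.reg (P.adj z) ≤ lamT / 4
  ρs_pos : 0 < ρs
  ρp_pos : 0 < ρp
  ρm_pos : 0 < ρm
  ρ1_nonneg : 0 ≤ ρ1
  one_le_ginc : 1 ≤ ginc
  tangent_le : ∀ t ∈ tangent H.dec x₀, P.reg t ^ 2 ≤ ck * ‖t‖ ^ 2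
  gain : ∀ lam, lamT ≤ lam → 2 * lam ≤ G * ((1 - δ) * lam - dualNorm P.reg (P.adj z))
  cone_lower : ∀ x, P.reg x ^ 2 ≤ ck * G ^ 2 * ‖x‖ ^ 2 → ρs * ‖x‖ ^ 2 ≤ ‖P.A x‖ ^ 2
  lower : ∀ x, P.reg x ^ 2 ≤ 72 * Q * ‖x‖ ^ 2 → ρm * ‖x‖ ^ 2 ≤ ‖P.A x‖ ^ 2
  upper : ∀ x, P.reg x ^ 2 ≤ 72 * Q * ‖x‖ ^ 2 → ‖P.A x‖ ^ 2 ≤ ρp * ‖x‖ ^ 2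
  atom_upper : ∀ x, P.reg x ^ 2 ≤ ‖x‖ ^ 2 → ‖P.A x‖ ^ 2 ≤ ρ1 * ‖x‖ ^ 2
  ratio : ρp * ck * G * ginc ≤ Q * ρs

namespace RecoverySetting

variable {P : Problem E m} {H : IsAtomicDecomposable P.reg} (K : RecoverySetting P H)

lemma ck_pos : 0 < K.ck := one_pos.trans_le K.one_le_ck

lemma G_pos : 0 < K.G := two_pos.trans_le K.two_le_G

/-- The scale of the error `‖x - x₀‖` of approximate solutions. -/
def errBound (lam : ℝ) : ℝ := lam * K.ck * K.G / K.ρs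

/-- The dual norm of the noise. -/
def noiseNorm : ℝ := dualNorm P.reg (P.adj K.z)

/-- `φ_λ(x)` is within the warm start accuracy of the minimum. -/
def NearOptimal (lam : ℝ) (x : E) : Prop :=
  ∀ w, P.phi lam x ≤ P.phi lam w + K.δ * lam * K.errBound lam

variable {lam : ℝ} (hlam : K.lamT ≤ lam)

include hlam in
lemma lam_pos : 0 < lam := K.lamT_pos.trans_le hlam

include hlam in
lemma errBound_pos : 0 < K.errBound lam :=
  div_pos (mul_pos (mul_pos (K.lam_pos hlam) K.ck_pos) K.G_pos) K.ρs_pos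

include hlam in
lemma noiseNorm_le : K.noiseNorm ≤ lam / 4 := by
  have := K.noise
  rw [noiseNorm]
  linarith

lemma inner_grad (x w : E) : inner ℝ (P.grad x) w =
    inner ℝ (P.A (x - K.x₀)) (P.A w) - inner ℝ (P.adj K.z) w := by
  simp only [Problem.grad, Problem.adj, LinearMap.adjoint_inner_left]
  rw [← inner_sub_left, K.b_eq, map_sub]
  congr 1
  abel

include H in
lemma abs_inner_noise_le (w : E) : |inner ℝ (P.adj K.z) w| ≤ K.noiseNorm * P.reg w :=
  H.abs_inner_le_dualNorm_mul _ _

lemma tproj_sq_le {h : E} (hS : H.spread K.x₀ h ≤ K.G * P.reg (H.tproj K.x₀ h)) :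
    K.ρs * P.reg (H.tproj K.x₀ h) ^ 2 ≤ K.ck * ‖P.A h‖ ^ 2 := by
  have h1 : P.reg (H.tproj K.x₀ h) ^ 2 ≤ K.ck * ‖h‖ ^ 2 :=
    (K.tangent_le _ (H.tproj_mem _ _)).trans (mul_le_mul_of_nonneg_left
      (pow_le_pow_left₀ (norm_nonneg _) (H.norm_tproj_le _ _) 2) K.ck_pos.le)
  have h2 : P.reg h ^ 2 ≤ K.ck * K.G ^ 2 * ‖h‖ ^ 2 := by
    calc P.reg h ^ 2 ≤ (K.G * P.reg (H.tproj K.x₀ h)) ^ 2 :=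
          pow_le_pow_left₀ (apply_nonneg _ _) ((H.apply_le_spread _ _).trans hS) 2
      _ = K.G ^ 2 * P.reg (H.tproj K.x₀ h) ^ 2 := by ring
      _ ≤ K.G ^ 2 * (K.ck * ‖h‖ ^ 2) := mul_le_mul_of_nonneg_left h1 (sq_nonneg _)
      _ = _ := by ring
  have h3 := mul_le_mul_of_nonneg_left (K.cone_lower h h2) K.ck_pos.le
  have h4 := mul_le_mul_of_nonneg_left h1 K.ρs_pos.le
  linarith

include hlam in
/-- A bound `‖A h‖² ≤ μ λ (t - S / G)`, with `t` and `S` the tangential part and the spread of the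
error `h`, confines the spread. -/
lemma spread_le_of_norm_sq_le {h : E} {μ : ℝ} (hμ : 0 < μ)
    (hA : ‖P.A h‖ ^ 2 ≤ μ * lam * (P.reg (H.tproj K.x₀ h) - H.spread K.x₀ h / K.G)) :
    H.spread K.x₀ h ≤ μ / 4 * K.errBound lam := by
  have hl := K.lam_pos hlam
  set t := P.reg (H.tproj K.x₀ h)
  set S := H.spread K.x₀ h
  have hG := K.G_pos
  have hck := K.ck_pos
  have hρ := K.ρs_pos
  have h0 : 0 ≤ t - S / K.G :=
    nonneg_of_mul_nonneg_right ((sq_nonneg _).trans hA) (mul_pos hμ hl)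
  have hS : S ≤ K.G * t := by
    rw [mul_comm, ← div_le_iff₀ hG]; linarith
  have h1 := K.tproj_sq_le hS
  have h2 := mul_le_mul_of_nonneg_left hA hck.le
  set X := μ * lam * K.ck with hX
  have hX0 : 0 < X := by positivity
  have h3 : K.ρs * t ^ 2 ≤ X * (t - S / K.G) := by
    rw [hX]; linarith
  have h4 : K.ρs * (S / K.G) ≤ X / 4 := by
    have h5 : X * (K.ρs * (S / K.G)) ≤ X * (X / 4) := by
      nlinarith [mul_le_mul_of_nonneg_left h3 hρ.le, sq_nonneg (K.ρs * t - X / 2)]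
    exact le_of_mul_le_mul_left h5 hX0
  have h6 : μ / 4 * K.errBound lam = X / 4 / K.ρs * K.G := by
    rw [errBound, hX]; field_simp
  rw [h6, ← div_le_iff₀ hG, le_div_iff₀ hρ, mul_comm]
  exact h4

variable [Nontrivial E]

include hlam in
/-- Approximate stationary points lie close to `x₀`. -/
lemma spread_le_of_residual_le {x ξ : E} (hξ : ξ ∈ subdiff P.reg x)
    (hres : dualNorm P.reg (P.grad x + lam • ξ) ≤ K.δ * lam) :
    H.spread K.x₀ (x - K.x₀) ≤ K.errBound lam / 2 := by
  have hl := K.lam_pos hlam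
  set h := x - K.x₀ with hh
  have e1 := H.spread_le_apply_add K.x₀ h
  rw [hh, add_sub_cancel, ← hh] at e1
  have e2 := hξ K.x₀
  rw [← neg_sub, ← hh, inner_neg_right] at e2
  have e3 := H.inner_le_dualNorm_mul (P.grad x + lam • ξ) h
  rw [inner_add_left, real_inner_smul_left, K.inner_grad, ← hh, real_inner_self_eq_norm_sq] at e3
  have hp := H.apply_le_spread K.x₀ h
  have hp0 := apply_nonneg P.reg h
  have e4 : dualNorm P.reg (P.grad x + lam • ξ) * P.reg h ≤ K.δ * lam * H.spread K.x₀ h :=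
    mul_le_mul hres hp hp0 (mul_nonneg K.δ_pos.le hl.le)
  have hn0 : 0 ≤ K.noiseNorm := H.dualNorm_nonneg _
  have e5 := (le_abs_self _).trans (K.abs_inner_noise_le h)
  have e6 := mul_le_mul_of_nonneg_left hp hn0
  have e7 : lam * (H.spread K.x₀ h - 2 * P.reg (H.tproj K.x₀ h)) ≤ lam * inner ℝ ξ h :=
    mul_le_mul_of_nonneg_left (by linarith) hl.le
  have hG := K.G_pos
  have e8 : 2 * lam / K.G ≤ (1 - K.δ) * lam - K.noiseNorm := by
    rw [div_le_iff₀ hG, mul_comm _ K.G]; exact K.gain lam hlam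
  have e9 := mul_le_mul_of_nonneg_right e8 (hp0.trans hp)
  have := K.spread_le_of_norm_sq_le hlam (h := h) two_pos (by
    have : 2 * lam / K.G * H.spread K.x₀ h = 2 * lam * (H.spread K.x₀ h / K.G) := by ring
    rw [mul_sub, ← this]
    nlinarith)
  linarith

include hlam in
lemma spread_le_of_minimizer {x : E} (hmin : ∀ w, P.phi lam x ≤ P.phi lam w) :
    H.spread K.x₀ (x - K.x₀) ≤ K.errBound lam / 2 := by
  obtain ⟨ξ, hξ, h⟩ := P.phi_subgradient (K.lam_pos hlam) hmin
  refine K.spread_le_of_residual_le hlam hξ ?_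
  rw [h, add_neg_cancel]
  have : dualNorm P.reg (0 : E) ≤ 0 := IsAtomicDecomposable.dualNorm_le (by simp)
  exact this.trans (mul_nonneg K.δ_pos.le (K.lam_pos hlam).le)

include hlam in
/-- The objective gap of a point at distance `S` is at most the residual times `S + B / 2`. -/
lemma phi_sub_le_of_residual_le {x ξ : E} (hξ : ξ ∈ subdiff P.reg x) {τ S : ℝ}
    (hres : dualNorm P.reg (P.grad x + lam • ξ) ≤ τ)
    (hS : H.spread K.x₀ (x - K.x₀) ≤ S) (w : E) :
    P.phi lam x - P.phi lam w ≤ τ * (S + K.errBound lam / 2) := by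
  obtain ⟨y, hy⟩ := P.exists_minimizer H (K.lam_pos hlam)
  have h1 := P.phi_sub_le (K.lam_pos hlam).le hξ y
  have h2 := H.inner_le_dualNorm_mul (P.grad x + lam • ξ) (x - y)
  have h3 : P.reg (x - y) ≤ S + K.errBound lam / 2 := by
    have e : x - y = (x - K.x₀) - (y - K.x₀) := by abel
    rw [e]
    exact (map_sub_le_add _ _ _).trans (add_le_add ((H.apply_le_spread _ _).trans hS)
      ((H.apply_le_spread _ _).trans (K.spread_le_of_minimizer hlam hy)))
  have h4 := mul_le_mul hres h3 (apply_nonneg _ _) ((H.dualNorm_nonneg _).trans hres)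
  linarith [hy w]

include hlam in
lemma nearOptimal_of_residual_le {x ξ : E} (hξ : ξ ∈ subdiff P.reg x)
    (hres : dualNorm P.reg (P.grad x + lam • ξ) ≤ K.δ * lam) : K.NearOptimal lam x := by
  intro w
  have := K.phi_sub_le_of_residual_le hlam hξ hres (K.spread_le_of_residual_le hlam hξ hres) w
  linarith

/-- The objective gap to `x₀` in terms of the error. -/
lemma half_norm_sq_le {x : E} (hx : K.NearOptimal lam x) (hl : 0 < lam) :
    1 / 2 * ‖P.A (x - K.x₀)‖ ^ 2 ≤ lam * (2 * P.reg (H.tproj K.x₀ (x - K.x₀))) -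
      (lam - K.noiseNorm) * H.spread K.x₀ (x - K.x₀) + K.δ * lam * K.errBound lam := by
  set h := x - K.x₀ with hh
  have e1 := H.spread_le_apply_add K.x₀ h
  rw [hh, add_sub_cancel, ← hh] at e1
  have e2 := hx K.x₀
  rw [Problem.phi, Problem.phi, P.f_expand K.x₀ x, K.inner_grad, sub_self, map_zero,
    inner_zero_left, ← hh] at e2
  have hn0 : 0 ≤ K.noiseNorm := H.dualNorm_nonneg _
  have e5 := (le_abs_self _).trans (K.abs_inner_noise_le h)
  have e6 := mul_le_mul_of_nonneg_left (H.apply_le_spread K.x₀ h) hn0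
  have e7 := mul_le_mul_of_nonneg_left e1 hl.le
  linarith

include hlam in
/-- Nearly optimal points lie close to `x₀`. -/
lemma spread_le_of_nearOptimal {x : E} (hx : K.NearOptimal lam x) :
    H.spread K.x₀ (x - K.x₀) ≤ K.errBound lam := by
  have hl := K.lam_pos hlam
  have e := K.half_norm_sq_le hx hl
  by_contra! hS
  have hG := K.G_pos
  have hB := K.errBound_pos hlam
  have e8 : 2 * lam / K.G ≤ (1 - K.δ) * lam - K.noiseNorm := by
    rw [div_le_iff₀ hG, mul_comm _ K.G]; exact K.gain lam hlam
  have e9 := mul_le_mul_of_nonneg_right e8 (hB.le.trans hS.le)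
  have e10 := mul_le_mul_of_nonneg_left hS.le (mul_nonneg K.δ_pos.le hl.le)
  have := K.spread_le_of_norm_sq_le hlam (h := x - K.x₀) four_pos (by
    have : 2 * lam / K.G * H.spread K.x₀ (x - K.x₀) =
      2 * lam * (H.spread K.x₀ (x - K.x₀) / K.G) := by ring
    rw [mul_sub]
    nlinarith)
  linarith

include hlam in
/-- Nearly optimal points fit the noiseless data. -/
lemma norm_map_sub_le {x : E} (hx : K.NearOptimal lam x) :
    K.ρs * ‖P.A (x - K.x₀)‖ ^ 2 ≤ 2.56 * (lam ^ 2 * (K.ck * K.G)) := by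
  have hl := K.lam_pos hlam
  have e := K.half_norm_sq_le hx hl
  set h := x - K.x₀ with hh
  set t := P.reg (H.tproj K.x₀ h)
  set S := H.spread K.x₀ h
  set a := ‖P.A h‖ with ha
  have ha0 : 0 ≤ a := norm_nonneg _
  have hG := K.G_pos
  have hρ := K.ρs_pos
  have hck := K.ck_pos
  have hδ := K.δ_pos
  have hδ' := K.δ_le
  have hB := K.errBound_pos hlam
  have hBe : K.ρs * K.errBound lam = lam * K.ck * K.G := by
    rw [errBound]; field_simp
  have hn0 : 0 ≤ K.noiseNorm := H.dualNorm_nonneg _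
  have hn1 := K.noiseNorm_le hlam
  have ht0 : 0 ≤ t := apply_nonneg _ _
  have htS : t ≤ S := H.tproj_le_spread _ _
  have hgain : 2 * lam ≤ K.G * ((1 - K.δ) * lam - K.noiseNorm) := K.gain lam hlam
  by_cases hc : S ≤ K.G * t
  · have h1 : K.ρs * t ^ 2 ≤ K.ck * a ^ 2 := K.tproj_sq_le hc
    have h2 : 1 / 2 * a ^ 2 ≤ (lam + K.noiseNorm) * t + K.δ * lam * K.errBound lam := by
      nlinarith
    -- `v` is the natural unit of `‖A h‖`; the claim reads `a ≤ 1.6 v`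
    set v := √(lam ^ 2 * (K.ck * K.G) / K.ρs) with hv
    have hv0 : 0 < v := Real.sqrt_pos.2 (by positivity)
    have hv2 : v ^ 2 = lam ^ 2 * (K.ck * K.G) / K.ρs := Real.sq_sqrt (by positivity)
    have hBv : K.δ * lam * K.errBound lam = K.δ * v ^ 2 := by
      rw [hv2, errBound]; ring
    have h3 : (lam + K.noiseNorm) * t ≤ (4 / 5 - 5 / 8 * K.δ) * v * a := by
      have hq : 2 * (lam + K.noiseNorm) ^ 2 ≤ 2 * ((4 / 5 - 5 / 8 * K.δ) ^ 2 * K.G) * lam ^ 2 := by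
        set ν := K.noiseNorm / lam with hν
        have hν' : K.noiseNorm = ν * lam := by rw [hν]; field_simp
        have hν0 : 0 ≤ ν := div_nonneg hn0 hl.le
        have hν1 : ν ≤ 1 / 4 := by rw [hν, div_le_iff₀ hl]; linarith
        rw [hν'] at hgain ⊢
        have g1 : 2 ≤ K.G * (1 - K.δ - ν) := by
          have : 2 * lam ≤ K.G * (1 - K.δ - ν) * lam := by linarith
          exact le_of_mul_le_mul_right this hl
        have g2 := noise_tradeoff hν0 hν1 hδ.le hδ'
        have g3 : (1 + ν) ^ 2 * 2 ≤ K.G * (2 * (4 / 5 - 5 / 8 * K.δ) ^ 2) := by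
          calc (1 + ν) ^ 2 * 2 ≤ (1 + ν) ^ 2 * (K.G * (1 - K.δ - ν)) :=
                mul_le_mul_of_nonneg_left g1 (sq_nonneg _)
            _ = K.G * ((1 + ν) ^ 2 * (1 - K.δ - ν)) := by ring
            _ ≤ _ := mul_le_mul_of_nonneg_left g2 hG.le
        have := mul_le_mul_of_nonneg_right g3 (sq_nonneg lam)
        linarith [(by ring : (lam + ν * lam) ^ 2 = (1 + ν) ^ 2 * lam ^ 2)]
      refine abs_le_of_sq_le_sq' ?_ (mul_nonneg (mul_nonneg (by linarith) hv0.le) ha0) |>.2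
      have h4 : t ^ 2 ≤ K.ck * a ^ 2 / K.ρs := by rw [le_div_iff₀ hρ]; linarith
      calc ((lam + K.noiseNorm) * t) ^ 2 = (lam + K.noiseNorm) ^ 2 * t ^ 2 := by ring
        _ ≤ ((4 / 5 - 5 / 8 * K.δ) ^ 2 * K.G * lam ^ 2) * (K.ck * a ^ 2 / K.ρs) :=
            mul_le_mul (by linarith) h4 (sq_nonneg _) (by positivity)
        _ = (4 / 5 - 5 / 8 * K.δ) ^ 2 * (lam ^ 2 * (K.ck * K.G) / K.ρs) * a ^ 2 := by ring
        _ = _ := by rw [← hv2]; ring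
    rw [hBv] at h2
    have h5 : a ≤ 8 / 5 * v := by
      by_contra! hcon
      have : 0 < 1 / 2 * ((a - 8 / 5 * v) * (a + 5 / 4 * K.δ * v)) := by
        have : 0 < a + 5 / 4 * K.δ * v := by positivity
        exact mul_pos (by norm_num) (mul_pos (by linarith) this)
      nlinarith
    have h6 : a ^ 2 ≤ 2.56 * v ^ 2 := by nlinarith
    rw [hv2] at h6
    have h7 := mul_le_mul_of_nonneg_left h6 hρ.le
    have h8 : K.ρs * (2.56 * (lam ^ 2 * (K.ck * K.G) / K.ρs)) =
      2.56 * (lam ^ 2 * (K.ck * K.G)) := by field_simp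
    linarith
  · push Not at hc
    have h1 : (2 * lam) * S ≤ K.G * (((1 - K.δ) * lam - K.noiseNorm) * S) := by
      nlinarith [ht0.trans htS]
    have h2 : 2 * lam * t ≤ ((1 - K.δ) * lam - K.noiseNorm) * S := by
      have : K.G * (2 * lam * t) ≤ K.G * (((1 - K.δ) * lam - K.noiseNorm) * S) := by nlinarith
      exact le_of_mul_le_mul_left this hG
    have h3 : 0 ≤ K.δ * lam * S := by have := ht0.trans htS; positivity
    have h4 : a ^ 2 ≤ 2 * (K.δ * lam * K.errBound lam) := by nlinarith
    have h5 := mul_le_mul_of_nonneg_left h4 hρ.le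
    have h6 : K.ρs * (2 * (K.δ * lam * K.errBound lam)) =
        2 * K.δ * (lam ^ 2 * (K.ck * K.G)) := by
      linear_combination 2 * K.δ * lam * hBe
    have h7 : 0 ≤ lam ^ 2 * (K.ck * K.G) := by positivity
    nlinarith

include hlam in
lemma ρp_mul_norm_map_sub_le {x : E} (hx : K.NearOptimal lam x) :
    K.ρp * ‖P.A (x - K.x₀)‖ ^ 2 ≤ 2.56 * (lam ^ 2 * K.Q) := by
  have h1 := mul_le_mul_of_nonneg_left (K.norm_map_sub_le hlam hx) K.ρp_pos.le
  have h2 : K.ρp * K.ck * K.G ≤ K.Q * K.ρs :=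
    le_trans (le_mul_of_one_le_right (mul_nonneg (mul_nonneg K.ρp_pos.le K.ck_pos.le) K.G_pos.le)
      K.one_le_ginc) K.ratio
  have h3 := mul_le_mul_of_nonneg_left h2 (sq_nonneg lam)
  refine le_of_mul_le_mul_left ?_ K.ρs_pos
  linarith

end RecoverySetting

/-! ### Sparsity of the proximal iterates and the line search -/

/-- The inequality that `exists_hasRank` gives for an accepted step, solved for `t = √(k / Q)`; the
square root is replaced by its linear majorant at `3.3`. -/
lemma rank_ratio_le {t : ℝ} (h : 3 / 4 * t ≤ 8 / 5 * √(1 + t ^ 2 / 71) + √(1 / 2)) :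
    t ≤ 3.3 := by
  by_contra! ht
  have h1 : √(1 + t ^ 2 / 71) ≤ 1.074 + 0.12 * (t - 3.3) := by
    rw [Real.sqrt_le_iff]; constructor <;> nlinarith
  have h2 : √(1 / 2 : ℝ) ≤ 0.7072 := by
    rw [Real.sqrt_le_iff]; constructor <;> norm_num
  linarith

/-- The same for a rejected step, where the curvature ratio `τ` is itself controlled by `t`. -/
lemma rank_ratio_le_of_le {t τ : ℝ} (h : 3 / 4 * t ≤ 8 / 5 * √(1 + t ^ 2 / 71) + √(τ / 2))
    (hτ : τ ≤ 1 + 5 / 4 * (3.3 + t) ^ 2 / 71) : t ≤ 3.7 := by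
  by_contra! ht
  have h1 : √(1 + t ^ 2 / 71) ≤ 1.093 + 0.12 * (t - 3.7) := by
    rw [Real.sqrt_le_iff]; constructor <;> nlinarith
  have h2 : √(τ / 2) ≤ 0.966 + 0.1 * (t - 3.7) := by
    rw [Real.sqrt_le_iff]; constructor <;> nlinarith
  linarith

namespace RecoverySetting

variable {E : Type*} [NormedAddCommGroup E] [InnerProductSpace ℝ E] [FiniteDimensional ℝ E]
  {m : ℕ} {P : Problem E m} {H : IsAtomicDecomposable P.reg} (K : RecoverySetting P H)

/-- Vectors composed of at most `3.3² Q` atoms. The constant is such that differences of two of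
them, and of one of them and a rejected proximal point, lie within the range `72 Q` of the
restricted eigenvalue bounds. -/
def LowRank (x : E) : Prop := ∃ k : ℕ, HasRank P.reg x k ∧ (k : ℝ) ≤ 3.3 ^ 2 * K.Q

lemma Q_pos : 0 < K.Q := by linarith [K.two_le_Q]

lemma lowRank_zero : K.LowRank 0 :=
  ⟨0, hasRank_zero, by have := K.Q_pos; push_cast; positivity⟩

/-- The upper bound on the accepted step parameters. -/
def maxStep : ℝ := K.ginc * K.ρp

lemma maxStep_pos : 0 < K.maxStep :=
  mul_pos (one_pos.trans_le K.one_le_ginc) K.ρp_pos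

lemma step_errBound_le {lam : ℝ} (hlam : K.lamT ≤ lam) {L : ℝ} (hL : L ≤ K.maxStep) :
    4 * (L * (K.δ * lam * K.errBound lam)) ≤ K.Q * lam ^ 2 := by
  have hl := K.lam_pos hlam
  have hρ := K.ρs_pos
  have hB := K.errBound_pos hlam
  have hδ := K.δ_pos
  have h1 : L * (K.δ * lam * K.errBound lam) ≤ K.maxStep * (K.δ * lam * K.errBound lam) :=
    mul_le_mul_of_nonneg_right hL (by positivity)
  have h2 : K.maxStep * K.errBound lam ≤ K.Q * lam := by
    rw [errBound, maxStep, mul_div_assoc', div_le_iff₀ hρ]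
    have := mul_le_mul_of_nonneg_left K.ratio hl.le
    linarith
  have h3 := mul_le_mul_of_nonneg_left h2 (mul_nonneg hδ.le hl.le)
  have h4 : K.δ * (K.Q * lam ^ 2) ≤ 1 / 4 * (K.Q * lam ^ 2) :=
    mul_le_mul_of_nonneg_right K.δ_le (by have := K.Q_pos; positivity)
  linarith

lemma norm_map_frame_sum_sq_le {s : Finset E} (hs : IsFrame P.reg s) {σ : E → ℝ}
    (hσ : ∀ a ∈ s, 0 ≤ σ a) :
    ‖P.A (∑ a ∈ s, σ a • a)‖ ^ 2 ≤
      K.ρp * (‖∑ a ∈ s, σ a • a‖ ^ 2 + P.reg (∑ a ∈ s, σ a • a) ^ 2 / (71 * K.Q)) := by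
  have hQ := K.two_le_Q
  have hk0 : (0 : ℝ) ≤ 72 * K.Q := by linarith
  have hf := Nat.lt_floor_add_one (72 * K.Q)
  have hk : 2 ≤ ⌊72 * K.Q⌋₊ := Nat.le_floor (by push_cast; linarith)
  have h := H.norm_map_sq_le_of_restricted hs P.A K.upper hk (Nat.floor_le hk0) hσ
  rw [← H.apply_frame_sum hs hσ] at h
  refine h.trans (mul_le_mul_of_nonneg_left ?_ K.ρp_pos.le)
  gcongr
  linarith

variable [Nontrivial E]

/-- A bound on `A` without sparsity: the excess is controlled by the norm `p`. -/
lemma norm_map_sq_le (y : E) :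
    ‖P.A y‖ ^ 2 ≤ K.ρp * (‖y‖ ^ 2 + P.reg y ^ 2 / (71 * K.Q)) := by
  obtain ⟨s, hs, σ, hσ, rfl⟩ := H.exists_frame y
  exact K.norm_map_frame_sum_sq_le hs fun a ha => (hσ a ha).le

variable {lam : ℝ} (hlam : K.lamT ≤ lam)

include hlam in
/-- The rank of a proximal point: testing the optimality condition against the sum of its atoms
leaves a contribution of the noise, one of the error and one of the step. -/
lemma exists_hasRank {x y ξ : E} {L τ : ℝ} (hx : K.NearOptimal lam x) (hξ : ξ ∈ subdiff P.reg y)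
    (h : lam • ξ = -P.grad x - L • (y - x)) (hL : 2 * (L * ‖y - x‖) ^ 2 ≤ τ * K.Q * lam ^ 2)
    (hL0 : 0 ≤ L) :
    ∃ k : ℕ, HasRank P.reg y k ∧ ∃ t : ℝ, 0 ≤ t ∧ (k : ℝ) = t ^ 2 * K.Q ∧
      3 / 4 * t ≤ 8 / 5 * √(1 + t ^ 2 / 71) + √(τ / 2) := by
  have hl := K.lam_pos hlam
  have hQ := K.Q_pos
  obtain ⟨s, hs, σ, hσ, rfl⟩ := H.exists_frame y
  set y := ∑ a ∈ s, σ a • a with hy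
  obtain ⟨t, ht0, hk⟩ : ∃ t : ℝ, 0 ≤ t ∧ (s.card : ℝ) = t ^ 2 * K.Q := by
    refine ⟨√(s.card / K.Q), Real.sqrt_nonneg _, ?_⟩
    rw [Real.sq_sqrt (by positivity)]; field_simp
  refine ⟨s.card, ⟨s, hs, rfl, σ, fun a ha => (hσ a ha).le, rfl⟩, t, ht0, hk, ?_⟩
  rcases ht0.eq_or_lt with h0 | htpos
  · rw [← h0]; simp only [mul_zero]; positivity
  set g := ∑ a ∈ s, a with hg
  have hg1 : g = ∑ a ∈ s, (1 : ℝ) • a := by simp [hg]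
  have hgp : P.reg g = s.card := by
    rw [hg1, H.apply_frame_sum hs fun _ _ => zero_le_one]; simp
  have hgn : ‖g‖ = t * √K.Q := by
    have : ‖g‖ ^ 2 = (t * √K.Q) ^ 2 := by
      rw [H.norm_sum_frame_sq hs, mul_pow, Real.sq_sqrt hQ.le, hk]
    exact (pow_left_inj₀ (norm_nonneg _) (by positivity) two_ne_zero).1 this
  have hξg : inner ℝ ξ g = s.card := by
    rw [hg, inner_sum, Finset.sum_congr rfl fun a ha => H.inner_subdiff_frame hs hσ hξ ha]
    simp
  have e := congrArg (fun w => inner ℝ w g) h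
  simp only [real_inner_smul_left, inner_sub_left, inner_neg_left, hξg, K.inner_grad] at e
  rw [← inner_sub_left] at e
  have e1 := (le_abs_self _).trans (K.abs_inner_noise_le g)
  have e2 : K.noiseNorm * P.reg g ≤ lam / 4 * s.card := by
    rw [hgp]; exact mul_le_mul_of_nonneg_right (K.noiseNorm_le hlam) (Nat.cast_nonneg _)
  have hAg : ‖P.A g‖ ^ 2 ≤ K.ρp * (s.card * (1 + t ^ 2 / 71)) := by
    have := K.norm_map_frame_sum_sq_le hs (σ := fun _ => 1) fun _ _ => zero_le_one
    rw [← hg1, hgp, H.norm_sum_frame_sq hs] at this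
    refine this.trans (le_of_eq ?_)
    rw [hk]; field_simp
  have e3 : -inner ℝ (P.A (x - K.x₀)) (P.A g) ≤
      lam * (8 / 5 * √(1 + t ^ 2 / 71)) * (t * K.Q) := by
    refine (neg_le_abs _).trans ((abs_real_inner_le_norm _ _).trans ?_)
    refine abs_le_of_sq_le_sq' ?_ (by positivity) |>.2
    have h2 := K.ρp_mul_norm_map_sub_le hlam hx
    have hs2 : √(1 + t ^ 2 / 71) ^ 2 = 1 + t ^ 2 / 71 := Real.sq_sqrt (by positivity)
    calc (‖P.A (x - K.x₀)‖ * ‖P.A g‖) ^ 2 = ‖P.A (x - K.x₀)‖ ^ 2 * ‖P.A g‖ ^ 2 := by ring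
      _ ≤ ‖P.A (x - K.x₀)‖ ^ 2 * (K.ρp * (s.card * (1 + t ^ 2 / 71))) :=
          mul_le_mul_of_nonneg_left hAg (sq_nonneg _)
      _ = (K.ρp * ‖P.A (x - K.x₀)‖ ^ 2) * (s.card * (1 + t ^ 2 / 71)) := by ring
      _ ≤ 2.56 * (lam ^ 2 * K.Q) * (s.card * (1 + t ^ 2 / 71)) :=
          mul_le_mul_of_nonneg_right h2 (by positivity)
      _ = _ := by rw [hk]; simp only [mul_pow, hs2]; ring
  have e4 : -(L * inner ℝ (y - x) g) ≤ lam * √(τ / 2) * (t * K.Q) := by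
    have h1 : -(L * inner ℝ (y - x) g) ≤ (L * ‖y - x‖) * ‖g‖ := by
      rw [mul_assoc, ← mul_neg]
      exact mul_le_mul_of_nonneg_left ((neg_le_abs _).trans (abs_real_inner_le_norm _ _)) hL0
    have h2 : L * ‖y - x‖ ≤ lam * √(τ / 2) * √K.Q := by
      have hτ : L * ‖y - x‖ = √((L * ‖y - x‖) ^ 2) := (Real.sqrt_sq (by positivity)).symm
      have h3 : lam * √(τ / 2) * √K.Q = √(lam ^ 2 * (τ / 2) * K.Q) := by
        rw [Real.sqrt_mul' _ hQ.le, Real.sqrt_mul (sq_nonneg _), Real.sqrt_sq hl.le]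
      rw [hτ, h3]
      exact Real.sqrt_le_sqrt (by linarith)
    calc _ ≤ (L * ‖y - x‖) * ‖g‖ := h1
      _ ≤ (lam * √(τ / 2) * √K.Q) * (t * √K.Q) := by
          rw [hgn]; exact mul_le_mul_of_nonneg_right h2 (by positivity)
      _ = lam * √(τ / 2) * t * (√K.Q * √K.Q) := by ring
      _ = _ := by rw [Real.mul_self_sqrt hQ.le]; ring
  have e5 : (lam * (t * K.Q)) * (3 / 4 * t) ≤
      (lam * (t * K.Q)) * (8 / 5 * √(1 + t ^ 2 / 71) + √(τ / 2)) := by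
    rw [hk] at e e2
    linarith
  exact le_of_mul_le_mul_left e5 (by positivity)

include hlam in
lemma lowRank_of_step {x y ξ : E} {L : ℝ} (hx : K.NearOptimal lam x) (hξ : ξ ∈ subdiff P.reg y)
    (h : lam • ξ = -P.grad x - L • (y - x)) (hL : 2 * (L * ‖y - x‖) ^ 2 ≤ K.Q * lam ^ 2)
    (hL0 : 0 ≤ L) : K.LowRank y := by
  obtain ⟨k, hk, t, ht0, hkt, ht⟩ := K.exists_hasRank hlam (τ := 1) hx hξ h (by linarith) hL0
  refine ⟨k, hk, ?_⟩
  rw [hkt]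
  exact mul_le_mul_of_nonneg_right (pow_le_pow_left₀ ht0 (rank_ratio_le ht) 2) K.Q_pos.le

include hlam in
lemma lowRank_of_minimizer {x : E} (hmin : ∀ w, P.phi lam x ≤ P.phi lam w) : K.LowRank x := by
  obtain ⟨ξ, hξ, h⟩ := P.phi_subgradient (K.lam_pos hlam) hmin
  refine K.lowRank_of_step hlam (x := x) (L := 0) (fun w => ?_) hξ (by simpa using h) ?_ le_rfl
  · have := mul_pos (mul_pos K.δ_pos (K.lam_pos hlam)) (K.errBound_pos hlam)
    linarith [hmin w]
  · have := K.Q_pos; simp; positivity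

/-- The norm ratio of the difference of two vectors of bounded rank. -/
lemma apply_sub_sq_le {x y : E} {k : ℕ} {t : ℝ} (hx : K.LowRank x) (hy : HasRank P.reg y k)
    (ht0 : 0 ≤ t) (hk : (k : ℝ) ≤ t ^ 2 * K.Q) :
    P.reg (y - x) ^ 2 ≤ 5 / 4 * (3.3 + t) ^ 2 * K.Q * ‖y - x‖ ^ 2 := by
  obtain ⟨j, hj, hjQ⟩ := hx
  have hQ := K.Q_pos
  have h := H.two_mul_apply_sub_le hy hj
  have aux : ∀ {n : ℕ} {u : ℝ}, 0 ≤ u → (n : ℝ) ≤ u ^ 2 * K.Q → √(5 * n) ≤ u * √(5 * K.Q) := by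
    intro n u hu hn
    rw [Real.sqrt_le_iff]
    refine ⟨by positivity, ?_⟩
    rw [mul_pow, Real.sq_sqrt (by positivity)]
    linarith
  have h1 : 2 * P.reg (y - x) ≤ ((3.3 + t) * √(5 * K.Q)) * ‖y - x‖ :=
    h.trans (mul_le_mul_of_nonneg_right
      (by linarith [aux ht0 hk, aux (by norm_num) hjQ]) (norm_nonneg _))
  have h2 := pow_le_pow_left₀ (by positivity) h1 2
  simp only [mul_pow, Real.sq_sqrt (by positivity : 0 ≤ 5 * K.Q)] at h2
  linarith

lemma apply_sub_sq_le_of_lowRank {x y : E} (hx : K.LowRank x) (hy : K.LowRank y) :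
    P.reg (y - x) ^ 2 ≤ 72 * K.Q * ‖y - x‖ ^ 2 := by
  obtain ⟨k, hk, hkQ⟩ := hy
  refine (K.apply_sub_sq_le hx hk (by norm_num) hkQ).trans
    (mul_le_mul_of_nonneg_right ?_ (sq_nonneg _))
  exact mul_le_mul_of_nonneg_right (by norm_num) K.Q_pos.le

include hlam in
/-- Near a point of low rank the line search accepts every parameter between `ρ₊` and
`γ_inc ρ₊`. -/
lemma lineSearchOK {x : E} {L : ℝ} (hr : K.LowRank x) (hx : K.NearOptimal lam x)
    (hL1 : K.ρp ≤ L) (hL2 : L ≤ K.maxStep) : P.LineSearchOK lam L x := by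
  have hl := K.lam_pos hlam
  have hL : 0 < L := K.ρp_pos.trans_le hL1
  have hQ := K.Q_pos
  rw [P.lineSearchOK_iff]
  by_contra! hcon
  obtain ⟨ξ, hξ, h⟩ := P.prox_subgradient hl hL x
  set y := P.prox lam L x
  set d := y - x with hd
  have hd0 : 0 < ‖d‖ := by
    refine norm_pos_iff.2 fun h0 => ?_
    rw [h0, map_zero] at hcon
    simp at hcon
  set q := L * ‖d‖ ^ 2 with hq
  have hq0 : 0 < q := by positivity
  set τ := ‖P.A d‖ ^ 2 / q with hτ
  have hAd : ‖P.A d‖ ^ 2 = τ * q := by rw [hτ]; field_simp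
  have hτ1 : 1 < τ := by rw [hτ, one_lt_div hq0]; exact hcon
  have hτ0 : 0 < τ := one_pos.trans hτ1
  -- the step of length `1 / τ` from `x` towards `y` decreases the objective by `q / (2 τ)`
  have hdec := P.prox_linear_decrease hl.le hξ h
  rw [← hd, ← hq] at hdec
  have hgap : q ≤ 2 * τ * (K.δ * lam * K.errBound lam) := by
    have h1 := hx (x + τ⁻¹ • d)
    have h2 := P.reg_segment_le x d (inv_nonneg.2 hτ0.le) (inv_le_one_of_one_le₀ hτ1.le)
    rw [hd, add_sub_cancel, ← hd] at h2
    have h3 := mul_le_mul_of_nonneg_left h2 hl.le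
    rw [Problem.phi, Problem.phi, P.f_expand x (x + τ⁻¹ • d), add_sub_cancel_left, map_smul,
      norm_smul, mul_pow, real_inner_smul_right, Real.norm_eq_abs, sq_abs, hAd] at h1
    have h4 := mul_le_mul_of_nonneg_left hdec (inv_nonneg.2 hτ0.le)
    have h5 : 1 / 2 * (τ⁻¹ ^ 2 * (τ * q)) = τ⁻¹ * q / 2 := by field_simp
    have h6 : τ⁻¹ * q ≤ 2 * (K.δ * lam * K.errBound lam) := by linarith
    have h7 := mul_le_mul_of_nonneg_left h6 hτ0.le
    rw [← mul_assoc, mul_inv_cancel₀ hτ0.ne', one_mul] at h7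
    linarith
  have hstep : 2 * (L * ‖d‖) ^ 2 ≤ τ * K.Q * lam ^ 2 := by
    have h1 := mul_le_mul_of_nonneg_left hgap hL.le
    have h2 := mul_le_mul_of_nonneg_left (K.step_errBound_le hlam hL2) hτ0.le
    have h3 : (L * ‖d‖) ^ 2 = L * q := by rw [hq]; ring
    rw [h3]
    linarith
  obtain ⟨k, hk, t, ht0, hkt, ht⟩ := K.exists_hasRank hlam hx hξ h hstep hL.le
  have hpd := K.apply_sub_sq_le hr hk ht0 hkt.le
  rw [← hd] at hpd
  have hτ2 : τ ≤ 1 + 5 / 4 * (3.3 + t) ^ 2 / 71 := by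
    rw [hτ, div_le_iff₀ hq0]
    refine (K.norm_map_sq_le d).trans ?_
    have h1 : P.reg d ^ 2 / (71 * K.Q) ≤ 5 / 4 * (3.3 + t) ^ 2 / 71 * ‖d‖ ^ 2 := by
      rw [div_le_iff₀ (by positivity)]
      linarith
    calc K.ρp * (‖d‖ ^ 2 + P.reg d ^ 2 / (71 * K.Q))
        ≤ K.ρp * (‖d‖ ^ 2 + 5 / 4 * (3.3 + t) ^ 2 / 71 * ‖d‖ ^ 2) :=
          mul_le_mul_of_nonneg_left (by linarith) K.ρp_pos.le
      _ = K.ρp * ((1 + 5 / 4 * (3.3 + t) ^ 2 / 71) * ‖d‖ ^ 2) := by ring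
      _ ≤ L * ((1 + 5 / 4 * (3.3 + t) ^ 2 / 71) * ‖d‖ ^ 2) :=
          mul_le_mul_of_nonneg_right hL1 (by positivity)
      _ = _ := by rw [hq]; ring
  have ht3 := rank_ratio_le_of_le ht hτ2
  -- so `d` satisfies the restricted bound, which contradicts the rejection
  have h1 : 5 / 4 * (3.3 + t) ^ 2 ≤ 72 := by nlinarith
  have h2 : P.reg d ^ 2 ≤ 72 * K.Q * ‖d‖ ^ 2 :=
    hpd.trans (mul_le_mul_of_nonneg_right (mul_le_mul_of_nonneg_right h1 hQ.le) (sq_nonneg _))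
  have h3 := (K.upper d h2).trans (mul_le_mul_of_nonneg_right hL1 (sq_nonneg ‖d‖))
  linarith

/-! ### One proximal step -/

variable {x : E} {L : ℝ} (hr : K.LowRank x) (hx : K.NearOptimal lam x) (hL0 : 0 < L)
  (hL : L ≤ K.maxStep) (hOK : P.LineSearchOK lam L x)

omit [Nontrivial E] in
include hlam hx hL0 hOK in
lemma nearOptimal_prox : K.NearOptimal lam (P.prox lam L x) := fun w => by
  have h := P.phi_prox_le (K.lam_pos hlam) hL0 hOK
  have : 0 ≤ L / 2 * ‖P.prox lam L x - x‖ ^ 2 := by positivity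
  linarith [hx w]

include hlam hx hL0 hOK hL in
lemma lowRank_prox : K.LowRank (P.prox lam L x) := by
  obtain ⟨ξ, hξ, h⟩ := P.prox_subgradient (K.lam_pos hlam) hL0 x
  refine K.lowRank_of_step hlam hx hξ h ?_ hL0.le
  have h1 := P.phi_prox_le (K.lam_pos hlam) hL0 hOK
  have h2 := hx (P.prox lam L x)
  have h3 : L * (L / 2 * ‖P.prox lam L x - x‖ ^ 2) ≤ L * (K.δ * lam * K.errBound lam) :=
    mul_le_mul_of_nonneg_left (by linarith) hL0.le
  have h4 := K.step_errBound_le hlam hL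
  linarith [(by ring : (L * ‖P.prox lam L x - x‖) ^ 2 = L * (L * ‖P.prox lam L x - x‖ ^ 2))]

lemma ρm_le_ρp : K.ρm ≤ K.ρp := by
  obtain ⟨a, ha, -⟩ := H.exists_isAtom_inner_eq (0 : E)
  have h : P.reg a ^ 2 ≤ 72 * K.Q * ‖a‖ ^ 2 := by
    rw [ha.1, ha.2]; linarith [K.two_le_Q]
  have := (K.lower a h).trans (K.upper a h)
  rw [ha.2] at this
  linarith

/-- The contraction factor of a proximal step is `1 - rate`. -/
def rate : ℝ := K.ρm / (4 * K.maxStep)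

omit [Nontrivial E] in
lemma rate_pos : 0 < K.rate := div_pos K.ρm_pos (mul_pos four_pos K.maxStep_pos)

lemma rate_le : K.rate ≤ 1 / 4 := by
  rw [rate, div_le_iff₀ (mul_pos four_pos K.maxStep_pos)]
  have := K.ρm_le_ρp
  have := le_mul_of_one_le_left K.ρp_pos.le K.one_le_ginc
  rw [maxStep]
  linarith

include hlam hr hL0 hOK hL in
/-- Restricted strong convexity makes the objective gap contract. -/
lemma phi_prox_sub_le {y : E} (hy : ∀ w, P.phi lam y ≤ P.phi lam w) :
    P.phi lam (P.prox lam L x) - P.phi lam y ≤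
      (1 - K.rate) * (P.phi lam x - P.phi lam y) := by
  have hl := K.lam_pos hlam
  set θ := K.rate
  have hθ : 0 < θ := K.rate_pos
  have hθ1 : θ ≤ 1 / 4 := K.rate_le
  have h1 := hOK.trans (P.prox_spec hl.le hL0 x (x + θ • (y - x)))
  have h2 := P.reg_segment_le x (y - x) hθ.le (by linarith)
  rw [add_sub_cancel] at h2
  have h3 := mul_le_mul_of_nonneg_left h2 hl.le
  rw [Problem.model, add_sub_cancel_left, norm_smul, mul_pow, real_inner_smul_right,
    Real.norm_eq_abs, sq_abs] at h1
  have h4 := P.f_expand x y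
  have h5 := K.lower _ (K.apply_sub_sq_le_of_lowRank hr (K.lowRank_of_minimizer hlam hy))
  have h6 : L * θ ≤ K.ρm := by
    have e : K.maxStep * θ = K.ρm / 4 := by
      have := K.maxStep_pos
      simp only [θ, rate]; field_simp
    have := mul_le_mul_of_nonneg_right hL hθ.le
    linarith [K.ρm_pos]
  have h7 := mul_le_mul_of_nonneg_right h6 (mul_nonneg hθ.le (sq_nonneg ‖y - x‖))
  have h8 := mul_le_mul_of_nonneg_left h5 hθ.le
  have h9 : θ * P.f y = θ * P.f x + θ * inner ℝ (P.grad x) (y - x) +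
      θ * (1 / 2 * ‖P.A (y - x)‖ ^ 2) := by rw [h4]; ring
  have e1 : P.phi lam x = P.f x + lam * P.reg x := rfl
  have e2 : P.phi lam y = P.f y + lam * P.reg y := rfl
  rw [e1, e2] at *
  linarith

include H in
lemma dualNorm_adj_map_le (d : E) :
    dualNorm P.reg (P.adj (P.A d)) ≤ ‖P.A d‖ * √K.ρ1 := by
  obtain ⟨a, ha, h⟩ := H.exists_isAtom_inner_eq (P.adj (P.A d))
  rw [← h, Problem.adj, LinearMap.adjoint_inner_left]
  refine (real_inner_le_norm _ _).trans (mul_le_mul_of_nonneg_left ?_ (norm_nonneg _))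
  refine Real.le_sqrt_of_sq_le ?_
  have := K.atom_upper a (by rw [ha.1, ha.2])
  rwa [ha.2, one_pow, mul_one] at this

/-- The factor between the objective gap and the square of the residual. -/
def resFactor : ℝ := 2 * K.maxStep * (1 + √(K.ρ1 * K.ρp) / K.ρm) ^ 2

include hlam hr hx hL0 hOK hL in
/-- The residual after a proximal step is controlled by the objective gap before it. -/
lemma residual_sq_le :
    dualNorm P.reg (L • (x - P.prox lam L x) + P.grad (P.prox lam L x) - P.grad x) ^ 2 ≤
      K.resFactor * (P.phi lam x - P.phi lam (P.prox lam L x)) := by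
  have hl := K.lam_pos hlam
  set y := P.prox lam L x with hy
  set d := y - x with hd
  have hM := K.maxStep_pos
  have hgap : L / 2 * ‖d‖ ^ 2 ≤ P.phi lam x - P.phi lam y := by
    linarith [P.phi_prox_le hl hL0 hOK]
  have hpd := K.apply_sub_sq_le_of_lowRank hr (K.lowRank_prox hlam hx hL0 hL hOK)
  rw [← hy, ← hd] at hpd
  have hgrad : P.grad y - P.grad x = P.adj (P.A d) := by
    simp only [Problem.grad, hd, map_sub]
    abel
  set s := √(K.ρ1 * K.ρp) with hs
  have hs0 : 0 ≤ s := Real.sqrt_nonneg _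
  have hAd : ‖P.A d‖ * √K.ρ1 ≤ s * ‖d‖ := by
    have : ‖P.A d‖ ≤ √K.ρp * ‖d‖ := by
      refine abs_le_of_sq_le_sq' ?_ (by positivity) |>.2
      rw [mul_pow, Real.sq_sqrt K.ρp_pos.le]
      exact K.upper d hpd
    rw [hs, Real.sqrt_mul K.ρ1_nonneg]
    calc _ ≤ √K.ρp * ‖d‖ * √K.ρ1 := mul_le_mul_of_nonneg_right this (Real.sqrt_nonneg _)
      _ = _ := by ring
  have hres : dualNorm P.reg (L • (x - y) + P.grad y - P.grad x) ≤ (L + s) * ‖d‖ := by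
    rw [add_sub_assoc, hgrad]
    refine (H.dualNorm_add_le _ _).trans ?_
    have h1 := H.dualNorm_le_norm (L • (x - y))
    rw [norm_smul, Real.norm_eq_abs, abs_of_pos hL0, norm_sub_rev, ← hd] at h1
    have h2 := K.dualNorm_adj_map_le d
    linarith
  have hsq := pow_le_pow_left₀ (H.dualNorm_nonneg _) hres 2
  refine hsq.trans ?_
  have hρm := K.ρm_pos
  -- only for `d ≠ 0` is `L` bounded from below by the restricted strong convexity
  rcases (norm_nonneg d).eq_or_lt with h0 | hdpos
  · rw [← h0] at hgap ⊢
    have : 0 ≤ K.resFactor := by rw [resFactor]; positivity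
    rw [mul_zero, zero_pow two_ne_zero]
    exact mul_nonneg this (by linarith)
  have hLm : K.ρm ≤ L := by
    have := (K.lower d hpd).trans (P.lineSearchOK_iff.1 hOK)
    exact le_of_mul_le_mul_right this (by positivity)
  have h1 : (L + s) ≤ L * (1 + s / K.ρm) := by
    have : s ≤ L * (s / K.ρm) := by
      rw [mul_div_assoc', le_div_iff₀ hρm]
      linarith [mul_le_mul_of_nonneg_right hLm hs0]
    linarith
  calc ((L + s) * ‖d‖) ^ 2 ≤ (L * (1 + s / K.ρm) * ‖d‖) ^ 2 :=
        pow_le_pow_left₀ (by positivity) (mul_le_mul_of_nonneg_right h1 (norm_nonneg _)) 2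
    _ = 2 * L * (1 + s / K.ρm) ^ 2 * (L / 2 * ‖d‖ ^ 2) := by ring
    _ ≤ 2 * K.maxStep * (1 + s / K.ρm) ^ 2 * (L / 2 * ‖d‖ ^ 2) := by gcongr
    _ ≤ _ := mul_le_mul_of_nonneg_left hgap (by positivity)

end RecoverySetting

/-! ### Complexity of one call of the proximal gradient method -/

/-- A geometric decay with ratio at least `3 / 4` reaches the tolerance in the stated number of
steps; the factor `3` in the logarithm pays for rounding up and for the last step. -/
lemma exists_pow_mul_le {D ε q : ℝ} (hD : 0 < D) (hε : 0 < ε) (hq : 0 < q) (hq1 : q ≤ 1 / 4) :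
    ∃ t : ℕ, D * (1 - q) ^ t ≤ ε ∧
      (t : ℝ) + 1 ≤ max 1 (Real.log (3 * D / ε) / Real.log ((1 - q)⁻¹)) := by
  set Θ := Real.log ((1 - q)⁻¹) with hΘ
  have h1q : 0 < 1 - q := by linarith
  have hΘ0 : 0 < Θ := Real.log_pos ((one_lt_inv₀ h1q).2 (by linarith))
  have hΘ1 : 2 * Θ ≤ Real.log 3 := by
    have h1 : (1 - q)⁻¹ ≤ 4 / 3 := by
      rw [inv_le_comm₀ h1q (by norm_num)]; linarith
    have h2 : 2 * Θ = Real.log ((1 - q)⁻¹ ^ 2) := by rw [Real.log_pow]; push_cast; rfl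
    rw [h2]
    refine Real.log_le_log (by positivity) ?_
    calc (1 - q)⁻¹ ^ 2 ≤ (4 / 3) ^ 2 := pow_le_pow_left₀ (by positivity) h1 2
      _ ≤ 3 := by norm_num
  have h3 : Real.log (3 * D / ε) = Real.log 3 + Real.log (D / ε) := by
    rw [mul_div_assoc, Real.log_mul (by norm_num) (by positivity)]
  refine ⟨⌈Real.log (D / ε) / Θ⌉₊, ?_, ?_⟩
  · have h4 := Nat.le_ceil (Real.log (D / ε) / Θ)
    set t := ⌈Real.log (D / ε) / Θ⌉₊
    rw [div_le_iff₀ hΘ0] at h4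
    have h5 : (t : ℝ) * Θ = Real.log ((1 - q)⁻¹ ^ t) := by rw [Real.log_pow]
    rw [h5] at h4
    have h6 := (Real.log_le_log_iff (by positivity) (by positivity)).1 h4
    rw [inv_pow, div_le_iff₀ hε, inv_mul_eq_div, le_div_iff₀ (by positivity)] at h6
    exact h6
  · rcases le_or_gt (Real.log (D / ε) / Θ) 0 with h | h
    · rw [Nat.ceil_eq_zero.2 h]
      simp
    · refine le_max_of_le_right ?_
      have h4 := Nat.ceil_lt_add_one h.le
      have h5 : 2 ≤ Real.log 3 / Θ := by rw [le_div_iff₀ hΘ0]; exact hΘ1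
      rw [h3, add_div]
      linarith

section

variable {E : Type*} [NormedAddCommGroup E] [InnerProductSpace ℝ E] [FiniteDimensional ℝ E]
  {m : ℕ} (P : Problem E m) (S : Params)

lemma backtrackM_pos (lam : ℝ) (x : E) {L : ℝ} (hL : 0 < L) : 0 < backtrackM P S lam x L :=
  mul_pos (pow_pos (one_pos.trans S.one_lt_gammaInc) _) hL

lemma lineSearchOK_backtrackM (lam : ℝ) (x : E) {L : ℝ} (hL : 0 < L) :
    P.LineSearchOK lam (backtrackM P S lam x L) x :=
  Nat.sInf_mem (P.exists_lineSearchOK S lam hL x)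

lemma backtrackM_le_of_lineSearchOK {lam : ℝ} {x : E} {L : ℝ} (hL : 0 < L) {i : ℕ}
    (h : P.LineSearchOK lam (S.gammaInc ^ i * L) x) :
    backtrackM P S lam x L ≤ S.gammaInc ^ i * L :=
  mul_le_mul_of_nonneg_right
    (pow_le_pow_right₀ S.one_lt_gammaInc.le (Nat.sInf_le h)) hL.le

lemma lamSeq_succ (t : ℕ) :
    lamSeq P S (t + 1) = S.eta * lamSeq P S t := by
  rw [lamSeq, lamSeq, pow_succ]; ring

variable {P S}

/-- The residual of the stopping test bounds the subgradients at the output. -/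
lemma exists_residual_le {lam : ℝ} (hlam : 0 < lam) {x₀ : E} {L₀ tol : ℝ}
    (hterm : ProxGradTerminates P S lam x₀ L₀ tol)
    (hL : ∀ t, 0 < (proxGradSeq P S lam x₀ L₀ t).2.2) :
    ∃ ξ ∈ subdiff P.reg (proxGrad P S lam x₀ L₀ tol).1,
      dualNorm P.reg (P.grad (proxGrad P S lam x₀ L₀ tol).1 + lam • ξ) ≤ tol := by
  have h : StopsAfter P S lam x₀ L₀ tol (sInf {t : ℕ | StopsAfter P S lam x₀ L₀ tol t}) :=
    Nat.sInf_mem hterm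
  set s := sInf {t : ℕ | StopsAfter P S lam x₀ L₀ tol t}
  set w := proxGradSeq P S lam x₀ L₀ s with hw
  obtain ⟨ξ, hξ, e⟩ := P.prox_subgradient hlam (backtrackM_pos P S lam w.1 (hL s)) w.1
  refine ⟨ξ, hξ, ?_⟩
  have e2 : P.grad (P.prox lam (backtrackM P S lam w.1 w.2.2) w.1) + lam • ξ =
      backtrackM P S lam w.1 w.2.2 • (w.1 - P.prox lam (backtrackM P S lam w.1 w.2.2) w.1) +
        P.grad (P.prox lam (backtrackM P S lam w.1 w.2.2) w.1) - P.grad w.1 := by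
    rw [e, smul_sub, smul_sub]; abel
  change dualNorm P.reg (P.grad (P.prox lam (backtrackM P S lam w.1 w.2.2) w.1) + lam • ξ) ≤ tol
  rw [e2]
  exact h

end

namespace RecoverySetting

variable {E : Type*} [NormedAddCommGroup E] [InnerProductSpace ℝ E] [FiniteDimensional ℝ E]
  {m : ℕ} {P : Problem E m} {H : IsAtomicDecomposable P.reg} (K : RecoverySetting P H)
  [Nontrivial E] {S : Params} (hS : S.gammaInc = K.ginc) (hmin : S.Lmin ≤ K.maxStep)
  {lam : ℝ} (hlam : K.lamT ≤ lam)

include hS hlam in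
lemma backtrackM_le {x : E} {L : ℝ} (hr : K.LowRank x) (hx : K.NearOptimal lam x)
    (hL0 : 0 < L) (hL : L ≤ K.maxStep) : backtrackM P S lam x L ≤ K.maxStep := by
  have hex : ∃ i : ℕ, K.ρp ≤ S.gammaInc ^ i * L := by
    obtain ⟨i, hi⟩ := pow_unbounded_of_one_lt (K.ρp / L) S.one_lt_gammaInc
    exact ⟨i, ((div_lt_iff₀ hL0).1 hi).le⟩
  classical
  set i := Nat.find hex with hi
  have h1 : K.ρp ≤ S.gammaInc ^ i * L := Nat.find_spec hex
  have h2 : S.gammaInc ^ i * L ≤ K.maxStep := by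
    rcases Nat.eq_zero_or_eq_succ_pred i with h0 | h0
    · rw [h0, pow_zero, one_mul]; exact hL
    · have h3 : ¬ K.ρp ≤ S.gammaInc ^ (i.pred) * L := Nat.find_min hex (by omega)
      rw [h0, Nat.succ_eq_add_one, pow_succ, maxStep, ← hS]
      push Not at h3
      calc S.gammaInc ^ i.pred * S.gammaInc * L = S.gammaInc * (S.gammaInc ^ i.pred * L) := by ring
        _ ≤ _ := mul_le_mul_of_nonneg_left h3.le (one_pos.trans S.one_lt_gammaInc).le
  exact (backtrackM_le_of_lineSearchOK P S hL0 (K.lineSearchOK hlam hr hx h1 h2)).trans h2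

/-- The properties of the current point and step parameter that the algorithm preserves. -/
structure Good (lam : ℝ) (x : E) (L : ℝ) : Prop where
  lowRank : K.LowRank x
  nearOptimal : K.NearOptimal lam x
  pos : 0 < L
  le : L ≤ K.maxStep

variable {x : E} {L : ℝ} (hg : K.Good lam x L)

include hS hmin hlam hg in
lemma good_proxGradSeq (t : ℕ) :
    K.Good lam (proxGradSeq P S lam x L t).1 (proxGradSeq P S lam x L t).2.2 := by
  induction t with
  | zero => exact hg
  | succ t ih =>
    set w := proxGradSeq P S lam x L t with hw
    have h0 := backtrackM_pos P S lam w.1 ih.pos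
    have h1 := K.backtrackM_le hS hlam ih.lowRank ih.nearOptimal ih.pos ih.le
    have h2 := lineSearchOK_backtrackM P S lam w.1 ih.pos
    exact ⟨K.lowRank_prox hlam ih.nearOptimal h0 h1 h2, K.nearOptimal_prox hlam ih.nearOptimal h0 h2,
      lt_max_of_lt_left S.Lmin_pos,
      max_le hmin ((div_le_self h0.le S.one_le_gammaDec).trans h1)⟩

include hS hmin hlam hg in
lemma phi_proxGradSeq_sub_le {y : E} (hy : ∀ w, P.phi lam y ≤ P.phi lam w) (t : ℕ) :
    P.phi lam (proxGradSeq P S lam x L t).1 - P.phi lam y ≤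
      K.δ * lam * K.errBound lam * (1 - K.rate) ^ t := by
  induction t with
  | zero =>
    have := hg.nearOptimal y
    simp only [proxGradSeq, pow_zero, mul_one]
    linarith
  | succ t ih =>
    have hgt := K.good_proxGradSeq hS hmin hlam hg t
    set w := proxGradSeq P S lam x L t with hw
    have h0 := backtrackM_pos P S lam w.1 hgt.pos
    have h1 := K.backtrackM_le hS hlam hgt.lowRank hgt.nearOptimal hgt.pos hgt.le
    have h2 := lineSearchOK_backtrackM P S lam w.1 hgt.pos
    have h3 := K.phi_prox_sub_le hlam hgt.lowRank h0 h1 h2 hy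
    have h4 := mul_le_mul_of_nonneg_left ih (by linarith [K.rate_le] : 0 ≤ 1 - K.rate)
    refine (h3.trans h4).trans (le_of_eq ?_)
    rw [pow_succ]; ring

/-- The scale of the squared residual at the start of a call. -/
def resConst (lam : ℝ) : ℝ := K.resFactor * (K.δ * lam * K.errBound lam)

omit [Nontrivial E] in
lemma resFactor_pos : 0 < K.resFactor := by
  have := K.maxStep_pos
  have := K.ρm_pos
  rw [resFactor]; positivity

omit [Nontrivial E] in
include hlam in
lemma resConst_pos : 0 < K.resConst lam :=
  mul_pos K.resFactor_pos (mul_pos (mul_pos K.δ_pos (K.lam_pos hlam)) (K.errBound_pos hlam))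

include hS hmin hlam hg in
lemma stopsAfter_of_le {tol : ℝ} (htol : 0 < tol) {t : ℕ}
    (ht : K.resConst lam * (1 - K.rate) ^ t ≤ tol ^ 2) : StopsAfter P S lam x L tol t := by
  obtain ⟨y, hy⟩ := P.exists_minimizer H (K.lam_pos hlam)
  have hgt := K.good_proxGradSeq hS hmin hlam hg t
  have hgap := K.phi_proxGradSeq_sub_le hS hmin hlam hg hy t
  rw [StopsAfter]
  set w := proxGradSeq P S lam x L t with hw
  have h0 := backtrackM_pos P S lam w.1 hgt.pos
  have h1 := K.backtrackM_le hS hlam hgt.lowRank hgt.nearOptimal hgt.pos hgt.le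
  have h2 := lineSearchOK_backtrackM P S lam w.1 hgt.pos
  have h3 := K.residual_sq_le hlam hgt.lowRank hgt.nearOptimal h0 h1 h2
  refine abs_le_of_sq_le_sq' (h3.trans ?_) htol.le |>.2
  refine le_trans (mul_le_mul_of_nonneg_left ?_ K.resFactor_pos.le) ((mul_assoc _ _ _).symm.trans_le ht)
  linarith [hy (P.prox lam (backtrackM P S lam w.1 w.2.2) w.1)]

include hS hmin hlam hg in
/-- The proximal gradient method terminates within a logarithmic number of iterations. -/
lemma proxGrad_terminates {tol : ℝ} (htol : 0 < tol) :
    ProxGradTerminates P S lam x L tol ∧ (proxGradIters P S lam x L tol : ℝ) ≤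
      max 1 (Real.log (3 * K.resConst lam / tol ^ 2) / Real.log ((1 - K.rate)⁻¹)) := by
  obtain ⟨t, ht, hle⟩ := exists_pow_mul_le (K.resConst_pos hlam) (pow_pos htol 2) K.rate_pos
    K.rate_le
  have hterm := K.stopsAfter_of_le hS hmin hlam hg htol ht
  refine ⟨⟨t, hterm⟩, le_trans ?_ hle⟩
  rw [proxGradIters]
  push_cast
  have : sInf {t : ℕ | StopsAfter P S lam x L tol t} ≤ t := Nat.sInf_le hterm
  gcongr

include hS hmin hlam hg in
lemma good_proxGrad (tol : ℝ) :
    K.Good lam (proxGrad P S lam x L tol).1 (proxGrad P S lam x L tol).2 := by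
  set s := sInf {t : ℕ | StopsAfter P S lam x L tol t} with hs
  have h := K.good_proxGradSeq hS hmin hlam hg s
  have h' := K.good_proxGradSeq hS hmin hlam hg (s + 1)
  exact ⟨h'.lowRank, h'.nearOptimal, backtrackM_pos P S lam _ h.pos,
    K.backtrackM_le hS hlam h.lowRank h.nearOptimal h.pos h.le⟩

include hS hmin hlam hg in
lemma residual_proxGrad_le {tol : ℝ} (htol : 0 < tol) :
    ∃ ξ ∈ subdiff P.reg (proxGrad P S lam x L tol).1,
      dualNorm P.reg (P.grad (proxGrad P S lam x L tol).1 + lam • ξ) ≤ tol :=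
  exists_residual_le (K.lam_pos hlam) (K.proxGrad_terminates hS hmin hlam hg htol).1
    fun t => (K.good_proxGradSeq hS hmin hlam hg t).pos

/-! ### The homotopy -/

include hlam in
/-- A point solved to accuracy `δ'` for one parameter is a warm start for the next one. -/
lemma nearOptimal_of_residual_prev {lam' : ℝ} (h1 : lam ≤ lam') (h2 : S.eta * lam' ≤ lam)
    (heta : 1 + S.deltaP ≤ S.eta * (1 + K.δ)) {ξ : E} (hξ : ξ ∈ subdiff P.reg x)
    (hres : dualNorm P.reg (P.grad x + lam' • ξ) ≤ S.deltaP * lam') : K.NearOptimal lam x := by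
  refine K.nearOptimal_of_residual_le hlam hξ ?_
  have e : P.grad x + lam • ξ = (P.grad x + lam' • ξ) + (lam - lam') • ξ := by
    rw [sub_smul]; abel
  rw [e]
  refine (H.dualNorm_add_le _ _).trans ?_
  have h3 := H.dualNorm_smul_le (lam - lam') ξ
  have h4 : dualNorm P.reg ξ ≤ 1 := H.mem_dualBall_iff.1 (mem_subdiff_iff.1 hξ).1
  rw [abs_of_nonpos (by linarith)] at h3
  have h5 := mul_le_mul_of_nonneg_left h4 (by linarith : 0 ≤ -(lam - lam'))
  have h6 := mul_le_mul_of_nonneg_right heta ((K.lam_pos hlam).le.trans h1)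
  have h7 := mul_le_mul_of_nonneg_right h2 (by linarith [K.δ_pos] : 0 ≤ 1 + K.δ)
  linarith

variable (h0 : K.lamT ≤ lam0 P) (heta : 1 + S.deltaP ≤ S.eta * (1 + K.δ))

omit [Nontrivial E] in
include h0 in
lemma lamT_le_lamSeq {t : ℕ} (ht : t ≤ numStages P S K.lamT) : K.lamT ≤ lamSeq P S t := by
  have hl0 : 0 < lam0 P := K.lamT_pos.trans_le h0
  have hlog : Real.log S.eta < 0 := Real.log_neg S.eta_pos S.eta_lt_one
  have hnum : Real.log (K.lamT / lam0 P) ≤ 0 :=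
    Real.log_nonpos (div_nonneg K.lamT_pos.le hl0.le) ((div_le_one hl0).2 h0)
  have h1 : (t : ℝ) ≤ Real.log (K.lamT / lam0 P) / Real.log S.eta :=
    (Nat.le_floor_iff (div_nonneg_of_nonpos hnum hlog.le)).1 ht
  rw [le_div_iff_of_neg hlog, ← Real.log_pow] at h1
  have h2 := (Real.log_le_log_iff (div_pos K.lamT_pos hl0) (pow_pos S.eta_pos _)).1 h1
  rwa [div_le_iff₀ hl0, mul_comm] at h2

omit [Nontrivial E] in
include h0 in
lemma eta_mul_lamSeq_le : S.eta * lamSeq P S (numStages P S K.lamT) ≤ K.lamT := by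
  have hl0 : 0 < lam0 P := K.lamT_pos.trans_le h0
  have hlog : Real.log S.eta < 0 := Real.log_neg S.eta_pos S.eta_lt_one
  have h1 := Nat.lt_floor_add_one (Real.log (K.lamT / lam0 P) / Real.log S.eta)
  change _ < (numStages P S K.lamT : ℝ) + 1 at h1
  rw [div_lt_iff_of_neg hlog] at h1
  have h2 : ((numStages P S K.lamT : ℝ) + 1) * Real.log S.eta =
      Real.log (S.eta ^ (numStages P S K.lamT + 1)) := by rw [Real.log_pow]; push_cast; rfl
  rw [h2] at h1
  have h3 := (Real.log_lt_log_iff (pow_pos S.eta_pos _) (div_pos K.lamT_pos hl0)).1 h1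
  rw [lt_div_iff₀ hl0, pow_succ] at h3
  rw [lamSeq]
  linarith

/-- The state of the algorithm after `t` stages: the current point has low rank and is solved to
relative accuracy `δ'`, and the step parameter is bounded. -/
structure Solved (S : Params) (lam : ℝ) (x : E) (L : ℝ) : Prop where
  lowRank : K.LowRank x
  pos : 0 < L
  le : L ≤ K.maxStep
  residual : ∃ ξ ∈ subdiff P.reg x, dualNorm P.reg (P.grad x + lam • ξ) ≤ S.deltaP * lam

include heta in
lemma Solved.good {lam' : ℝ} (hs : K.Solved S lam' x L) (hlam : K.lamT ≤ lam) (h1 : lam ≤ lam')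
    (h2 : S.eta * lam' ≤ lam) : K.Good lam x L := by
  obtain ⟨ξ, hξ, hres⟩ := hs.residual
  exact ⟨hs.lowRank, K.nearOptimal_of_residual_prev hlam h1 h2 heta hξ hres, hs.pos, hs.le⟩

include h0 heta hS hmin in
lemma solved_homotopySeq {t : ℕ} (ht : t ≤ numStages P S K.lamT) :
    K.Solved S (lamSeq P S t) (homotopySeq P S t).1 (homotopySeq P S t).2 := by
  induction t with
  | zero =>
    have hl0 : 0 < lam0 P := K.lamT_pos.trans_le h0
    -- at the start `ξ = A* b / λ₀` solves the optimality condition exactly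
    refine ⟨K.lowRank_zero, S.Lmin_pos, hmin, (lam0 P)⁻¹ • P.adj P.b,
      mem_subdiff_iff.2 ⟨H.inv_dualNorm_smul_mem hl0, by simp [homotopySeq]⟩, ?_⟩
    have e : P.grad (homotopySeq P S 0).1 + lamSeq P S 0 • (lam0 P)⁻¹ • P.adj P.b = 0 := by
      rw [smul_smul, lamSeq, pow_zero, mul_one, mul_inv_cancel₀ hl0.ne']
      simp [homotopySeq, Problem.grad]
    rw [e]
    have : dualNorm P.reg (0 : E) ≤ 0 := IsAtomicDecomposable.dualNorm_le (by simp)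
    refine this.trans (mul_nonneg S.deltaP_pos.le ?_)
    rw [lamSeq, pow_zero, mul_one]; exact hl0.le
  | succ t ih =>
    have hlam' := K.lamT_le_lamSeq (S := S) h0 (t := t) (by omega)
    have hlam1 := K.lamT_le_lamSeq h0 ht
    have hpos := K.lam_pos hlam'
    have hg := (ih (by omega)).good K heta hlam1
      (by rw [lamSeq_succ]; exact mul_le_of_le_one_left hpos.le S.eta_lt_one.le)
      (lamSeq_succ P S t).ge
    have hg' := K.good_proxGrad hS hmin hlam1 hg (S.deltaP * lamSeq P S (t + 1))
    exact ⟨hg'.lowRank, hg'.pos, hg'.le, K.residual_proxGrad_le hS hmin hlam1 hg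
      (mul_pos S.deltaP_pos (K.lam_pos hlam1))⟩

include h0 heta hS hmin in
lemma good_stage {t : ℕ} (ht : t < numStages P S K.lamT) :
    K.Good (lamSeq P S (t + 1)) (homotopySeq P S t).1 (homotopySeq P S t).2 := by
  have hpos := K.lam_pos (K.lamT_le_lamSeq (S := S) h0 ht.le)
  exact (K.solved_homotopySeq hS hmin h0 heta ht.le).good K heta (K.lamT_le_lamSeq h0 ht)
    (by rw [lamSeq_succ]; exact mul_le_of_le_one_left hpos.le S.eta_lt_one.le)
    (lamSeq_succ P S t).ge

include h0 heta hS hmin in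
lemma good_final : K.Good K.lamT (homotopySeq P S (numStages P S K.lamT)).1
    (homotopySeq P S (numStages P S K.lamT)).2 :=
  (K.solved_homotopySeq hS hmin h0 heta le_rfl).good K heta le_rfl (K.lamT_le_lamSeq h0 le_rfl)
    (K.eta_mul_lamSeq_le h0)

include h0 heta hS hmin in
/-- The accuracy of the output. -/
lemma phi_homotopyOutput_sub_le {eps : ℝ} (heps : 0 < eps) (w : E) :
    P.phi K.lamT (homotopyOutput P S K.lamT eps) - P.phi K.lamT w ≤
      eps * (3 / 2 * K.errBound K.lamT) := by
  have hg := K.good_final hS hmin h0 heta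
  obtain ⟨ξ, hξ, hres⟩ := K.residual_proxGrad_le hS hmin le_rfl hg heps
  have hg' := K.good_proxGrad hS hmin le_rfl hg eps
  refine (K.phi_sub_le_of_residual_le le_rfl hξ hres
    (K.spread_le_of_nearOptimal le_rfl hg'.nearOptimal) w).trans (le_of_eq ?_)
  ring

end RecoverySetting

/-! ### The constants of the convergence result -/

section Constants

variable {E : Type*} [NormedAddCommGroup E] [InnerProductSpace ℝ E]
  {F : Type*} [NormedAddCommGroup F] [InnerProductSpace ℝ F] {p : Seminorm ℝ E}
  {A : E →ₗ[ℝ] F} {k : ℝ}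

lemma rhoPlus_nonneg : 0 ≤ rhoPlus p A k := Real.sInf_nonneg fun _ h => h.1

/-- The supremum defining `ρ₋` is attained. -/
lemma rhoMinus_mul_le {x : E} (hx : p x ^ 2 ≤ k * ‖x‖ ^ 2) :
    rhoMinus p A k * ‖x‖ ^ 2 ≤ ‖A x‖ ^ 2 := by
  rcases eq_or_ne x 0 with rfl | h0
  · simp
  have hpos : 0 < ‖x‖ ^ 2 := pow_pos (norm_pos_iff.2 h0) 2
  rw [← le_div_iff₀ hpos]
  refine csSup_le ⟨0, le_rfl, fun y _ => by rw [zero_mul]; positivity⟩ ?_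
  rintro ρ ⟨-, hρ⟩
  rw [le_div_iff₀ hpos]
  exact hρ x hx

/-- The infimum defining `ρ₊` is attained. -/
lemma le_rhoPlus_mul [FiniteDimensional ℝ E] {x : E} (hx : p x ^ 2 ≤ k * ‖x‖ ^ 2) :
    ‖A x‖ ^ 2 ≤ rhoPlus p A k * ‖x‖ ^ 2 := by
  rcases eq_or_ne x 0 with rfl | h0
  · simp
  have hpos : 0 < ‖x‖ ^ 2 := pow_pos (norm_pos_iff.2 h0) 2
  rw [← div_le_iff₀ hpos]
  refine le_csInf ⟨‖LinearMap.toContinuousLinearMap A‖ ^ 2, sq_nonneg _, fun y _ => ?_⟩ ?_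
  · rw [← mul_pow]
    exact pow_le_pow_left₀ (norm_nonneg _) ((LinearMap.toContinuousLinearMap A).le_opNorm y) 2
  · rintro ρ ⟨-, hρ⟩
    rw [div_le_iff₀ hpos]
    exact hρ x hx

variable [FiniteDimensional ℝ E] (H : IsAtomicDecomposable p) {x₀ : E} (hx₀ : x₀ ≠ 0)

namespace IsAtomicDecomposable

include H hx₀

lemma one_le_norm_sgn : 1 ≤ ‖H.sgn x₀‖ := by
  have h1 := H.inner_sgn_self x₀
  have h2 := real_inner_le_norm (H.sgn x₀) x₀
  have h3 := mul_le_mul_of_nonneg_left (H.norm_le x₀) (norm_nonneg (H.sgn x₀))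
  have h4 : 0 < p x₀ := (norm_pos_iff.2 hx₀).trans_le (H.norm_le x₀)
  refine le_of_mul_le_mul_right ?_ h4
  linarith

lemma one_le_card : 1 ≤ card H.dec x₀ := one_le_pow₀ (H.one_le_norm_sgn hx₀)

lemma bddAbove_constC :
    BddAbove {s : ℝ | ∃ x ∈ tangent H.dec x₀, x ≠ 0 ∧ s = p x ^ 2 / (card H.dec x₀ * ‖x‖ ^ 2)} := by
  obtain ⟨C, hC, hle⟩ := Seminorm.bound_of_continuous_normedSpace p (continuous_seminorm p)
  refine ⟨C ^ 2, ?_⟩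
  rintro s ⟨x, -, hx, rfl⟩
  have hpos : 0 < ‖x‖ ^ 2 := pow_pos (norm_pos_iff.2 hx) 2
  have hk := H.one_le_card hx₀
  rw [div_le_iff₀ (mul_pos (by linarith) hpos)]
  calc p x ^ 2 ≤ (C * ‖x‖) ^ 2 := pow_le_pow_left₀ (apply_nonneg _ _) (hle x) 2
    _ = 1 * (C ^ 2 * ‖x‖ ^ 2) := by ring
    _ ≤ card H.dec x₀ * (C ^ 2 * ‖x‖ ^ 2) := mul_le_mul_of_nonneg_right hk (by positivity)
    _ = _ := by ring

lemma apply_sq_le_of_mem_tangent {t : E} (ht : t ∈ tangent H.dec x₀) :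
    p t ^ 2 ≤ constC H.dec x₀ * card H.dec x₀ * ‖t‖ ^ 2 := by
  rcases eq_or_ne t 0 with rfl | h0
  · simp
  have hpos : 0 < ‖t‖ ^ 2 := pow_pos (norm_pos_iff.2 h0) 2
  have hk := H.one_le_card hx₀
  have h := le_csSup (H.bddAbove_constC hx₀) ⟨t, ht, h0, rfl⟩
  rw [div_le_iff₀ (mul_pos (by linarith) hpos), ← mul_assoc] at h
  exact h

/-- The vector `e_{x₀}` is a competitor in the definition of `c` with ratio at least one. -/
lemma one_le_constC : 1 ≤ constC H.dec x₀ := by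
  have hk := H.one_le_card hx₀
  have hn := H.one_le_norm_sgn hx₀
  have h0 : H.sgn x₀ ≠ 0 := norm_pos_iff.1 (by linarith)
  refine le_trans ?_ (le_csSup (H.bddAbove_constC hx₀) ⟨_, H.sgn_mem_tangent x₀, h0, rfl⟩)
  have h1 : card H.dec x₀ = ‖H.sgn x₀‖ ^ 2 := rfl
  rw [h1, one_le_div (by positivity), ← sq]
  refine pow_le_pow_left₀ (by positivity) ?_ 2
  rw [← real_inner_self_eq_norm_sq]
  exact H.sgn_mem_dualBall x₀ _

end IsAtomicDecomposable

end Constants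

namespace RecoverySetting

variable {E : Type*} [NormedAddCommGroup E] [InnerProductSpace ℝ E] [FiniteDimensional ℝ E]
  {m : ℕ} {P : Problem E m} {H : IsAtomicDecomposable P.reg} (K : RecoverySetting P H)

lemma rate_eq : K.rate = 1 / (4 * K.ginc * (K.ρp / K.ρm)) := by
  have := K.ρm_pos
  have := K.ρp_pos
  have := one_pos.trans_le K.one_le_ginc
  rw [rate, maxStep]
  field_simp

lemma three_mul_resConst (lam : ℝ) : 3 * K.resConst lam =
    6 * K.ginc * (K.ρp / K.ρm) * K.δ * K.ck * K.G *
      (√K.ρm + √(K.ρ1 * (K.ρp / K.ρm))) ^ 2 / K.ρs * lam ^ 2 := by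
  have hm := K.ρm_pos
  have hm' := Real.sqrt_pos.2 hm
  have h1 : √K.ρm + √(K.ρ1 * (K.ρp / K.ρm)) = √K.ρm * (1 + √(K.ρ1 * K.ρp) / K.ρm) := by
    rw [← mul_div_assoc, Real.sqrt_div' _ hm.le]
    have : √(K.ρ1 * K.ρp) / √K.ρm = √K.ρm * (√(K.ρ1 * K.ρp) / K.ρm) := by
      nth_rewrite 3 [← Real.mul_self_sqrt hm.le]
      field_simp
    rw [this]; ring
  rw [h1, mul_pow, Real.sq_sqrt hm.le, resConst, resFactor, maxStep, errBound]
  have := K.ρs_pos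
  field_simp
  ring

/-- The iteration bound of a stage is at least one. -/
lemma log_inv_le [Nontrivial E] {lam δ' : ℝ} (hlam : 0 < lam) (h1 : 0 < δ') (h2 : δ' ≤ K.δ) :
    Real.log ((1 - K.rate)⁻¹) ≤ Real.log (3 * K.resConst lam / (δ' * lam) ^ 2) := by
  have hr := K.rate_le
  have hr0 : 0 < 1 - K.rate := by linarith
  have hM := K.maxStep_pos
  have hρs := K.ρs_pos
  have hδ := K.δ_pos
  have hG := K.two_le_G
  have hck := K.one_le_ck
  refine Real.log_le_log (inv_pos.2 hr0) (le_trans (b := 4 / 3) ?_ ?_)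
  · rw [inv_le_comm₀ hr0 (by norm_num)]; linarith
  have hs : K.ρs ≤ K.maxStep := by
    obtain ⟨a, ha, -⟩ := H.exists_isAtom_inner_eq (0 : E)
    have e1 := K.cone_lower a (by rw [ha.1, ha.2]; nlinarith)
    have e2 := K.upper a (by rw [ha.1, ha.2]; linarith [K.two_le_Q])
    rw [ha.2] at e1 e2
    have := le_mul_of_one_le_left K.ρp_pos.le K.one_le_ginc
    rw [maxStep]
    linarith
  have hf : 2 * K.ρs ≤ K.resFactor := by
    have hq : 0 ≤ √(K.ρ1 * K.ρp) / K.ρm := div_nonneg (Real.sqrt_nonneg _) K.ρm_pos.le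
    have : 1 ≤ (1 + √(K.ρ1 * K.ρp) / K.ρm) ^ 2 := one_le_pow₀ (by linarith)
    rw [resFactor]
    have := le_mul_of_one_le_right (by positivity : 0 ≤ 2 * K.maxStep) this
    linarith
  rw [le_div_iff₀ (by positivity), resConst, errBound]
  have hckG : 2 ≤ K.ck * K.G := by nlinarith
  calc 4 / 3 * (δ' * lam) ^ 2 = 4 / 3 * lam ^ 2 * (δ' * δ') := by ring
    _ ≤ 4 / 3 * lam ^ 2 * (K.δ * 1) := by
        refine mul_le_mul_of_nonneg_left (mul_le_mul h2 ?_ h1.le hδ.le) (by positivity)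
        linarith [K.δ_le]
    _ ≤ 12 * lam ^ 2 * K.δ := by nlinarith [mul_pos (pow_pos hlam 2) hδ]
    _ = 3 * ((2 * K.ρs) * (K.δ * lam * (lam * 2 / K.ρs))) := by field_simp; ring
    _ ≤ 3 * ((2 * K.ρs) * (K.δ * lam * (lam * K.ck * K.G / K.ρs))) := by
        have : lam * 2 ≤ lam * K.ck * K.G := by
          rw [mul_assoc]; exact mul_le_mul_of_nonneg_left hckG hlam.le
        gcongr
    _ ≤ _ := by
        have := K.ck_pos
        have := K.G_pos
        gcongr

end RecoverySetting

end ProxHomotopy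

end

theorem mainTheorem3
    {E : Type*} [NormedAddCommGroup E] [InnerProductSpace ℝ E] [FiniteDimensional ℝ E] {m : ℕ}
    (P : ProxHomotopy.Problem E m) (S : ProxHomotopy.Params)
    -- the standing conditions on the regularizing norm
    (hunit : ProxHomotopy.UnitExtremePoints P.reg)
    (hdec : ProxHomotopy.Decomposable P.reg)
    -- the measurement model
    (x₀ : E) (hx₀ : x₀ ≠ 0) (z : EuclideanSpace ℝ (Fin m)) (hb : P.b = P.A x₀ + z)
    -- inputs of the algorithm
    (lamTgt eps : ℝ) (hlamTgt : 0 < lamTgt) (heps : 0 < eps)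
    -- the constants
    (k₀ c r δ γ kt : ℝ)
    (hk₀ : k₀ = ProxHomotopy.card hdec x₀)
    (hc : c = ProxHomotopy.constC hdec x₀)
    (hγ : γ = ProxHomotopy.gammaConst P z lamTgt δ)
    (hkt : kt = ProxHomotopy.kTilde c k₀ r γ S.gammaInc)
    -- the restricted isometry assumption
    (hnoise : ProxHomotopy.dualNorm P.reg (P.adj z) ≤ lamTgt / 4)
    (hr : 1 < r) (hδ_pos : 0 < δ) (hδ_le : δ ≤ 1 / 4)
    (hratio : c / r <
      ProxHomotopy.rhoMinus P.reg P.A (c * k₀ * (1 + γ) ^ 2) /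
        ProxHomotopy.rhoPlus P.reg P.A (72 * r * c * k₀ * (1 + γ) * S.gammaInc))
    (hpos : 0 < ProxHomotopy.rhoMinus P.reg P.A (72 * r * c * k₀ * (1 + γ) * S.gammaInc))
    -- the conditions on the parameters
    (hLmin : S.Lmin ≤ S.gammaInc * ProxHomotopy.rhoPlus P.reg P.A (2 * kt))
    (hlam0 : lamTgt ≤ ProxHomotopy.lam0 P)
    (heta : (1 + S.deltaP) / (1 + δ) ≤ S.eta)
    -- a minimizer of the target problem
    (yStar : E)
    (hyStar : ∀ w : E, P.phi lamTgt yStar ≤ P.phi lamTgt w) :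
    -- each intermediate stage terminates, with a bound on its number of iterations
    (∀ t < ProxHomotopy.numStages P S lamTgt,
      ProxHomotopy.StageTerminates P S t ∧
      (ProxHomotopy.stageIters P S t : ℝ) ≤
        Real.log (ProxHomotopy.bigC P S.gammaInc c k₀ γ δ kt / S.deltaP ^ 2) /
          ProxHomotopy.logRate P S.gammaInc kt) ∧
    -- so does the final stage
    (ProxHomotopy.FinalTerminates P S lamTgt eps ∧
      (ProxHomotopy.finalIters P S lamTgt eps : ℝ) ≤
        max 1 (Real.log (ProxHomotopy.bigC P S.gammaInc c k₀ γ δ kt * lamTgt ^ 2 / eps ^ 2) /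
          ProxHomotopy.logRate P S.gammaInc kt)) ∧
    -- the objective gap of the output
    P.phi lamTgt (ProxHomotopy.homotopyOutput P S lamTgt eps) - P.phi lamTgt yStar ≤
      9 * c * k₀ * lamTgt * (1 + γ) * eps /
        ProxHomotopy.rhoMinus P.reg P.A (c * (1 + γ) ^ 2 * k₀) ∧
    -- the total number of iterations
    (ProxHomotopy.totalIters P S lamTgt eps : ℝ) ≤
      max 1 (Real.log (ProxHomotopy.bigC P S.gammaInc c k₀ γ δ kt * lamTgt ^ 2 / eps ^ 2) /
          ProxHomotopy.logRate P S.gammaInc kt) +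
        Real.log (lamTgt / ProxHomotopy.lam0 P) / Real.log S.eta *
          (Real.log (ProxHomotopy.bigC P S.gammaInc c k₀ γ δ kt / S.deltaP ^ 2) /
            ProxHomotopy.logRate P S.gammaInc kt) := by
  have H : ProxHomotopy.IsAtomicDecomposable P.reg := ⟨P.reg_definite, hunit, hdec⟩
  have : Nontrivial E := ⟨⟨x₀, 0, hx₀⟩⟩
  have hk1 : 1 ≤ k₀ := hk₀ ▸ H.one_le_card hx₀
  have hc1 : 1 ≤ c := hc ▸ H.one_le_constC hx₀
  have hg1 := S.one_lt_gammaInc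
  set n := ProxHomotopy.dualNorm P.reg (P.adj z) with hn
  have hn0 : 0 ≤ n := H.dualNorm_nonneg _
  have hD : lamTgt / 2 ≤ lamTgt * (1 - δ) - n := by nlinarith
  have hGD : (1 + γ) * (lamTgt * (1 - δ) - n) = 2 * lamTgt := by
    rw [hγ, ProxHomotopy.gammaConst, ← hn, add_mul, div_mul_cancel₀ _ (by linarith)]
    ring
  have hG0 : 0 < 1 + γ := pos_of_mul_pos_left (by rw [hGD]; linarith) (by linarith)
  have hG2 : 2 ≤ 1 + γ := by
    refine le_of_mul_le_mul_right ?_ hlamTgt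
    rw [← hGD]
    exact mul_le_mul_of_nonneg_left (by nlinarith) hG0.le
  have hgain : ∀ lam, lamTgt ≤ lam → 2 * lam ≤ (1 + γ) * ((1 - δ) * lam - n) := by
    intro lam hlam
    have h1 : 2 ≤ (1 + γ) * (1 - δ) := by
      refine le_of_mul_le_mul_right ?_ hlamTgt
      nlinarith
    nlinarith
  set Q := r * c * k₀ * (1 + γ) * S.gammaInc with hQ
  have hQ2 : 2 ≤ Q := by
    have e1 : 1 ≤ r * c := one_le_mul_of_one_le_of_one_le hr.le hc1
    have e2 : 1 ≤ r * c * k₀ := one_le_mul_of_one_le_of_one_le e1 hk1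
    have e3 : 2 ≤ r * c * k₀ * (1 + γ) := by nlinarith
    exact e3.trans (le_mul_of_one_le_right (by linarith) hg1.le)
  have e72 : 72 * r * c * k₀ * (1 + γ) * S.gammaInc = 72 * Q := by rw [hQ]; ring
  have ekt : 2 * kt = 72 * Q := by rw [hkt, ProxHomotopy.kTilde, hQ]; ring
  have econe : c * (1 + γ) ^ 2 * k₀ = c * k₀ * (1 + γ) ^ 2 := by ring
  rw [e72] at hratio hpos
  rw [ekt] at hLmin
  have hc_r : 0 < c / r := by positivity
  have hρp : 0 < ProxHomotopy.rhoPlus P.reg P.A (72 * Q) := by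
    refine ProxHomotopy.rhoPlus_nonneg.lt_of_ne fun h => ?_
    rw [← h, div_zero] at hratio
    exact absurd hratio (not_lt.2 hc_r.le)
  have hcr : c * ProxHomotopy.rhoPlus P.reg P.A (72 * Q) <
      ProxHomotopy.rhoMinus P.reg P.A (c * k₀ * (1 + γ) ^ 2) * r := by
    rwa [div_lt_div_iff₀ (by linarith) hρp] at hratio
  have hρs : 0 < ProxHomotopy.rhoMinus P.reg P.A (c * k₀ * (1 + γ) ^ 2) :=
    (pos_iff_pos_of_mul_pos ((mul_pos (by linarith) hρp).trans hcr)).2 (by linarith)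
  let K : ProxHomotopy.RecoverySetting P H :=
    { x₀ := x₀, z := z, ck := c * k₀, G := 1 + γ, Q := Q, δ := δ, lamT := lamTgt,
      ρs := ProxHomotopy.rhoMinus P.reg P.A (c * k₀ * (1 + γ) ^ 2)
      ρp := ProxHomotopy.rhoPlus P.reg P.A (72 * Q)
      ρm := ProxHomotopy.rhoMinus P.reg P.A (72 * Q)
      ρ1 := ProxHomotopy.rhoPlus P.reg P.A 1
      ginc := S.gammaInc
      b_eq := hb
      one_le_ck := one_le_mul_of_one_le_of_one_le hc1 hk1
      two_le_G := hG2
      two_le_Q := hQ2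
      δ_pos := hδ_pos
      δ_le := hδ_le
      lamT_pos := hlamTgt
      noise := hnoise
      ρs_pos := hρs
      ρp_pos := hρp
      ρm_pos := hpos
      ρ1_nonneg := ProxHomotopy.rhoPlus_nonneg
      one_le_ginc := hg1.le
      tangent_le := fun t ht => by
        rw [hc, hk₀]; exact H.apply_sq_le_of_mem_tangent hx₀ ht
      gain := hgain
      cone_lower := fun x hx => ProxHomotopy.rhoMinus_mul_le hx
      lower := fun x hx => ProxHomotopy.rhoMinus_mul_le hx
      upper := fun x hx => ProxHomotopy.le_rhoPlus_mul hx
      atom_upper := fun x hx => ProxHomotopy.le_rhoPlus_mul (by rwa [one_mul])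
      ratio := by
        have h1 : 0 ≤ k₀ * (1 + γ) * S.gammaInc := by positivity
        have h2 := mul_le_mul_of_nonneg_right hcr.le h1
        have h3 : 0 ≤ ProxHomotopy.rhoMinus P.reg P.A (c * k₀ * (1 + γ) ^ 2) * r *
          (k₀ * (1 + γ) * S.gammaInc) := by positivity
        have h4 := mul_le_mul_of_nonneg_left hc1 h3
        rw [hQ]
        linarith }
  have heta' : 1 + S.deltaP ≤ S.eta * (1 + K.δ) := (div_le_iff₀ (by linarith)).1 heta
  have hδ' : S.deltaP ≤ K.δ := by
    have : S.eta * (1 + δ) ≤ 1 * (1 + δ) :=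
      mul_le_mul_of_nonneg_right S.eta_lt_one.le (by linarith)
    change 1 + S.deltaP ≤ S.eta * (1 + δ) at heta'
    change S.deltaP ≤ δ
    linarith
  have hrate : ProxHomotopy.logRate P S.gammaInc kt = Real.log ((1 - K.rate)⁻¹) := by
    rw [ProxHomotopy.logRate, ProxHomotopy.kappa, ekt, K.rate_eq]
  have hC : ∀ lam, ProxHomotopy.bigC P S.gammaInc c k₀ γ δ kt * lam ^ 2 = 3 * K.resConst lam := by
    intro lam
    rw [K.three_mul_resConst, ProxHomotopy.bigC, ProxHomotopy.kappa, ekt, econe]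
    simp only [K]
    ring
  have hΘ : 0 < Real.log ((1 - K.rate)⁻¹) := by
    have h1 := K.rate_le
    have h2 := K.rate_pos
    exact Real.log_pos ((one_lt_inv₀ (by linarith)).2 (by linarith))
  set T := Real.log (ProxHomotopy.bigC P S.gammaInc c k₀ γ δ kt / S.deltaP ^ 2) /
    ProxHomotopy.logRate P S.gammaInc kt with hT
  have hstage_eq : ∀ lam, 0 < lam → 3 * K.resConst lam / (S.deltaP * lam) ^ 2 =
      ProxHomotopy.bigC P S.gammaInc c k₀ γ δ kt / S.deltaP ^ 2 := by
    intro lam hlam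
    rw [← hC, mul_pow, mul_div_mul_right _ _ (by positivity)]
  have hT1 : 1 ≤ T := by
    have := K.log_inv_le hlamTgt S.deltaP_pos hδ'
    rw [hstage_eq _ hlamTgt] at this
    rwa [hT, hrate, one_le_div hΘ]
  have hstages : ∀ t < ProxHomotopy.numStages P S lamTgt,
      ProxHomotopy.StageTerminates P S t ∧ (ProxHomotopy.stageIters P S t : ℝ) ≤ T := by
    intro t ht
    have hl := K.lam_pos (K.lamT_le_lamSeq (S := S) hlam0 (t := t + 1) ht)
    obtain ⟨h1, h2⟩ := K.proxGrad_terminates rfl hLmin (K.lamT_le_lamSeq hlam0 ht)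
      (K.good_stage rfl hLmin hlam0 heta' ht) (mul_pos S.deltaP_pos hl)
    refine ⟨h1, h2.trans ?_⟩
    rw [hstage_eq _ hl, ← hrate]
    exact max_le hT1 le_rfl
  have hfinal := K.proxGrad_terminates rfl hLmin le_rfl (K.good_final rfl hLmin hlam0 heta') heps
  rw [← hC, ← hrate] at hfinal
  refine ⟨hstages, hfinal, ?_, ?_⟩
  · refine (K.phi_homotopyOutput_sub_le rfl hLmin hlam0 heta' heps yStar).trans ?_
    rw [econe]
    have h1 := K.errBound_pos (lam := lamTgt) le_rfl
    have h2 : 9 * c * k₀ * lamTgt * (1 + γ) * eps /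
        ProxHomotopy.rhoMinus P.reg P.A (c * k₀ * (1 + γ) ^ 2) =
        eps * (9 * K.errBound lamTgt) := by
      simp only [ProxHomotopy.RecoverySetting.errBound, K]; ring
    rw [h2]
    refine mul_le_mul_of_nonneg_left ?_ heps.le
    change 3 / 2 * K.errBound lamTgt ≤ _
    linarith
  · have hsum : ∑ t ∈ Finset.range (ProxHomotopy.numStages P S lamTgt),
        (ProxHomotopy.stageIters P S t : ℝ) ≤ ProxHomotopy.numStages P S lamTgt * T := by
      have := Finset.sum_le_card_nsmul (Finset.range (ProxHomotopy.numStages P S lamTgt))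
        (fun t => (ProxHomotopy.stageIters P S t : ℝ)) T
        fun t ht => (hstages t (Finset.mem_range.1 ht)).2
      simpa using this
    have hl0 : 0 < ProxHomotopy.lam0 P := hlamTgt.trans_le hlam0
    have hN : (ProxHomotopy.numStages P S lamTgt : ℝ) ≤
        Real.log (lamTgt / ProxHomotopy.lam0 P) / Real.log S.eta :=
      Nat.floor_le (div_nonneg_of_nonpos
        (Real.log_nonpos (by positivity) ((div_le_one hl0).2 hlam0))
        (Real.log_neg S.eta_pos S.eta_lt_one).le)
    have hN' := mul_le_mul_of_nonneg_right hN (zero_le_one.trans hT1)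
    rw [ProxHomotopy.totalIters]
    push_cast
    rw [add_comm (max _ _)]
    exact add_le_add (hsum.trans hN') hfinal.2
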